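/- Let $V_1,V_2,\Gamma_1,\Gamma_2:\mathbb R\to\mathbb R$ be bounded, measurable and $1$-periodic with $\operatorname{ess\,sup}\Gamma_i>0$ for $i=1,2$, and let $1<p<\infty$. Put $V=V_1$, $\Gamma=\Gamma_1$ on $(0,\infty)$ and $V=V_2$, $\Gamma=\Gamma_2$ on $(-\infty,0)$. For $\lambda\in\mathbb R$ let $L_\lambda=-\frac{d^2}{dx^2}+V-\lambda$ on $L^2(\mathbb R)$ with domain $H^2(\mathbb R)$. Let $$J_\lambda[u]=\int_{\mathbb R}\Big(\tfrac12\big(|u'|^2+(V-\lambda)u^2\big)-\tfrac1{p+1}\Gamma|u|^{p+1}\Big)dx,$$ $$N_\lambda=\Big\{u\in H^1(\mathbb R): u\neq0,\ \int_{\mathbb R}\big(|u'|^2+(V-\lambda)u^2-\Gamma|u|^{p+1}\big)dx=0\Big\}.$$ A strong ground state of $L_\lambda u=\Gamma|u|^{p-1}u$ is a $w\in N_\lambda$ with $J_\lambda[w]=\inf_{N_\lambda}J_\lambda$. For $i=1,2$ let $c_i=c_i(\lambda)$ be the ground state energy of $-u''+(V_i-\lambda)u=\Gamma_i|u|^{p-1}u$,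 i.e. the least value of $\int_{\mathbb R}\big(\tfrac12(|u'|^2+(V_i-\lambda)u^2)-\tfrac1{p+1}\Gamma_i|u|^{p+1}\big)dx$ among all nontrivial weak solutions $u\in H^1(\mathbb R)$. The Bloch mode of $-\frac{d^2}{dx^2}+V_1-\lambda$ decaying at $-\infty$ is the solution of $-u''+(V_1-\lambda)u=0$ on $\mathbb R$ of the form $u(x)=p_-(x)e^{\kappa x}$ with $\kappa>0$ and $p_-$ positive, $1$-periodic, $\|p_-\|_\infty=1$. Consider the condition $$\int_{-1}^0\big(V_2(x)-V_1(x)\big)\,p_-(x)^2e^{2\kappa x}\,dx<0.\qquad(*)$$ (a) If $\lambda\in\mathbb R$ is such that $0<\min\sigma(L_\lambda)$ and $c_1(\lambda)\le c_2(\lambda)$, then this Bloch mode exists and is unique, and if $(*)$ holds, then $L_\lambda u=\Gamma|u|^{p-1}u$ has a strong ground state. (b) If for some $\varepsilon>0$ the potentials $V_1,V_2$ are continuous on $[-\varepsilon,0)$ and $V_2(x)<V_1(x)$ for all $x\in[-\varepsilon,0)$, then for all sufficiently negative $\lambda$ the Bloch mode exists, is unique, and satisfies $(*)$. In particular, the same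 conclusion holds if $V_1,V_2$ are $C^1$ near $x=0$ and either $V_2(0)<V_1(0)$, or $V_2(0)=V_1(0)$ and $V_2'(0)>V_1'(0)$. -/

import Mathlib

open MeasureTheory Set Filter

noncomputable section

namespace InterfaceNLS

/-- `v` is the weak (distributional) derivative of `u` on the real line; applied below to `L²`
functions, so that all integrals converge. -/
def IsWeakDeriv {E : Type*} [NormedAddCommGroup E] [NormedSpace ℝ E] (u v : ℝ → E) : Prop :=
  ∀ φ : ℝ → ℝ, ContDiff ℝ (⊤ : ℕ∞) φ → HasCompactSupport φ →
    ∫ x, deriv φ x • u x = -∫ x, φ x • v x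

/-- An element of the real Sobolev space `H¹(ℝ)`: a square integrable function together with its
(almost everywhere unique) square integrable weak derivative. Two elements represent the same
vector of `H¹(ℝ)` exactly when their values agree almost everywhere. -/
structure H1 where
  val : ℝ → ℝ
  der : ℝ → ℝ
  memLp_val : MemLp val 2 volume
  memLp_der : MemLp der 2 volume
  isWeakDeriv : IsWeakDeriv val der

/-- The element `u` is not the zero vector of `H¹(ℝ)`. -/
def H1.Nontrivial (u : H1) : Prop := ¬ u.val =ᵐ[volume] 0

/-- The energy `∫ (1/2) (|u'|² + W u²) - (1/(p+1)) Γ |u|^(p+1)`. -/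
def energy (W Γ : ℝ → ℝ) (p : ℝ) (u : H1) : ℝ :=
  ∫ x, ((1 / 2) * ((u.der x) ^ 2 + W x * (u.val x) ^ 2)
    - (1 / (p + 1)) * (Γ x * |u.val x| ^ (p + 1)))

/-- The Nehari manifold of `-u'' + W u = Γ |u|^(p-1) u`. -/
def nehari (W Γ : ℝ → ℝ) (p : ℝ) : Set H1 :=
  {u | u.Nontrivial ∧
    ∫ x, ((u.der x) ^ 2 + W x * (u.val x) ^ 2 - Γ x * |u.val x| ^ (p + 1)) = 0}

/-- Strong ground state: an element of the Nehari manifold whose energy is the infimum of the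
energy over the Nehari manifold. -/
def IsStrongGroundState (W Γ : ℝ → ℝ) (p : ℝ) (w : H1) : Prop :=
  w ∈ nehari W Γ p ∧ IsGLB (energy W Γ p '' nehari W Γ p) (energy W Γ p w)

/-- Bound state: weak `H¹` solution of `-u'' + W u = Γ |u|^(p-1) u` on the real line. -/
def IsBoundState (W Γ : ℝ → ℝ) (p : ℝ) (u : H1) : Prop :=
  ∀ φ : ℝ → ℝ, ContDiff ℝ (⊤ : ℕ∞) φ → HasCompactSupport φ →
    ∫ x, (u.der x * deriv φ x + W x * u.val x * φ x)
      = ∫ x, Γ x * |u.val x| ^ (p - 1) * u.val x * φ x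

/-- Ground state energy: the least energy among all nontrivial bound states. -/
def groundEnergy (W Γ : ℝ → ℝ) (p : ℝ) : ℝ :=
  sInf (energy W Γ p '' {u | IsBoundState W Γ p u ∧ u.Nontrivial})

/-- The graph of the operator `-d²/dx² + W` on `L²(ℝ; ℂ)` with domain `H²(ℝ)`. -/
def schrodingerGraph (W : ℝ → ℝ) :
    Set (Lp ℂ 2 (volume : Measure ℝ) × Lp ℂ 2 (volume : Measure ℝ)) :=
  {uf | ∃ u' u'' : ℝ → ℂ, MemLp u' 2 volume ∧ MemLp u'' 2 volume ∧
    IsWeakDeriv (uf.1 : ℝ → ℂ) u' ∧ IsWeakDeriv u' u'' ∧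
    (uf.2 : ℝ → ℂ) =ᵐ[volume] fun x => -u'' x + (W x : ℂ) * (uf.1 : ℝ → ℂ) x}

/-- The spectrum of `-d²/dx² + W` on `L²(ℝ; ℂ)` with domain `H²(ℝ)`: those `z` for which
`-d²/dx² + W - z` is not a bijection of `H²(ℝ)` onto `L²(ℝ; ℂ)` with a bounded inverse `R`. -/
def schrodingerSpectrum (W : ℝ → ℝ) : Set ℂ :=
  {z | ¬ ∃ R : Lp ℂ 2 (volume : Measure ℝ) →L[ℂ] Lp ℂ 2 (volume : Measure ℝ),
    ∀ f u, R f = u ↔ (u, f + z • u) ∈ schrodingerGraph W}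

/-- `0 < min σ(-d²/dx² + W)` (the operator is self-adjoint, so its spectrum is real). -/
def PositiveSpectrum (W : ℝ → ℝ) : Prop :=
  ∃ m : ℝ, IsLeast {μ : ℝ | (μ : ℂ) ∈ schrodingerSpectrum W} m ∧ 0 < m

/-- `u` is a (strong, Carathéodory) solution of `-u'' + W u = 0` on the real line: it is `C¹` with
absolutely continuous derivative and satisfies the equation almost everywhere. -/
def SolvesHill (W u : ℝ → ℝ) : Prop :=
  ∃ u' : ℝ → ℝ, (∀ x, HasDerivAt u (u' x) x) ∧ ∀ a b : ℝ, u' b - u' a = ∫ x in a..b, W x * u x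

/-- `q(x) exp(κ x)` is the Bloch mode of `-d²/dx² + W` (with `W` of period one) decaying at `-∞`,
with positive periodic part `q` normalized by `‖q‖_∞ = 1`. -/
structure IsLeftBlochMode (W : ℝ → ℝ) (κ : ℝ) (q : ℝ → ℝ) : Prop where
  kappa_pos : 0 < κ
  periodic : Function.Periodic q 1
  pos : ∀ x, 0 < q x
  isLUB : IsLUB (range q) 1
  solves : SolvesHill W (fun x => q x * Real.exp (κ * x))

/-- The Bloch mode of `-d²/dx² + V₁ - lam` decaying at `-∞` exists and is unique. -/
def HasUniqueBlochMode (V₁ : ℝ → ℝ) (lam : ℝ) : Prop :=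
  ∃! m : ℝ × (ℝ → ℝ), IsLeftBlochMode (fun x => V₁ x - lam) m.1 m.2

/-- `∫_{-1}^0 (V₂ - V₁) q² exp(2 κ x) dx < 0`, where `q(x) exp(κ x)` is the Bloch mode of
`-d²/dx² + V₁ - lam` decaying at `-∞`. -/
def BlochCondition (V₁ V₂ : ℝ → ℝ) (lam : ℝ) : Prop :=
  ∃ (κ : ℝ) (q : ℝ → ℝ), IsLeftBlochMode (fun x => V₁ x - lam) κ q ∧
    ∫ x in (-1 : ℝ)..0, (V₂ x - V₁ x) * (q x) ^ 2 * Real.exp (2 * κ * x) < 0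

/-- The function equal to `f₁` on the right and to `f₂` on the left of the interface `x = 0`
(the value at the single point `0` plays no role). -/
def interface (f₁ f₂ : ℝ → ℝ) (x : ℝ) : ℝ := if 0 < x then f₁ x else f₂ x

/-- A bounded, Lebesgue measurable function of period one. -/
structure IsCoefficient (f : ℝ → ℝ) : Prop where
  measurable : AEMeasurable f volume
  bounded : ∃ C : ℝ, ∀ x, |f x| ≤ C
  periodic : Function.Periodic f 1

end InterfaceNLS

end

/-! Write `r = p + 1`, `a(u) = ∫ u'² + W u²` for the quadratic form (`form`) and `B(u) = ∫ Γ |u|^r`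
for the potential energy (`pot`). Everything is phrased through the scale-invariant ratio `B(u) /
a(u)^(r/2)` and its supremum `S`, with `S₁`, `S₂` the suprema for the two periodic problems.

A positive spectral bottom makes `a` coercive on `H¹(ℝ)` (`exists_coercive_of_positiveSpectrum`),
and translation to `±∞` passes this to both periodic forms. A maximizer of the ratio, scaled so that
`a = B`, is a critical point and satisfies `S a^(r/2-1) = 1`. On the Nehari manifold the energy is
`(1/2 - 1/r) a`, so maximizing the ratio is the same as minimizing the energy, and `c₁ ≤ c₂` becomes
`S₂ ≤ S₁` (`IsExtremal.ratio_le_of_groundEnergy_le`).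

By concentration compactness (`ratioAttains_or`), a maximizing sequence cannot vanish, and after
integer translations it has a nonzero weak limit. The limit attains `S` for the interface problem if
the translations stay bounded, and for one of the periodic problems otherwise. In the latter case `S
≤ S₁`, directly or through `S₂ ≤ S₁`, so it remains to exclude `S ≤ S₁`.

This is `IsExtremal.not_ratioLe`. Shift a ground state of problem 1 far to the right to get `w`, and
replace `w` on the left half line by the multiple `β φ` of the Bloch mode that agrees with it at
`0`. Let `h` be the difference. Since `φ` solves the linear equation and `h(0) = 0`, the two pieces
are orthogonal, and the form changes by `-a₁(h) + β² J` with `J = ∫_{-∞}^0 (V₂ - V₁) φ²`. By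
quasi-periodicity `J` is a geometric series times the integral in the Bloch condition, hence
negative. The change of `B` is superquadratic in a small quantity, so it is dominated by this gain.
Thus `S ≤ S₁` would force `β = 0` and `h = 0`, so the ground state would vanish on a half line,
against unique continuation. No sign or decay rate of the ground state is needed.

The Bloch mode comes from the Green's function `G` with pole `0`: on the left half line truncation
arguments show that `G` is positive and that `G(x - 1)` is a constant multiple of `G(x)`. Uniqueness
is constancy of the Wronskian. For part (b), `V₁ - λ ≥ k` with `k` large makes `φ` convex,
increasing and rapidly growing, so the region next to `0`, where `V₂ < V₁`, outweighs the rest of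
the period. -/

namespace InterfaceNLS

open scoped Topology

/-! ### Locally absolutely continuous functions. -/

/-- `u` is locally absolutely continuous with almost everywhere derivative `v`. -/
structure IsPrim (u v : ℝ → ℝ) : Prop where
  locInt : LocallyIntegrable v volume
  sub_eq : ∀ a b, u b - u a = ∫ x in a..b, v x

lemma locallyIntegrable_intervalIntegrable {v : ℝ → ℝ} (hv : LocallyIntegrable v volume) (a b : ℝ) :
    IntervalIntegrable v volume a b :=
  intervalIntegrable_iff.mpr <|
    (hv.integrableOn_isCompact isCompact_uIcc).mono_set uIoc_subset_uIcc

namespace IsPrim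

variable {u v f g : ℝ → ℝ}

lemma intervalIntegrable (h : IsPrim u v) (a b : ℝ) : IntervalIntegrable v volume a b :=
  locallyIntegrable_intervalIntegrable h.locInt a b

lemma eq_add (h : IsPrim u v) (a : ℝ) : u = fun x => u a + ∫ t in a..x, v t := by
  funext x; linarith [h.sub_eq a x]

lemma continuous (h : IsPrim u v) : Continuous u := by
  rw [h.eq_add 0]
  exact continuous_const.add (intervalIntegral.continuous_primitive h.intervalIntegrable 0)

lemma absolutelyContinuousOnInterval (h : IsPrim u v) (a b : ℝ) :
    AbsolutelyContinuousOnInterval u a b := by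
  rw [h.eq_add a]
  exact ((LipschitzWith.const (u a)).lipschitzOnWith.absolutelyContinuousOnInterval).add
    ((h.intervalIntegrable a b).absolutelyContinuousOnInterval_intervalIntegral left_mem_uIcc)

lemma ae_hasDerivAt (h : IsPrim u v) : ∀ᵐ x, HasDerivAt u (v x) x := by
  filter_upwards [_root_.LocallyIntegrable.ae_hasDerivAt_integral h.locInt] with x hx
  rw [h.eq_add 0]
  simpa using (hx 0).const_add (u 0)

lemma hasDerivAt (h : IsPrim u v) {x : ℝ} (hv : ContinuousAt v x) : HasDerivAt u (v x) x := by
  rw [h.eq_add 0]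
  refine HasDerivAt.const_add _ (intervalIntegral.integral_hasDerivAt_right
    (h.intervalIntegrable 0 x) ?_ hv)
  exact ⟨univ, univ_mem, by simpa using h.locInt.aestronglyMeasurable⟩

lemma of_hasDerivAt (hu : ∀ x, HasDerivAt u (v x) x) (hv : Continuous v) : IsPrim u v :=
  ⟨hv.locallyIntegrable, fun a b => (intervalIntegral.integral_eq_sub_of_hasDerivAt
    (fun x _ => hu x) (hv.intervalIntegrable a b)).symm⟩

lemma primitive (hv : LocallyIntegrable v volume) (c : ℝ) :
    IsPrim (fun x => c + ∫ t in (0 : ℝ)..x, v t) v := by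
  refine ⟨hv, fun a b => ?_⟩
  have hi := locallyIntegrable_intervalIntegrable hv
  have := intervalIntegral.integral_interval_sub_left (hi 0 b) (hi 0 a)
  linarith

lemma congr_ae (h : IsPrim u v) (hg : v =ᵐ[volume] g) : IsPrim u g := by
  refine ⟨h.locInt.congr hg, fun a b => ?_⟩
  rw [h.sub_eq]
  exact intervalIntegral.integral_congr_ae (hg.mono fun x hx _ => hx)

lemma add (h : IsPrim u v) (h' : IsPrim f g) :
    IsPrim (fun x => u x + f x) (fun x => v x + g x) := by
  refine ⟨h.locInt.add h'.locInt, fun a b => ?_⟩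
  rw [intervalIntegral.integral_add (h.intervalIntegrable a b) (h'.intervalIntegrable a b),
    ← h.sub_eq, ← h'.sub_eq]
  ring

lemma const_mul (h : IsPrim u v) (c : ℝ) : IsPrim (fun x => c * u x) (fun x => c * v x) := by
  refine ⟨h.locInt.smul c, fun a b => ?_⟩
  rw [intervalIntegral.integral_const_mul, ← h.sub_eq]
  ring

lemma sub (h : IsPrim u v) (h' : IsPrim f g) :
    IsPrim (fun x => u x - f x) (fun x => v x - g x) := by
  have := h.add (h'.const_mul (-1))
  simpa [sub_eq_add_neg] using this

lemma comp_add (h : IsPrim u v) (c : ℝ) : IsPrim (fun x => u (x + c)) (fun x => v (x + c)) := by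
  refine ⟨?_, fun a b => ?_⟩
  · intro x
    obtain ⟨s, hs, hi⟩ := h.locInt (x + c)
    refine ⟨(fun y => y + c) ⁻¹' s, (continuous_add_const c).continuousAt hs, ?_⟩
    exact ((measurePreserving_add_right volume c).integrableOn_comp_preimage
      (measurableEmbedding_addRight c)).2 hi
  · rw [intervalIntegral.integral_comp_add_right, h.sub_eq]

lemma mul (h : IsPrim u v) (h' : IsPrim f g) :
    IsPrim (fun x => u x * f x) (fun x => v x * f x + u x * g x) := by
  have hl : LocallyIntegrable (fun x => v x * f x + u x * g x) volume := by
    refine LocallyIntegrable.add ?_ ?_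
    · have := h.locInt.smul_continuous h'.continuous
      exact this
    · have := h'.locInt.continuous_smul h.continuous
      exact this
  refine ⟨hl, fun a b => ?_⟩
  rw [← (h.absolutelyContinuousOnInterval a b).integral_deriv_mul_eq_sub
    (h'.absolutelyContinuousOnInterval a b)]
  refine intervalIntegral.integral_congr_ae ?_
  filter_upwards [h.ae_hasDerivAt, h'.ae_hasDerivAt] with x h1 h2 _
  rw [h1.deriv, h2.deriv]

lemma tendsto_atBot (h : IsPrim u v) (b : ℝ) (hv : IntegrableOn v (Iic b)) :
    Tendsto u atBot (𝓝 (u b - ∫ x in Iic b, v x)) := by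
  have := (intervalIntegral_tendsto_integral_Iic b hv tendsto_id).const_sub (u b)
  refine this.congr fun x => ?_
  rw [id, ← h.sub_eq]; ring

lemma tendsto_atTop (h : IsPrim u v) (a : ℝ) (hv : IntegrableOn v (Ioi a)) :
    Tendsto u atTop (𝓝 (u a + ∫ x in Ioi a, v x)) := by
  have := (intervalIntegral_tendsto_integral_Ioi a hv tendsto_id).const_add (u a)
  refine this.congr fun x => ?_
  rw [id, ← h.sub_eq]; ring

/-- An integrable derivative gives `u` a limit at `-∞`; since `u` is itself integrable and
neighbourhoods of `-∞` have infinite measure, that limit is zero. -/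
lemma integral_Iic (h : IsPrim u v) (b : ℝ) (hu : IntegrableOn u (Iic b))
    (hv : IntegrableOn v (Iic b)) : ∫ x in Iic b, v x = u b := by
  have h1 : IntegrableAtFilter u atBot volume := ⟨Iic b, Iic_mem_atBot b, hu⟩
  have := h1.eq_zero_of_tendsto (by
    intro s hs
    obtain ⟨c, hc⟩ := mem_atBot_sets.1 hs
    exact top_le_iff.1 ((Real.volume_Iic (a := c)).symm.le.trans (measure_mono hc)))
    (h.tendsto_atBot b hv)
  linarith

lemma tendsto_zero_atBot (h : IsPrim u v) (b : ℝ) (hu : IntegrableOn u (Iic b))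
    (hv : IntegrableOn v (Iic b)) : Tendsto u atBot (𝓝 0) := by
  have := h.tendsto_atBot b hv
  rwa [h.integral_Iic b hu hv, sub_self] at this

lemma integral_Ioi (h : IsPrim u v) (a : ℝ) (hu : IntegrableOn u (Ioi a))
    (hv : IntegrableOn v (Ioi a)) : ∫ x in Ioi a, v x = - u a := by
  have h1 : IntegrableAtFilter u atTop volume := ⟨Ioi a, Ioi_mem_atTop a, hu⟩
  have := h1.eq_zero_of_tendsto (by
    intro s hs
    obtain ⟨c, hc⟩ := mem_atTop_sets.1 hs
    exact top_le_iff.1 ((Real.volume_Ici (a := c)).symm.le.trans (measure_mono hc)))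
    (h.tendsto_atTop a hv)
  linarith

lemma integral_eq_zero (h : IsPrim u v) (hu : Integrable u) (hv : Integrable v) :
    ∫ x, v x = 0 := by
  rw [← integral_add_compl (measurableSet_Iic (a := (0 : ℝ))) hv, compl_Iic,
    h.integral_Iic 0 hu.integrableOn hv.integrableOn,
    h.integral_Ioi 0 hu.integrableOn hv.integrableOn]
  ring

/-- Truncation at a zero. -/
lemma cut (h : IsPrim u v) {b : ℝ} (hb : u b = 0) :
    IsPrim ((Iic b).indicator u) ((Iic b).indicator v) := by
  have hl : LocallyIntegrable ((Iic b).indicator v) volume := h.locInt.indicator measurableSet_Iic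
  refine ⟨hl, ?_⟩
  have key : ∀ x, (Iic b).indicator u x = ∫ t in b..x, (Iic b).indicator v t := by
    intro x
    rcases le_total x b with hx | hx
    · rw [indicator_of_mem (by exact hx), ← sub_zero (u x), ← hb, h.sub_eq b x]
      refine intervalIntegral.integral_congr fun t ht => ?_
      rw [uIcc_of_ge hx] at ht
      rw [indicator_of_mem (by exact ht.2)]
    · have : ∫ t in b..x, (Iic b).indicator v t = 0 := by
        rw [intervalIntegral.integral_of_le hx]
        refine setIntegral_eq_zero_of_forall_eq_zero fun t ht => ?_
        rw [indicator_of_notMem (by simpa using ht.1)]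
      rw [this]
      rcases hx.eq_or_lt with rfl | hx'
      · rw [indicator_of_mem (by simp), hb]
      · rw [indicator_of_notMem (by simpa using hx')]
  intro a c
  rw [key a, key c]
  have hi := locallyIntegrable_intervalIntegrable hl
  exact intervalIntegral.integral_interval_sub_left (hi b c) (hi b a)

end IsPrim

/-! ### The space `H¹(ℝ)` through continuous representatives. -/

/-- `u` is the continuous representative of an element of `H¹(ℝ)` with weak derivative `v`. -/
structure IsH1 (u v : ℝ → ℝ) : Prop where
  prim : IsPrim u v
  memLp : MemLp u 2 volume
  memLp_der : MemLp v 2 volume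

/-- The square of the `H¹` norm. -/
noncomputable def normSq (u v : ℝ → ℝ) : ℝ := (∫ x, u x ^ 2) + ∫ x, v x ^ 2

lemma integrable_mul_of_memLp {u f : ℝ → ℝ} (hu : MemLp u 2 volume) (hf : MemLp f 2 volume) :
    Integrable (fun x => u x * f x) := hu.integrable_mul hf

/-- Cauchy–Schwarz, read off from the discriminant of the nonnegative quadratic `t ↦ ∫ (|u| - t
|f|)²`. -/
lemma integral_abs_mul_le_of_memLp {u f : ℝ → ℝ} (hu : MemLp u 2 volume) (hf : MemLp f 2 volume) :
    (∫ x, |u x * f x|) ^ 2 ≤ (∫ x, u x ^ 2) * ∫ x, f x ^ 2 := by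
  have h := integrable_mul_of_memLp hu hf
  have key : ∀ t : ℝ, 0 ≤ (∫ x, f x ^ 2) * (t * t) + (-2 * ∫ x, |u x * f x|) * t
      + ∫ x, u x ^ 2 := by
    intro t
    have : (∫ x, f x ^ 2) * (t * t) + (-2 * ∫ x, |u x * f x|) * t + ∫ x, u x ^ 2
        = ∫ x, (|u x| - t * |f x|) ^ 2 := by
      have e : ∀ x, (|u x| - t * |f x|) ^ 2
          = (t * t) * f x ^ 2 + (-2 * t) * |u x * f x| + u x ^ 2 := by
        intro x
        rw [abs_mul, sub_sq, mul_pow, sq_abs, sq_abs]; ring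
      simp_rw [e]
      rw [integral_add ((hf.integrable_sq.const_mul _).fun_add (h.abs.const_mul _)) hu.integrable_sq,
        integral_add (hf.integrable_sq.const_mul _) (h.abs.const_mul _),
        integral_const_mul, integral_const_mul]
      ring
    rw [this]
    exact integral_nonneg fun x => sq_nonneg _
  have := discrim_le_zero key
  rw [discrim] at this
  nlinarith

namespace IsH1

variable {u v f g : ℝ → ℝ}

lemma continuous (h : IsH1 u v) : Continuous u := h.prim.continuous

lemma add (h : IsH1 u v) (h' : IsH1 f g) : IsH1 (fun x => u x + f x) (fun x => v x + g x) :=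
  ⟨h.prim.add h'.prim, h.memLp.add h'.memLp, h.memLp_der.add h'.memLp_der⟩

lemma sub (h : IsH1 u v) (h' : IsH1 f g) : IsH1 (fun x => u x - f x) (fun x => v x - g x) :=
  ⟨h.prim.sub h'.prim, h.memLp.sub h'.memLp, h.memLp_der.sub h'.memLp_der⟩

lemma const_mul (h : IsH1 u v) (c : ℝ) : IsH1 (fun x => c * u x) (fun x => c * v x) :=
  ⟨h.prim.const_mul c, h.memLp.const_mul c, h.memLp_der.const_mul c⟩

lemma comp_add (h : IsH1 u v) (c : ℝ) : IsH1 (fun x => u (x + c)) (fun x => v (x + c)) :=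
  ⟨h.prim.comp_add c, h.memLp.comp_measurePreserving (measurePreserving_add_right volume c),
    h.memLp_der.comp_measurePreserving (measurePreserving_add_right volume c)⟩

lemma integrable_mul (h : IsH1 u v) (h' : IsH1 f g) : Integrable (fun x => u x * f x) :=
  integrable_mul_of_memLp h.memLp h'.memLp

lemma integrable_der_mul_der (h : IsH1 u v) (h' : IsH1 f g) : Integrable (fun x => v x * g x) :=
  integrable_mul_of_memLp h.memLp_der h'.memLp_der

/-- Integration by parts in `H¹(ℝ)`. -/
lemma integral_mul_der (h : IsH1 u v) (h' : IsH1 f g) :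
    ∫ x, u x * g x = - ∫ x, v x * f x := by
  have h1 := integrable_mul_of_memLp h.memLp_der h'.memLp
  have h2 := integrable_mul_of_memLp h.memLp h'.memLp_der
  have := (h.prim.mul h'.prim).integral_eq_zero (h.integrable_mul h') (h1.add h2)
  rw [integral_add h1 h2] at this
  linarith

lemma sq_eq_integral_Iic (h : IsH1 u v) (b : ℝ) :
    u b ^ 2 = ∫ x in Iic b, (v x * u x + u x * v x) := by
  have h1 := integrable_mul_of_memLp h.memLp_der h.memLp
  have h2 := integrable_mul_of_memLp h.memLp h.memLp_der
  rw [(h.prim.mul h.prim).integral_Iic b (h.integrable_mul h).integrableOn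
    (h1.add h2).integrableOn, sq]

/-- The embedding `H¹ ⊂ L^∞` with constant one: `u(b)² = ∫_{-∞}^b 2 u u'`, and `2 u u' ≤ u² + u'²`.
-/
lemma sq_le_normSq (h : IsH1 u v) (b : ℝ) : u b ^ 2 ≤ normSq u v := by
  have h1 := integrable_mul_of_memLp h.memLp_der h.memLp
  have h2 := integrable_mul_of_memLp h.memLp h.memLp_der
  have h3 := h.memLp.integrable_sq
  have h4 := h.memLp_der.integrable_sq
  rw [h.sq_eq_integral_Iic b, normSq, ← integral_add h3 h4]
  calc ∫ x in Iic b, (v x * u x + u x * v x)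
      ≤ ∫ x in Iic b, (u x ^ 2 + v x ^ 2) :=
        integral_mono (h1.fun_add h2).integrableOn (h3.fun_add h4).integrableOn
          fun x => by nlinarith [sq_nonneg (u x - v x)]
    _ ≤ ∫ x, (u x ^ 2 + v x ^ 2) :=
        setIntegral_le_integral (h3.fun_add h4) (ae_of_all _ fun x => by positivity)

lemma tendsto_atBot (h : IsH1 u v) : Tendsto u atBot (𝓝 0) := by
  have h1 := integrable_mul_of_memLp h.memLp_der h.memLp
  have h2 := integrable_mul_of_memLp h.memLp h.memLp_der
  have := (h.prim.mul h.prim).tendsto_zero_atBot 0 (h.integrable_mul h).integrableOn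
    (h1.add h2).integrableOn
  have := this.sqrt
  simp only [Real.sqrt_zero, Real.sqrt_mul_self_eq_abs] at this
  exact (tendsto_zero_iff_abs_tendsto_zero _).2 this

/-- Hölder continuity of exponent `1/2`, by Cauchy–Schwarz against the indicator of the interval. It
provides the equicontinuity in the concentration argument. -/
lemma sub_sq_le (h : IsH1 u v) (a b : ℝ) : (u b - u a) ^ 2 ≤ |b - a| * ∫ x, v x ^ 2 := by
  wlog hab : a ≤ b generalizing a b
  · have := this b a (le_of_not_ge hab)
    rw [abs_sub_comm, ← neg_sub, neg_sq]; exact this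
  have hi : MemLp ((Ioc a b).indicator (fun _ => (1 : ℝ))) 2 volume :=
    memLp_indicator_const 2 measurableSet_Ioc 1 (Or.inr (by simp))
  have := integral_abs_mul_le_of_memLp hi h.memLp_der
  have e1 : ∫ x, ((Ioc a b).indicator (fun _ => (1 : ℝ)) x) ^ 2 = |b - a| := by
    have : ∀ x, ((Ioc a b).indicator (fun _ => (1 : ℝ)) x) ^ 2
        = (Ioc a b).indicator (fun _ => (1 : ℝ)) x := by
      intro x; by_cases hx : x ∈ Ioc a b <;> simp [hx]
    simp_rw [this]
    rw [integral_indicator_const _ measurableSet_Ioc]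
    simp [abs_of_nonneg (sub_nonneg.2 hab), hab]
  rw [e1] at this
  refine le_trans ?_ this
  rw [sq_le_sq, h.prim.sub_eq, intervalIntegral.integral_of_le hab,
    abs_of_nonneg (integral_nonneg fun x => abs_nonneg _), ← integral_indicator measurableSet_Ioc]
  refine (abs_integral_le_integral_abs).trans (le_of_eq (integral_congr_ae (ae_of_all _ fun x => ?_)))
  by_cases hx : x ∈ Ioc a b <;> simp [hx]

lemma of_contDiff {φ : ℝ → ℝ} (hφ : ContDiff ℝ (⊤ : ℕ∞) φ) (hc : HasCompactSupport φ) :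
    IsH1 φ (deriv φ) := by
  have hd : Continuous (deriv φ) := hφ.continuous_deriv (by simp)
  exact ⟨.of_hasDerivAt (fun x => (hφ.differentiable (by simp) x).hasDerivAt) hd,
    hφ.continuous.memLp_of_hasCompactSupport hc,
    hd.memLp_of_hasCompactSupport hc.deriv⟩

lemma isWeakDeriv (h : IsH1 u v) : IsWeakDeriv u v := by
  intro φ hφ hc
  have := (of_contDiff hφ hc).integral_mul_der h
  simp only [smul_eq_mul]
  linarith

end IsH1

/-- Square integrability is required on the half line only, since the lemma is also applied to
combinations with a Bloch mode, which grows exponentially at `+∞`. -/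
lemma IsPrim.cut_isH1 {u v : ℝ → ℝ} (h : IsPrim u v) {b : ℝ} (hb : u b = 0)
    (hu : IntegrableOn (fun x => u x ^ 2) (Iic b))
    (hv : IntegrableOn (fun x => v x ^ 2) (Iic b)) :
    IsH1 ((Iic b).indicator u) ((Iic b).indicator v) := by
  refine ⟨h.cut hb, ?_, ?_⟩
  · rw [memLp_two_iff_integrable_sq
      (h.continuous.aestronglyMeasurable.indicator measurableSet_Iic)]
    refine ((integrable_indicator_iff measurableSet_Iic).2 hu).congr (ae_of_all _ fun x => ?_)
    by_cases hx : x ∈ Iic b <;> simp [hx]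
  · rw [memLp_two_iff_integrable_sq
      (h.locInt.aestronglyMeasurable.indicator measurableSet_Iic)]
    refine ((integrable_indicator_iff measurableSet_Iic).2 hv).congr (ae_of_all _ fun x => ?_)
    by_cases hx : x ∈ Iic b <;> simp [hx]

/-! ### From weak derivatives to absolutely continuous representatives. -/

/-- The lemma of du Bois-Reymond. -/
lemma ae_eq_const_of_integral_deriv_mul_eq_zero {f : ℝ → ℝ} (hf : LocallyIntegrable f volume)
    (h : ∀ φ : ℝ → ℝ, ContDiff ℝ (⊤ : ℕ∞) φ → HasCompactSupport φ →
      ∫ x, deriv φ x * f x = 0) : ∃ c : ℝ, ∀ᵐ x, f x = c := by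
  let η : ContDiffBump (0 : ℝ) := default
  set η' : ℝ → ℝ := η.normed volume with hη'
  have hηs : ContDiff ℝ (⊤ : ℕ∞) η' := η.contDiff_normed
  have hηc : HasCompactSupport η' := η.hasCompactSupport_normed
  have hηi : ∫ x, η' x = 1 := η.integral_normed
  refine ⟨∫ x, η' x * f x, ?_⟩
  refine ae_eq_of_integral_contDiff_smul_eq hf (locallyIntegrable_const _) fun ψ hψ hψc => ?_
  set m := ∫ x, ψ x with hm
  -- `χ` has mean zero, so its primitive from `-∞` is again a test function. The hypothesis applied
  -- to this primitive gives `∫ ψ f = m ∫ η' f`.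
  set χ : ℝ → ℝ := fun x => ψ x - m * η' x with hχ
  have hχs : ContDiff ℝ (⊤ : ℕ∞) χ := hψ.sub (contDiff_const.mul hηs)
  have hχc : HasCompactSupport χ := hψc.sub (hηc.mul_left)
  have hψi : Integrable ψ := hψ.continuous.integrable_of_hasCompactSupport hψc
  have hηint : Integrable η' := hηs.continuous.integrable_of_hasCompactSupport hηc
  have hχi : Integrable χ := hψi.sub (hηint.const_mul m)
  have hχ0 : ∫ x, χ x = 0 := by
    rw [hχ, integral_sub hψi (hηint.const_mul m), integral_const_mul, hηi]; ring
  obtain ⟨R, hR⟩ := hχc.isCompact.isBounded.subset_closedBall 0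
  have hout : ∀ x, R < |x| → χ x = 0 := by
    intro x hx
    by_contra hne
    have := hR (subset_tsupport χ hne)
    simp at this
    linarith
  set φ : ℝ → ℝ := fun x => ∫ t in Iic x, χ t with hφ
  have hφd : ∀ x, HasDerivAt φ (χ x) x := by
    intro x
    have h1 : ∀ y, φ y = (∫ t in Iic (0 : ℝ), χ t) + ∫ t in (0 : ℝ)..y, χ t := by
      intro y
      have := intervalIntegral.integral_Iic_sub_Iic (a := (0 : ℝ)) (b := y)
        hχi.integrableOn hχi.integrableOn
      simp only [hφ]; linarith
    rw [funext h1]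
    exact (intervalIntegral.integral_hasDerivAt_right (hχs.continuous.intervalIntegrable _ _)
      (hχs.continuous.stronglyMeasurableAtFilter _ _) hχs.continuous.continuousAt).const_add _
  have hφ' : deriv φ = χ := funext fun x => (hφd x).deriv
  have hφs : ContDiff ℝ (⊤ : ℕ∞) φ := by
    rw [contDiff_infty_iff_deriv]
    exact ⟨fun x => (hφd x).differentiableAt, by rw [hφ']; exact hχs⟩
  have hφc : HasCompactSupport φ := by
    refine HasCompactSupport.of_support_subset_isCompact (isCompact_Icc (a := -|R|) (b := |R|)) ?_
    intro x hx
    by_contra hne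
    apply hx
    rw [mem_Icc, not_and_or, not_le, not_le] at hne
    rcases hne with hne | hne
    · refine setIntegral_eq_zero_of_forall_eq_zero fun t ht => hout t ?_
      have : t < -|R| := lt_of_le_of_lt ht hne
      have h2 := neg_abs_le t
      linarith [le_abs_self R]
    · have h2 : ∫ t in Ioi x, χ t = 0 := by
        refine setIntegral_eq_zero_of_forall_eq_zero fun t ht => hout t ?_
        have : |R| < t := hne.trans ht
        linarith [le_abs_self R, le_abs_self t]
      have := integral_add_compl (measurableSet_Iic (a := x)) hχi
      rw [compl_Iic, h2, hχ0] at this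
      simpa using this
  have key := h φ hφs hφc
  have hψf : Integrable (fun x => ψ x * f x) :=
    hf.integrable_smul_left_of_hasCompactSupport hψ.continuous hψc
  have hηf : Integrable (fun x => η' x * f x) :=
    hf.integrable_smul_left_of_hasCompactSupport hηs.continuous hηc
  rw [hφ'] at key
  have e : ∀ x, χ x * f x = ψ x * f x - m * (η' x * f x) := fun x => by simp only [hχ]; ring
  simp_rw [e] at key
  rw [integral_sub hψf (hηf.const_mul m), integral_const_mul] at key
  simp only [smul_eq_mul]
  rw [integral_mul_const]
  linarith

/-- The difference of `u` and a primitive of `v` has weak derivative zero, hence is almost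
everywhere constant. -/
lemma exists_isPrim_of_weakDeriv {u v : ℝ → ℝ} (hu : LocallyIntegrable u volume)
    (hv : LocallyIntegrable v volume)
    (h : ∀ φ : ℝ → ℝ, ContDiff ℝ (⊤ : ℕ∞) φ → HasCompactSupport φ →
      ∫ x, deriv φ x * u x = - ∫ x, φ x * v x) :
    ∃ w, w =ᵐ[volume] u ∧ IsPrim w v := by
  have hP := IsPrim.primitive hv 0
  set P : ℝ → ℝ := fun x => 0 + ∫ t in (0 : ℝ)..x, v t
  have hPl : LocallyIntegrable P volume := hP.continuous.locallyIntegrable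
  obtain ⟨c, hc⟩ := ae_eq_const_of_integral_deriv_mul_eq_zero (hu.sub hPl) (by
    intro φ hφ hφc
    have hd : Continuous (deriv φ) := hφ.continuous_deriv (by simp)
    have i1 : Integrable (fun x => deriv φ x * u x) :=
      hu.integrable_smul_left_of_hasCompactSupport hd hφc.deriv
    have i2 : Integrable (fun x => deriv φ x * P x) :=
      hPl.integrable_smul_left_of_hasCompactSupport hd hφc.deriv
    have i3 : Integrable (fun x => φ x * v x) :=
      hv.integrable_smul_left_of_hasCompactSupport hφ.continuous hφc
    have i4 : Integrable (fun x => φ x * P x) :=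
      hPl.integrable_smul_left_of_hasCompactSupport hφ.continuous hφc
    have := ((IsH1.of_contDiff hφ hφc).prim.mul hP).integral_eq_zero i4 (i2.add i3)
    rw [integral_add i2 i3] at this
    simp only [Pi.sub_apply, mul_sub]
    rw [integral_sub i1 i2, h φ hφ hφc]
    linarith)
  refine ⟨fun x => c + ∫ t in (0 : ℝ)..x, v t, ?_, IsPrim.primitive hv c⟩
  filter_upwards [hc] with x hx
  simp only [Pi.sub_apply, P] at hx
  linarith

lemma exists_isH1_of_isWeakDeriv {u v : ℝ → ℝ} (hu : MemLp u 2 volume) (hv : MemLp v 2 volume)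
    (h : IsWeakDeriv u v) : ∃ w, w =ᵐ[volume] u ∧ IsH1 w v := by
  obtain ⟨w, hw, hp⟩ := exists_isPrim_of_weakDeriv (hu.locallyIntegrable (by norm_num))
    (hv.locallyIntegrable (by norm_num)) h
  exact ⟨w, hw, hp, hu.ae_eq hw.symm, hv⟩

lemma H1.exists_rep (u : H1) : ∃ w, w =ᵐ[volume] u.val ∧ IsH1 w u.der :=
  exists_isH1_of_isWeakDeriv u.memLp_val u.memLp_der u.isWeakDeriv

/-- The element of `H¹(ℝ)` given by a continuous representative. -/
def IsH1.toH1 {u v : ℝ → ℝ} (h : IsH1 u v) : H1 := ⟨u, v, h.memLp, h.memLp_der, h.isWeakDeriv⟩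

lemma IsH1.congr_der {u v g : ℝ → ℝ} (h : IsH1 u v) (hg : v =ᵐ[volume] g) : IsH1 u g :=
  ⟨h.prim.congr_ae hg, h.memLp, h.memLp_der.ae_eq hg⟩

/-! ### Bounded coefficients and the quadratic form. -/

/-- `W` is measurable and bounded by `C`. -/
structure IsBdd (W : ℝ → ℝ) (C : ℝ) : Prop where
  aesm : AEStronglyMeasurable W volume
  abs_le : ∀ x, |W x| ≤ C

lemma IsBdd.nonneg {W : ℝ → ℝ} {C : ℝ} (h : IsBdd W C) : 0 ≤ C :=
  (abs_nonneg _).trans (h.abs_le 0)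

lemma IsBdd.integrable_mul {W F : ℝ → ℝ} {C : ℝ} (h : IsBdd W C) (hF : Integrable F) :
    Integrable (fun x => W x * F x) :=
  hF.bdd_mul h.aesm (ae_of_all _ h.abs_le)

lemma IsBdd.memLp_mul {W F : ℝ → ℝ} {C : ℝ} (h : IsBdd W C) (hF : MemLp F 2 volume) :
    MemLp (fun x => W x * F x) 2 volume := by
  refine (hF.const_mul C).mono (h.aesm.mul hF.1) (ae_of_all _ fun x => ?_)
  rw [norm_mul, norm_mul]
  exact mul_le_mul_of_nonneg_right ((h.abs_le x).trans (le_abs_self C)) (norm_nonneg _)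

lemma IsBdd.abs_integral_mul_le {W F : ℝ → ℝ} {C : ℝ} (h : IsBdd W C) (hF : Integrable F) :
    |∫ x, W x * F x| ≤ C * ∫ x, |F x| := by
  refine abs_integral_le_integral_abs.trans ?_
  rw [← integral_const_mul]
  refine integral_mono (h.integrable_mul hF).abs (hF.abs.const_mul C) fun x => ?_
  simp only [abs_mul]
  exact mul_le_mul_of_nonneg_right (h.abs_le x) (abs_nonneg _)

lemma IsBdd.sub_const {W : ℝ → ℝ} {C : ℝ} (h : IsBdd W C) (c : ℝ) :
    IsBdd (fun x => W x - c) (C + |c|) :=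
  ⟨h.aesm.sub aestronglyMeasurable_const, fun x => (abs_sub _ _).trans (by
    have := h.abs_le x; gcongr)⟩

/-- The bilinear form `∫ u' f' + W u f`. -/
noncomputable def form (W u v f g : ℝ → ℝ) : ℝ := ∫ x, (v x * g x + W x * (u x * f x))

section form

variable {W : ℝ → ℝ} {C : ℝ} {u v f g : ℝ → ℝ}

lemma integrable_form (hW : IsBdd W C) (h : IsH1 u v) (h' : IsH1 f g) :
    Integrable (fun x => v x * g x + W x * (u x * f x)) :=
  (h.integrable_der_mul_der h').add (hW.integrable_mul (h.integrable_mul h'))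

lemma form_eq (hW : IsBdd W C) (h : IsH1 u v) (h' : IsH1 f g) :
    form W u v f g = (∫ x, v x * g x) + ∫ x, W x * (u x * f x) :=
  integral_add (h.integrable_der_mul_der h') (hW.integrable_mul (h.integrable_mul h'))

lemma form_add_mul (hW : IsBdd W C) (h : IsH1 u v) (h' : IsH1 f g) (t : ℝ) :
    form W (fun x => u x + t * f x) (fun x => v x + t * g x)
      (fun x => u x + t * f x) (fun x => v x + t * g x)
    = form W u v u v + 2 * t * form W u v f g + t ^ 2 * form W f g f g := by
  unfold form
  rw [← integral_const_mul, ← integral_const_mul, ← integral_add (integrable_form hW h h)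
    ((integrable_form hW h h').const_mul _), ← integral_add ((integrable_form hW h h).fun_add
    ((integrable_form hW h h').const_mul _)) ((integrable_form hW h' h').const_mul _)]
  congr 1; funext x; ring

lemma form_const_mul (W u v : ℝ → ℝ) (t : ℝ) :
    form W (fun x => t * u x) (fun x => t * v x) (fun x => t * u x) (fun x => t * v x)
    = t ^ 2 * form W u v u v := by
  unfold form
  rw [← integral_const_mul]
  congr 1; funext x; ring

lemma normSq_eq_form (h : IsH1 u v) : normSq u v = form (fun _ => 1) u v u v := by
  unfold normSq form
  rw [← integral_add h.memLp.integrable_sq h.memLp_der.integrable_sq]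
  congr 1; funext x; ring

lemma form_sub_const (hW : IsBdd W C) (h : IsH1 u v) (h' : IsH1 f g) (c : ℝ) :
    form (fun x => W x - c) u v f g = form W u v f g - c * ∫ x, u x * f x := by
  unfold form
  rw [← integral_const_mul, ← integral_sub (integrable_form hW h h')
    ((h.integrable_mul h').const_mul _)]
  congr 1; funext x; ring

/-- Cauchy–Schwarz from a discriminant. Only semidefiniteness is assumed, because the form is also
used shifted by the infimum of its Rayleigh quotient, where no lower bound better than zero is
available. -/
lemma form_sq_le (hW : IsBdd W C) (hpos : ∀ u v, IsH1 u v → 0 ≤ form W u v u v)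
    (h : IsH1 u v) (h' : IsH1 f g) :
    form W u v f g ^ 2 ≤ form W u v u v * form W f g f g := by
  have key : ∀ t : ℝ, 0 ≤ form W f g f g * (t * t) + (2 * form W u v f g) * t
      + form W u v u v := fun t => by
    have := hpos _ _ (h.add (h'.const_mul t))
    rw [form_add_mul hW h h'] at this
    linarith
  have := discrim_le_zero key
  rw [discrim] at this
  nlinarith

lemma normSq_nonneg (u v : ℝ → ℝ) : 0 ≤ normSq u v :=
  add_nonneg (integral_nonneg fun _ => sq_nonneg _) (integral_nonneg fun _ => sq_nonneg _)

lemma IsH1.eq_zero_of_normSq (h : IsH1 u v) (h0 : normSq u v ≤ 0) (x : ℝ) : u x = 0 := by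
  have := h.sq_le_normSq x
  nlinarith [sq_nonneg (u x)]

end form

/-! ### From the spectrum to coercivity. -/

/-- The quadratic form `∫ u'² + W u²` is bounded below by `δ ‖u‖²` in `H¹(ℝ)`. -/
def Coercive (W : ℝ → ℝ) (δ : ℝ) : Prop :=
  ∀ u v, IsH1 u v → δ * normSq u v ≤ form W u v u v

/-- An `L²` lower bound improves to an `H¹` one: take the convex combination, with weights `1 - s`
and `s`, of the hypothesis and of `form ≥ ∫ u'² - C ∫ u²`. -/
lemma coercive_of_le {W : ℝ → ℝ} {C μ : ℝ} (hW : IsBdd W C) (hμ : 0 < μ)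
    (h : ∀ u v, IsH1 u v → μ * ∫ x, u x ^ 2 ≤ form W u v u v) :
    ∃ δ, 0 < δ ∧ Coercive W δ := by
  have hC := hW.nonneg
  -- The weight solves `(1 - s) μ - s C = s`, so the coefficients of `∫ u²` and `∫ u'²` come out
  -- equal.
  set s := μ / (μ + C + 1) with hs
  have hd : 0 < μ + C + 1 := by linarith
  have hs0 : 0 < s := by positivity
  have hs1 : s * (μ + C + 1) = μ := div_mul_cancel₀ _ hd.ne'
  refine ⟨s, hs0, fun u v huv => ?_⟩
  have h1 := h u v huv
  have h2 := hW.abs_integral_mul_le (huv.integrable_mul huv)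
  have h2' : ∫ x, |u x * u x| = ∫ x, u x ^ 2 := by
    congr 1; funext x; rw [abs_mul_self]; ring
  have h3 : ∫ x, v x * v x = ∫ x, v x ^ 2 := by congr 1; funext x; ring
  have h5 : 0 ≤ ∫ x, u x ^ 2 := integral_nonneg fun x => sq_nonneg _
  have h6 := form_eq hW huv huv
  rw [h2'] at h2
  rw [h3] at h6
  have h7 := (abs_le.1 h2).1
  have hs2 : s ≤ 1 := by rw [hs, div_le_one hd]; linarith
  rw [normSq]
  have : (∫ x, v x ^ 2) ≤ form W u v u v + C * ∫ x, u x ^ 2 := by linarith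
  nlinarith [mul_le_mul_of_nonneg_left this hs0.le, mul_le_mul_of_nonneg_left h1
    (sub_nonneg.2 hs2), mul_nonneg (sub_nonneg.2 hs2) h5]

/-- The spectrum is defined on complex `L²`, whereas the form is real; taking real parts of the
resolvent connects the two. -/
lemma IsWeakDeriv.re {u v : ℝ → ℂ} (hu : MemLp u 2 volume) (hv : MemLp v 2 volume)
    (h : IsWeakDeriv u v) : IsWeakDeriv (fun x => (u x).re) (fun x => (v x).re) := by
  intro φ hφ hc
  have i1 : Integrable (fun x => deriv φ x • u x) :=
    (hu.locallyIntegrable (by norm_num)).integrable_smul_left_of_hasCompactSupport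
      (hφ.continuous_deriv (by simp)) hc.deriv
  have i2 : Integrable (fun x => φ x • v x) :=
    (hv.locallyIntegrable (by norm_num)).integrable_smul_left_of_hasCompactSupport
      hφ.continuous hc
  have := congrArg Complex.reCLM (h φ hφ hc)
  rw [map_neg, ← Complex.reCLM.integral_comp_comm i1, ← Complex.reCLM.integral_comp_comm i2] at this
  simpa using this

lemma norm_sq_eq_integral (f : Lp ℂ 2 (volume : Measure ℝ)) : ‖f‖ ^ 2 = ∫ x, ‖f x‖ ^ 2 := by
  have h1 : RCLike.re (inner ℂ f f) = ‖f‖ ^ 2 := inner_self_eq_norm_sq f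
  rw [← h1, L2.inner_def]
  have : ∀ x, inner ℂ (f x) (f x) = ((‖f x‖ ^ 2 : ℝ) : ℂ) := fun x => by
    rw [inner_self_eq_norm_sq_to_K]; norm_cast
  simp_rw [this]
  rw [integral_complex_ofReal]; simp

/-- A real point of the resolvent set: the equation `-g'' + (W - z) g = u` can be solved. -/
lemma exists_resolvent {W : ℝ → ℝ} {z : ℝ} (hz : (z : ℂ) ∉ schrodingerSpectrum W) :
    ∃ K : ℝ, ∀ u : ℝ → ℝ, MemLp u 2 volume → ∃ g g₁ g₂ : ℝ → ℝ, IsH1 g g₁ ∧ IsH1 g₁ g₂ ∧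
      (∀ᵐ x, u x = - g₂ x + (W x - z) * g x) ∧ ∫ x, g x ^ 2 ≤ K * ∫ x, u x ^ 2 := by
  simp only [schrodingerSpectrum, mem_ofPred_eq, not_not] at hz
  obtain ⟨R, hR⟩ := hz
  refine ⟨‖R‖ ^ 2, fun u hu => ?_⟩
  have hu' : MemLp (fun x => (u x : ℂ)) 2 volume := hu.ofReal
  set F : Lp ℂ 2 (volume : Measure ℝ) := hu'.toLp _ with hF
  obtain ⟨w₁, w₂, h1, h2, d1, d2, he⟩ := (hR F (R F)).1 rfl
  have hw : MemLp (R F : ℝ → ℂ) 2 volume := Lp.memLp _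
  obtain ⟨g, hg, hg1⟩ := exists_isH1_of_isWeakDeriv hw.re h1.re (IsWeakDeriv.re hw h1 d1)
  obtain ⟨g₁, hg₁, hg2⟩ := exists_isH1_of_isWeakDeriv h1.re h2.re (IsWeakDeriv.re h1 h2 d2)
  refine ⟨g, g₁, _, hg1.congr_der hg₁.symm, hg2, ?_, ?_⟩
  · filter_upwards [he, hg, hu'.coeFn_toLp, Lp.coeFn_add F ((z : ℂ) • R F),
      Lp.coeFn_smul (z : ℂ) (R F)] with x e1 e2 e3 e4 e5
    rw [e4, Pi.add_apply, e5, Pi.smul_apply, hF, e3] at e1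
    have := congrArg Complex.re e1
    simp at this
    rw [e2]
    simp
    linarith
  · have e1 : ∫ x, g x ^ 2 ≤ ∫ x, ‖(R F : ℝ → ℂ) x‖ ^ 2 := by
      refine integral_mono_ae hg1.memLp.integrable_sq ?_ ?_
      · exact hw.integrable_norm_pow (by norm_num)
      · filter_upwards [hg] with x hx
        rw [hx, ← sq_abs]
        exact pow_le_pow_left₀ (abs_nonneg _) (Complex.abs_re_le_norm _) 2
    have e2 : ∫ x, u x ^ 2 = ∫ x, ‖F x‖ ^ 2 := by
      refine integral_congr_ae ?_
      filter_upwards [hu'.coeFn_toLp] with x hx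
      rw [hF, hx]; simp
    rw [e2, ← norm_sq_eq_integral, ← mul_pow]
    rw [← norm_sq_eq_integral] at e1
    exact e1.trans (pow_le_pow_left₀ (norm_nonneg _) (R.le_opNorm F) 2)

lemma exists_isH1_pos : ∃ u v, IsH1 u v ∧ ∫ x, u x ^ 2 = 1 := by
  let η : ContDiffBump (0 : ℝ) := default
  have h := IsH1.of_contDiff (φ := η) η.contDiff η.hasCompactSupport
  set m := ∫ x, η x ^ 2 with hm
  have hmpos : 0 < m := by
    refine lt_of_le_of_ne (integral_nonneg fun x => sq_nonneg _) fun h0 => ?_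
    have h1 := (integral_eq_zero_iff_of_nonneg (fun x => sq_nonneg (η x)) h.memLp.integrable_sq).1
      h0.symm
    have h2 := (h.continuous.pow 2).ae_eq_iff_eq volume continuous_const |>.1 h1
    have h3 : η 0 ^ 2 = 0 := congrFun h2 0
    have h4 : η 0 = 1 := η.one_of_mem_closedBall (by simp [η.rIn_pos.le])
    simp [h4] at h3
  refine ⟨_, _, h.const_mul (√m)⁻¹, ?_⟩
  simp_rw [mul_pow]
  rw [integral_const_mul, inv_pow, Real.sq_sqrt hmpos.le]
  exact inv_mul_cancel₀ hmpos.ne'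

/-- A positive spectral bottom makes the quadratic form coercive. -/
theorem exists_coercive_of_positiveSpectrum {W : ℝ → ℝ} {C : ℝ} (hW : IsBdd W C)
    (h : PositiveSpectrum W) : ∃ δ, 0 < δ ∧ Coercive W δ := by
  obtain ⟨m, hm, hm0⟩ := h
  set A : Set ℝ := {a | ∃ u v, IsH1 u v ∧ ∫ x, u x ^ 2 = 1 ∧ a = form W u v u v} with hA
  have hne : A.Nonempty := by
    obtain ⟨u, v, h1, h2⟩ := exists_isH1_pos
    exact ⟨_, u, v, h1, h2, rfl⟩
  have hlow : ∀ a ∈ A, -C ≤ a := by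
    rintro a ⟨u, v, huv, h1, rfl⟩
    have h2 := hW.abs_integral_mul_le (huv.integrable_mul huv)
    have h2' : ∫ x, |u x * u x| = ∫ x, u x ^ 2 := by
      congr 1; funext x; rw [abs_mul_self]; ring
    have h3 : 0 ≤ ∫ x, v x * v x := integral_nonneg fun x => mul_self_nonneg _
    rw [h2', h1] at h2
    rw [form_eq hW huv huv]
    linarith [(abs_le.1 h2).1]
  have hbdd : BddBelow A := ⟨-C, hlow⟩
  set μ := sInf A with hμ
  have hform : ∀ u v, IsH1 u v → μ * ∫ x, u x ^ 2 ≤ form W u v u v := by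
    intro u v huv
    rcases (integral_nonneg fun x => sq_nonneg (u x) : 0 ≤ ∫ x, u x ^ 2).eq_or_lt with h0 | h0
    · rw [← h0, mul_zero]
      have h1 := (integral_eq_zero_iff_of_nonneg (fun x => sq_nonneg (u x))
        huv.memLp.integrable_sq).1 h0.symm
      refine integral_nonneg_of_ae ?_
      filter_upwards [h1] with x hx
      have : u x = 0 := by simpa using hx
      simp [this, mul_self_nonneg]
    · set n := ∫ x, u x ^ 2 with hn
      have h1 : μ ≤ form W (fun x => (√n)⁻¹ * u x) (fun x => (√n)⁻¹ * v x)
          (fun x => (√n)⁻¹ * u x) (fun x => (√n)⁻¹ * v x) := by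
        refine csInf_le hbdd ⟨_, _, huv.const_mul _, ?_, rfl⟩
        simp_rw [mul_pow]
        rw [integral_const_mul, inv_pow, Real.sq_sqrt h0.le]
        exact inv_mul_cancel₀ h0.ne'
      rw [form_const_mul, inv_pow, Real.sq_sqrt h0.le, ← div_eq_inv_mul, le_div_iff₀ h0] at h1
      exact h1
  -- The infimum `μ` of the Rayleigh quotient is a spectral point; minimality of `m` then gives `0 <
  -- m ≤ μ`.
  have hmem : (μ : ℂ) ∈ schrodingerSpectrum W := by
    by_contra hz
    obtain ⟨K, hK⟩ := exists_resolvent hz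
    have hWμ := hW.sub_const μ
    have hpos : ∀ u v, IsH1 u v → 0 ≤ form (fun x => W x - μ) u v u v := fun u v huv => by
      rw [form_sub_const hW huv huv]
      have := hform u v huv
      simp_rw [← sq]; linarith
    -- If `g` solves `-g'' + (W - μ) g = u` with `‖u‖ = 1`, Cauchy–Schwarz for the form of `W - μ`
    -- gives `1 ≤ (a(u) - μ) ⟨g, u⟩`, and `⟨g, u⟩ ≤ |K| + 1`. This is a uniform gap above the
    -- infimum, which is absurd.
    have hlb : ∀ a ∈ A, μ + 1 / (|K| + 1) ≤ a := by
      rintro a ⟨u, v, huv, h1, rfl⟩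
      obtain ⟨g, g₁, g₂, hg, hg1, he, hb⟩ := hK u huv.memLp
      have key : ∀ f f', IsH1 f f' → form (fun x => W x - μ) f f' g g₁ = ∫ x, f x * u x := by
        intro f f' hf
        rw [form_eq hWμ hf hg]
        have i1 := hf.integral_mul_der hg1
        have i2 := hf.integrable_mul hg
        have i3 := integrable_mul_of_memLp hf.memLp hg1.memLp_der
        have : ∫ x, f' x * g₁ x = ∫ x, -(f x * g₂ x) := by rw [integral_neg]; linarith
        rw [this, ← integral_add i3.fun_neg (hWμ.integrable_mul i2)]
        refine integral_congr_ae ?_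
        filter_upwards [he] with x hx
        rw [hx]; ring
      have c1 := form_sq_le hWμ hpos huv hg
      rw [key u v huv, key g g₁ hg] at c1
      have c2 : ∫ x, u x * u x = 1 := by rw [← h1]; congr 1; funext x; ring
      rw [c2, form_sub_const hW huv huv, c2] at c1
      have c3 := integral_abs_mul_le_of_memLp hg.memLp huv.memLp
      have c4 : ∫ x, g x * u x ≤ ∫ x, |g x * u x| :=
        integral_mono (hg.integrable_mul huv) (hg.integrable_mul huv).abs fun x => le_abs_self _
      have c5 : ∫ x, |g x * u x| ≤ |K| + 1 := by
        rw [h1] at c3 hb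
        nlinarith [le_abs_self K, abs_nonneg K]
      have c6 := hform u v huv
      rw [h1] at c6
      have : 1 / (|K| + 1) ≤ form W u v u v - μ := by
        rw [div_le_iff₀ (by positivity)]
        nlinarith
      linarith
    have := le_csInf hne hlb
    have h2 : 0 < 1 / (|K| + 1) := by positivity
    linarith
  exact coercive_of_le hW (hm0.trans_le (hm.2 hmem)) hform

/-! ### Convergence of integrals, Brezis–Lieb splitting and weak compactness. -/

/-- A version of dominated convergence with a small non-compact part in the domination. -/
lemma tendsto_integral_zero_of_le_add {F G : ℕ → ℝ → ℝ} {K : ℝ} (hF : ∀ n, Integrable (F n))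
    (hF0 : ∀ n x, 0 ≤ F n x) (hG : ∀ n, Integrable (G n)) (hG0 : ∀ n x, 0 ≤ G n x)
    (hGK : ∀ n, ∫ x, G n x ≤ K) (hlim : ∀ x, Tendsto (fun n => F n x) atTop (𝓝 0))
    (hdom : ∀ ε > 0, ∃ H : ℝ → ℝ, Integrable H ∧ ∀ n x, F n x ≤ ε * G n x + H x) :
    Tendsto (fun n => ∫ x, F n x) atTop (𝓝 0) := by
  rw [Metric.tendsto_atTop]
  intro η hη
  obtain ⟨H, hH, hle⟩ := hdom (η / (2 * (|K| + 1))) (by positivity)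
  set ε := η / (2 * (|K| + 1)) with hε
  have hε0 : 0 < ε := by positivity
  have hi : ∀ n, Integrable (fun x => max (F n x - ε * G n x) 0) := fun n =>
    ((hF n).sub ((hG n).const_mul ε)).pos_part
  -- The positive part of `F n - ε G n` is dominated by `|H|` and tends to zero with `F n`; what was
  -- subtracted costs at most `ε |K| ≤ η / 2`.
  have h1 : Tendsto (fun n => ∫ x, max (F n x - ε * G n x) 0) atTop (𝓝 (∫ _ : ℝ, (0 : ℝ))) := by
    refine tendsto_integral_of_dominated_convergence (fun x => |H x|)
      (fun n => (hi n).aestronglyMeasurable) hH.abs (fun n => ae_of_all _ fun x => ?_)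
      (ae_of_all _ fun x => ?_)
    · rw [Real.norm_eq_abs, abs_of_nonneg (le_max_right _ _)]
      exact max_le (by linarith [hle n x, le_abs_self (H x)]) (abs_nonneg _)
    · refine squeeze_zero (fun n => le_max_right _ _) (fun n => ?_) (hlim x)
      exact max_le (by linarith [mul_nonneg hε0.le (hG0 n x)]) (hF0 n x)
  rw [integral_zero, Metric.tendsto_atTop] at h1
  obtain ⟨N, hN⟩ := h1 (η / 2) (by positivity)
  refine ⟨N, fun n hn => ?_⟩
  have h2 := hN n hn
  rw [dist_zero_right, Real.norm_eq_abs] at h2 ⊢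
  rw [abs_of_nonneg (integral_nonneg (hF0 n))]
  have h3 : ∫ x, F n x ≤ (∫ x, max (F n x - ε * G n x) 0) + ε * ∫ x, G n x := by
    rw [← integral_const_mul, ← integral_add (hi n) ((hG n).const_mul ε)]
    refine integral_mono (hF n) ((hi n).add ((hG n).const_mul ε)) fun x => ?_
    exact sub_le_iff_le_add.1 (le_max_left (F n x - ε * G n x) 0)
  have h4 : ε * (|K| + 1) = η / 2 := by rw [hε]; field_simp
  have h5 := hGK n
  have h6 : ε * ∫ x, G n x ≤ ε * |K| :=
    mul_le_mul_of_nonneg_left (h5.trans (le_abs_self K)) hε0.le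
  linarith [le_abs_self (∫ x, max (F n x - ε * G n x) 0)]

/-- The inequality `|h w| ≤ ε w² + h² / (4 ε)` puts the product in the scope of the preceding
dominated convergence. -/
lemma tendsto_integral_abs_mul_zero {w : ℕ → ℝ → ℝ} {h : ℝ → ℝ} {K : ℝ}
    (hw : ∀ n, MemLp (w n) 2 volume) (hh : MemLp h 2 volume) (hK : ∀ n, ∫ x, w n x ^ 2 ≤ K)
    (hlim : ∀ x, Tendsto (fun n => w n x) atTop (𝓝 0)) :
    Tendsto (fun n => ∫ x, |h x * w n x|) atTop (𝓝 0) := by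
  refine tendsto_integral_zero_of_le_add (G := fun n x => w n x ^ 2)
    (fun n => (integrable_mul_of_memLp hh (hw n)).abs) (fun _ _ => abs_nonneg _)
    (fun n => (hw n).integrable_sq) (fun _ _ => sq_nonneg _) hK (fun x => ?_) fun ε hε => ?_
  · have := ((hlim x).const_mul (h x)).abs
    simpa using this
  · refine ⟨fun x => 1 / (4 * ε) * h x ^ 2, hh.integrable_sq.const_mul _, fun n x => ?_⟩
    rw [abs_mul]
    have h1 : 1 / (4 * ε) * h x ^ 2 + ε * w n x ^ 2 - |h x| * |w n x|
        = 1 / (4 * ε) * (|h x| - 2 * ε * |w n x|) ^ 2 := by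
      rw [← sq_abs (h x), ← sq_abs (w n x)]; field_simp; ring
    have h2 : 0 ≤ 1 / (4 * ε) * (|h x| - 2 * ε * |w n x|) ^ 2 := by positivity
    linarith

/-- The potential energy `∫ Γ |u|^r`. -/
noncomputable def pot (Γ : ℝ → ℝ) (r : ℝ) (u : ℝ → ℝ) : ℝ := ∫ x, Γ x * |u x| ^ r

/-- Superquadraticity in usable form: since `r > 2`, the factor `M^(r-2)` is small with `M`. This
excludes vanishing of maximizing sequences and makes the nonlinear term negligible in a tail. -/
lemma abs_rpow_le_mul_sq {r M s : ℝ} (hr : 2 < r) (hs : |s| ≤ M) :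
    |s| ^ r ≤ M ^ (r - 2) * s ^ 2 := by
  have : |s| ^ r = |s| ^ (r - 2) * s ^ 2 := by
    rcases eq_or_ne s 0 with rfl | h0
    · simp [Real.zero_rpow (by linarith : r ≠ 0)]
    · rw [← sq_abs s, ← Real.rpow_natCast, ← Real.rpow_add (abs_pos.2 h0)]
      congr 1; push_cast; ring
  rw [this]
  exact mul_le_mul_of_nonneg_right (Real.rpow_le_rpow (abs_nonneg _) hs (by linarith))
    (sq_nonneg _)

lemma abs_rpow_sub_abs_rpow_le {r M a b : ℝ} (hr : 2 < r) (h : |a| + |b| ≤ M) :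
    |(|a| ^ r - |b| ^ r)| ≤ r * M ^ (r - 2) * (|a| + |b|) * |a - b| := by
  set m := |a| + |b| with hm
  have hm0 : 0 ≤ m := by positivity
  have key : ‖|a| ^ r - |b| ^ r‖ ≤ (r * m ^ (r - 2) * m) * ‖a - b‖ := by
    refine Convex.norm_image_sub_le_of_norm_hasDerivWithin_le (s := Icc (-m) m)
      (f' := fun x => r * |x| ^ (r - 2) * x)
      (fun x _ => (hasDerivAt_abs_rpow x (by linarith)).hasDerivWithinAt) (fun x hx => ?_)
      (convex_Icc _ _) ?_ ?_
    · have hx' : |x| ≤ m := abs_le.2 hx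
      rw [norm_mul, norm_mul, Real.norm_eq_abs, Real.norm_eq_abs, Real.norm_eq_abs,
        abs_of_pos (by linarith : (0 : ℝ) < r), abs_of_nonneg (Real.rpow_nonneg (abs_nonneg x) _)]
      gcongr
    · exact abs_le.1 (by simp [hm])
    · exact abs_le.1 (by simp [hm])
  refine key.trans ?_
  rw [Real.norm_eq_abs]
  have : m ^ (r - 2) ≤ M ^ (r - 2) := Real.rpow_le_rpow hm0 h (by linarith)
  have hr0 : 0 ≤ r := by linarith
  gcongr

namespace IsH1
variable {u v : ℝ → ℝ} {r : ℝ}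

lemma abs_le_sqrt (h : IsH1 u v) (x : ℝ) : |u x| ≤ √(normSq u v) :=
  Real.abs_le_sqrt (h.sq_le_normSq x)

lemma continuous_rpow (h : IsH1 u v) (hr : 2 < r) : Continuous (fun x => |u x| ^ r) :=
  h.continuous.abs.rpow_const fun _ => Or.inr (by linarith)

lemma integrable_rpow (h : IsH1 u v) (hr : 2 < r) : Integrable (fun x => |u x| ^ r) := by
  refine (h.memLp.integrable_sq.const_mul (√(normSq u v) ^ (r - 2))).mono'
    (h.continuous_rpow hr).aestronglyMeasurable (ae_of_all _ fun x => ?_)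
  rw [Real.norm_eq_abs, abs_of_nonneg (Real.rpow_nonneg (abs_nonneg _) _)]
  exact abs_rpow_le_mul_sq hr (h.abs_le_sqrt x)

end IsH1

lemma pot_tendsto {Γ : ℕ → ℝ → ℝ} {Γ' : ℝ → ℝ} {C r : ℝ} {u v : ℝ → ℝ} (hr : 2 < r)
    (hΓ : ∀ n, IsBdd (Γ n) C) (hlim : ∀ x, Tendsto (fun n => Γ n x) atTop (𝓝 (Γ' x)))
    (h : IsH1 u v) : Tendsto (fun n => pot (Γ n) r u) atTop (𝓝 (pot Γ' r u)) := by
  refine tendsto_integral_of_dominated_convergence (fun x => C * |u x| ^ r)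
    (fun n => ((hΓ n).integrable_mul (h.integrable_rpow hr)).aestronglyMeasurable)
    ((h.integrable_rpow hr).const_mul C) (fun n => ae_of_all _ fun x => ?_)
    (ae_of_all _ fun x => (hlim x).mul_const _)
  rw [norm_mul, Real.norm_eq_abs, Real.norm_eq_abs, abs_of_nonneg (Real.rpow_nonneg (abs_nonneg _) _)]
  exact mul_le_mul_of_nonneg_right ((hΓ n).abs_le x) (Real.rpow_nonneg (abs_nonneg _) _)

lemma form_tendsto {W : ℕ → ℝ → ℝ} {W' : ℝ → ℝ} {C : ℝ} {u v : ℝ → ℝ}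
    (hW : ∀ n, IsBdd (W n) C) (hlim : ∀ x, Tendsto (fun n => W n x) atTop (𝓝 (W' x)))
    (h : IsH1 u v) : Tendsto (fun n => form (W n) u v u v) atTop (𝓝 (form W' u v u v)) := by
  refine tendsto_integral_of_dominated_convergence (fun x => v x * v x + C * (u x * u x))
    (fun n => (integrable_form (hW n) h h).aestronglyMeasurable)
    ((h.integrable_der_mul_der h).add ((h.integrable_mul h).const_mul C))
    (fun n => ae_of_all _ fun x => ?_)
    (ae_of_all _ fun x => ((hlim x).mul_const _).const_add _)
  refine (norm_add_le _ _).trans ?_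
  rw [norm_mul (W n x), Real.norm_eq_abs, Real.norm_eq_abs, Real.norm_eq_abs, abs_mul_self,
    abs_mul_self]
  gcongr
  · exact mul_self_nonneg _
  · exact (hW n).abs_le x

/-- The splitting of Brezis and Lieb. -/
lemma tendsto_integral_brezis_lieb {w w' : ℕ → ℝ → ℝ} {u v : ℝ → ℝ} {K r : ℝ} (hr : 2 < r)
    (hw : ∀ n, IsH1 (w n) (w' n)) (hu : IsH1 u v) (hK : ∀ n, normSq (w n) (w' n) ≤ K)
    (hlim : ∀ x, Tendsto (fun n => w n x) atTop (𝓝 (u x))) :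
    Tendsto (fun n => ∫ x, |(|w n x| ^ r - |w n x - u x| ^ r - |u x| ^ r)|) atTop (𝓝 0) := by
  have hrpos : 0 < r := by linarith
  set m := √K + √(normSq u v) with hm
  have hm1 : 0 ≤ √K := Real.sqrt_nonneg _
  have hm2 : 0 ≤ √(normSq u v) := Real.sqrt_nonneg _
  have hwm : ∀ n x, |w n x| ≤ √K := fun n x =>
    ((hw n).abs_le_sqrt x).trans (Real.sqrt_le_sqrt (hK n))
  set L := r * (2 * m) ^ (r - 2) + m ^ (r - 2) with hL
  have hL0 : 0 ≤ L := by positivity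
  have hbound : ∀ n x, |(|w n x| ^ r - |w n x - u x| ^ r - |u x| ^ r)|
      ≤ L * (2 * |w n x| * |u x| + 2 * u x ^ 2) := by
    intro n x
    have hd : |w n x - u x| ≤ |w n x| + |u x| := abs_sub _ _
    have hux := hu.abs_le_sqrt x
    have h1 := abs_rpow_sub_abs_rpow_le (a := w n x) (b := w n x - u x) (M := 2 * m) hr
      (by linarith [hwm n x])
    have h2 : |u x| ^ r ≤ m ^ (r - 2) * u x ^ 2 := abs_rpow_le_mul_sq hr (by linarith)
    have h3 : 0 ≤ |u x| ^ r := Real.rpow_nonneg (abs_nonneg _) _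
    rw [sub_sub_cancel] at h1
    have h4 : r * (2 * m) ^ (r - 2) * (|w n x| + |w n x - u x|) * |u x|
        ≤ r * (2 * m) ^ (r - 2) * (2 * |w n x| * |u x| + u x ^ 2) := by
      rw [mul_assoc]
      refine mul_le_mul_of_nonneg_left ?_ (by positivity)
      rw [← sq_abs (u x)]
      nlinarith [abs_nonneg (u x)]
    calc |(|w n x| ^ r - |w n x - u x| ^ r - |u x| ^ r)|
        ≤ |(|w n x| ^ r - |w n x - u x| ^ r)| + |u x| ^ r := by
          refine (abs_sub _ _).trans ?_
          rw [abs_of_nonneg h3]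
      _ ≤ r * (2 * m) ^ (r - 2) * (2 * |w n x| * |u x| + u x ^ 2) + m ^ (r - 2) * u x ^ 2 := by
          linarith
      _ ≤ L * (2 * |w n x| * |u x| + 2 * u x ^ 2) := by
          rw [hL, add_mul]
          have : 0 ≤ 2 * |w n x| * |u x| := by positivity
          have h5 : 0 ≤ u x ^ 2 := sq_nonneg _
          gcongr <;> linarith
  refine tendsto_integral_zero_of_le_add (G := fun n x => w n x ^ 2) (K := K)
    (fun n => ?_) (fun _ _ => abs_nonneg _)
    (fun n => (hw n).memLp.integrable_sq) (fun _ _ => sq_nonneg _) (fun n => ?_) (fun x => ?_)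
    fun ε hε => ?_
  · exact ((((hw n).integrable_rpow hr).sub (((hw n).sub hu).integrable_rpow hr)).sub
      (hu.integrable_rpow hr)).abs
  · have := hK n
    rw [normSq] at this
    have h0 : 0 ≤ ∫ x, w' n x ^ 2 := integral_nonneg fun x => sq_nonneg _
    linarith
  · have hc : Continuous (fun s : ℝ => |(|s| ^ r - |s - u x| ^ r - |u x| ^ r)|) :=
      (((continuous_abs.rpow_const fun _ => Or.inr hrpos.le).sub
        ((continuous_id.sub continuous_const).abs.rpow_const fun _ => Or.inr hrpos.le)).sub
        continuous_const).abs
    have := (hc.tendsto (u x)).comp (hlim x)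
    simpa [Function.comp_def, Real.zero_rpow hrpos.ne'] using this
  -- Completing the square: `2 L |w n| |u| ≤ ε (w n)² + (L² / ε) u²`. Only the part with the fixed
  -- function `u` has to be integrable uniformly in `n`.
  · refine ⟨fun x => (L ^ 2 / ε + 2 * L) * u x ^ 2, hu.memLp.integrable_sq.const_mul _,
      fun n x => (hbound n x).trans ?_⟩
    have h1 : ε * w n x ^ 2 + (L ^ 2 / ε + 2 * L) * u x ^ 2
        - L * (2 * |w n x| * |u x| + 2 * u x ^ 2) = ε * (|w n x| - L / ε * |u x|) ^ 2 := by
      rw [← sq_abs (w n x), ← sq_abs (u x)]; field_simp; ring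
    have h2 : 0 ≤ ε * (|w n x| - L / ε * |u x|) ^ 2 := by positivity
    linarith

/-- Bounded sequences in `H¹(ℝ)` have subsequences converging pointwise and weakly. -/
theorem exists_subseq_tendsto {u v : ℕ → ℝ → ℝ} {K : ℝ} (h : ∀ n, IsH1 (u n) (v n))
    (hK : ∀ n, normSq (u n) (v n) ≤ K) :
    ∃ φ : ℕ → ℕ, StrictMono φ ∧ ∃ u' v', IsH1 u' v' ∧
      (∀ x, Tendsto (fun n => u (φ n) x) atTop (𝓝 (u' x))) ∧
      ∀ g, MemLp g 2 volume →
        Tendsto (fun n => ∫ x, g x * v (φ n) x) atTop (𝓝 (∫ x, g x * v' x)) := by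
  have : Fact ((2 : ENNReal) ≠ ⊤) := ⟨by simp⟩
  have : TopologicalSpace.SeparableSpace (Lp ℝ 2 (volume : Measure ℝ)) := inferInstance
  have hinner : ∀ f g : Lp ℝ 2 (volume : Measure ℝ), inner ℝ f g = ∫ x, f x * g x := by
    intro f g; rw [L2.inner_def]; simp [mul_comm]
  have hu2 : ∀ n, ∫ x, u n x ^ 2 ≤ K := fun n => by
    have := hK n
    rw [normSq] at this
    have h0 : 0 ≤ ∫ x, v n x ^ 2 := integral_nonneg fun x => sq_nonneg _
    linarith
  have hv2 : ∀ n, ∫ x, v n x ^ 2 ≤ K := fun n => by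
    have := hK n
    rw [normSq] at this
    have h0 : 0 ≤ ∫ x, u n x ^ 2 := integral_nonneg fun x => sq_nonneg _
    linarith
  set V : ℕ → Lp ℝ 2 (volume : Measure ℝ) := fun n => (h n).memLp_der.toLp (v n) with hV
  have hVn : ∀ n, ‖V n‖ ≤ √K := by
    intro n
    refine Real.le_sqrt_of_sq_le ?_
    rw [← real_inner_self_eq_norm_sq, hinner]
    refine le_trans (le_of_eq ?_) (hv2 n)
    refine integral_congr_ae ?_
    filter_upwards [(h n).memLp_der.coeFn_toLp] with x hx
    rw [hx]; ring
  let D := InnerProductSpace.toDual ℝ (Lp ℝ 2 (volume : Measure ℝ))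
  let X : ℕ → WeakDual ℝ (Lp ℝ 2 (volume : Measure ℝ)) := fun n =>
    StrongDual.toWeakDual (D (V n))
  -- Sequential Banach–Alaoglu in the dual of the separable space `L²`, applied to the derivatives.
  obtain ⟨Y, -, φ₁, hφ₁, hY⟩ := WeakDual.isSeqCompact_closedBall ℝ
    (Lp ℝ 2 (volume : Measure ℝ)) 0 (√K) (x := X) (fun n => by
      simp only [mem_preimage, Metric.mem_closedBall, dist_zero_right]
      change ‖D (V n)‖ ≤ √K
      rw [LinearIsometryEquiv.norm_map]
      exact hVn n)
  -- Convergence at the single point `0` suffices: testing the weakly convergent derivatives with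
  -- indicators of intervals propagates it to every point.
  obtain ⟨c, -, φ₂, hφ₂, hc⟩ := tendsto_subseq_of_bounded
    (Metric.isBounded_closedBall (x := (0 : ℝ)) (r := √K)) (x := fun n => u (φ₁ n) 0) (fun n => by
      simp only [Metric.mem_closedBall, dist_zero_right]
      exact ((h _).abs_le_sqrt 0).trans (Real.sqrt_le_sqrt (hK _)))
  set Z : Lp ℝ 2 (volume : Measure ℝ) := D.symm (WeakDual.toStrongDual Y) with hZ
  have hweak : ∀ g, MemLp g 2 volume →
      Tendsto (fun n => ∫ x, g x * v (φ₁ (φ₂ n)) x) atTop (𝓝 (∫ x, g x * Z x)) := by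
    intro g hg
    have h1 := (tendsto_iff_forall_eval_tendsto_topDualPairing.1 hY (hg.toLp g)).comp
      hφ₂.tendsto_atTop
    have h2 : ∀ n, topDualPairing ℝ _ (X n) (hg.toLp g) = ∫ x, g x * v n x := by
      intro n
      change inner ℝ (V n) (hg.toLp g) = _
      rw [hinner]
      refine integral_congr_ae ?_
      filter_upwards [(h n).memLp_der.coeFn_toLp, hg.coeFn_toLp] with x h1 h2
      rw [h1, h2, mul_comm]
    have h3 : topDualPairing ℝ _ Y (hg.toLp g) = ∫ x, g x * Z x := by
      have e : Y = StrongDual.toWeakDual (D Z) := by rw [hZ, D.apply_symm_apply]; rfl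
      rw [e]
      change inner ℝ Z (hg.toLp g) = _
      rw [hinner]
      refine integral_congr_ae ?_
      filter_upwards [hg.coeFn_toLp] with x h2
      rw [h2, mul_comm]
    rw [h3] at h1
    exact h1.congr fun n => h2 _
  have hZm : MemLp (Z : ℝ → ℝ) 2 volume := Lp.memLp Z
  have hP := IsPrim.primitive (hZm.locallyIntegrable (by norm_num)) c
  have hset : ∀ a b : ℝ, Tendsto (fun n => ∫ x in Ioc a b, v (φ₁ (φ₂ n)) x) atTop
      (𝓝 (∫ x in Ioc a b, Z x)) := by
    intro a b
    have hi : MemLp ((Ioc a b).indicator (fun _ => (1 : ℝ))) 2 volume :=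
      memLp_indicator_const 2 measurableSet_Ioc 1 (Or.inr (by simp))
    have e : ∀ f : ℝ → ℝ, ∫ x, (Ioc a b).indicator (fun _ => (1 : ℝ)) x * f x
        = ∫ x in Ioc a b, f x := by
      intro f
      rw [← integral_indicator measurableSet_Ioc]
      congr 1; funext x
      by_cases hx : x ∈ Ioc a b <;> simp [hx]
    have := hweak _ hi
    simp_rw [e] at this
    exact this
  have hpt : ∀ x, Tendsto (fun n => u (φ₁ (φ₂ n)) x) atTop
      (𝓝 (c + ∫ t in (0 : ℝ)..x, Z t)) := by
    intro x
    have e : ∀ n, u (φ₁ (φ₂ n)) x = u (φ₁ (φ₂ n)) 0 + ∫ t in (0 : ℝ)..x, v (φ₁ (φ₂ n)) t := by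
      intro n; rw [← (h _).prim.sub_eq]; ring
    simp_rw [e]
    exact hc.add ((hset 0 x).sub (hset x 0))
  refine ⟨φ₁ ∘ φ₂, hφ₁.comp hφ₂, _, _, ⟨hP, ?_, hZm⟩, hpt, hweak⟩
  rw [memLp_two_iff_integrable_sq hP.continuous.aestronglyMeasurable]
  -- Fatou's lemma puts the pointwise limit in `L²`.
  refine integrable_of_tendsto (G := fun n x => u (φ₁ (φ₂ n)) x ^ 2)
    (ae_of_all _ fun x => (hpt x).pow 2) (fun n => ((h _).continuous.pow 2).aestronglyMeasurable) ?_
  refine ne_top_of_le_ne_top (ENNReal.ofReal_ne_top (r := K)) ?_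
  refine liminf_le_of_frequently_le' (Frequently.of_forall fun n => ?_)
  have hint := (h (φ₁ (φ₂ n))).memLp.integrable_sq
  rw [← ofReal_integral_norm_eq_lintegral_enorm hint]
  refine ENNReal.ofReal_le_ofReal (le_trans (le_of_eq ?_) (hu2 (φ₁ (φ₂ n))))
  congr 1; funext x; rw [Real.norm_eq_abs, abs_of_nonneg (sq_nonneg _)]

/-! ### Coercivity, translations and the variational ratio. -/

lemma normSq_le_of_coercive {W u v : ℝ → ℝ} {δ : ℝ} (hδ : 0 < δ) (hW : Coercive W δ)
    (h : IsH1 u v) : normSq u v ≤ form W u v u v / δ := by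
  rw [le_div_iff₀ hδ, mul_comm]; exact hW u v h

lemma Coercive.form_nonneg {W u v : ℝ → ℝ} {δ : ℝ} (hδ : 0 < δ) (hW : Coercive W δ)
    (h : IsH1 u v) : 0 ≤ form W u v u v :=
  (mul_nonneg hδ.le (normSq_nonneg u v)).trans (hW u v h)

lemma Coercive.form_pos {W u v : ℝ → ℝ} {δ : ℝ} (hδ : 0 < δ) (hW : Coercive W δ)
    (h : IsH1 u v) {x : ℝ} (hx : u x ≠ 0) : 0 < form W u v u v := by
  have h1 := h.sq_le_normSq x
  have h2 : 0 < u x ^ 2 := by positivity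
  exact (mul_pos hδ (h2.trans_le h1)).trans_le (hW u v h)

lemma Coercive.of_tendsto {W : ℕ → ℝ → ℝ} {W' : ℝ → ℝ} {C δ : ℝ} (hb : ∀ n, IsBdd (W n) C)
    (hW : ∀ n, Coercive (W n) δ) (hlim : ∀ x, Tendsto (fun n => W n x) atTop (𝓝 (W' x))) :
    Coercive W' δ := fun _ _ h =>
  ge_of_tendsto' (form_tendsto hb hlim h) fun n => hW n _ _ h

lemma IsBdd.comp_add {W : ℝ → ℝ} {C : ℝ} (h : IsBdd W C) (c : ℝ) :
    IsBdd (fun x => W (x + c)) C :=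
  ⟨h.aesm.comp_measurePreserving (measurePreserving_add_right volume c), fun _ => h.abs_le _⟩

lemma form_comp_add (W u v f g : ℝ → ℝ) (c : ℝ) :
    form (fun x => W (x + c)) (fun x => u (x + c)) (fun x => v (x + c))
      (fun x => f (x + c)) (fun x => g (x + c)) = form W u v f g :=
  integral_add_right_eq_self (fun x => v x * g x + W x * (u x * f x)) c

lemma pot_comp_add (Γ u : ℝ → ℝ) (r c : ℝ) :
    pot (fun x => Γ (x + c)) r (fun x => u (x + c)) = pot Γ r u :=
  integral_add_right_eq_self (fun x => Γ x * |u x| ^ r) c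

lemma normSq_comp_add (u v : ℝ → ℝ) (c : ℝ) :
    normSq (fun x => u (x + c)) (fun x => v (x + c)) = normSq u v := by
  unfold normSq
  rw [integral_add_right_eq_self (fun x => u x ^ 2) c,
    integral_add_right_eq_self (fun x => v x ^ 2) c]

lemma Coercive.comp_add {W : ℝ → ℝ} {δ : ℝ} (h : Coercive W δ) (c : ℝ) :
    Coercive (fun x => W (x + c)) δ := by
  intro u v huv
  have h1 := h _ _ (huv.comp_add (-c))
  rw [normSq_comp_add] at h1
  rw [← form_comp_add W _ _ _ _ c] at h1
  simpa using h1

/-- All nonzero multiples considered, the ratio `B(u) / a(u)^(r/2)` is at most `S`. -/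
def RatioLe (W Γ : ℝ → ℝ) (r S : ℝ) : Prop :=
  ∀ u v, IsH1 u v → pot Γ r u ≤ S * form W u v u v ^ (r / 2)

/-- The ratio `B(u) / a(u)^(r/2)` is at least `S` for some `u ≠ 0`. -/
def RatioAttains (W Γ : ℝ → ℝ) (r S : ℝ) : Prop :=
  ∃ u v, IsH1 u v ∧ (∃ x, u x ≠ 0) ∧ S * form W u v u v ^ (r / 2) ≤ pot Γ r u

lemma RatioLe.comp_add {W Γ : ℝ → ℝ} {r S : ℝ} (h : RatioLe W Γ r S) (c : ℝ) :
    RatioLe (fun x => W (x + c)) (fun x => Γ (x + c)) r S := by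
  intro u v huv
  have h1 := h _ _ (huv.comp_add (-c))
  rw [← form_comp_add W _ _ _ _ c, ← pot_comp_add Γ _ r c] at h1
  simpa using h1

lemma ratioAttains_comp_add {W Γ : ℝ → ℝ} {r S c : ℝ}
    (h : RatioAttains (fun x => W (x + c)) (fun x => Γ (x + c)) r S) : RatioAttains W Γ r S := by
  obtain ⟨u, v, huv, ⟨x, hx⟩, h1⟩ := h
  refine ⟨_, _, huv.comp_add (-c), ⟨x + c, by simpa using hx⟩, ?_⟩
  rw [← form_comp_add W _ _ _ _ c, ← pot_comp_add Γ _ r c]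
  simpa using h1

/-- The derivative part vanishes by weak convergence. In the zeroth order part the bound of `W n` is
pulled out, and `∫ |u (w n - u)|` tends to zero by pointwise convergence and `L²` boundedness, so no
convergence of `W n` is needed. -/
lemma tendsto_form_sub {W : ℕ → ℝ → ℝ} {C K : ℝ} (hW : ∀ n, IsBdd (W n) C)
    {w w' : ℕ → ℝ → ℝ} {u v : ℝ → ℝ} (hw : ∀ n, IsH1 (w n) (w' n)) (huv : IsH1 u v)
    (hK : ∀ n, normSq (w n) (w' n) ≤ K)
    (hpt : ∀ x, Tendsto (fun n => w n x) atTop (𝓝 (u x)))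
    (hweak : ∀ g, MemLp g 2 volume →
      Tendsto (fun n => ∫ x, g x * w' n x) atTop (𝓝 (∫ x, g x * v x))) :
    Tendsto (fun n => form (W n) u v (fun x => w n x - u x) (fun x => w' n x - v x))
      atTop (𝓝 0) := by
  set ρ : ℕ → ℝ → ℝ := fun n x => w n x - u x with hρ
  set ρ' : ℕ → ℝ → ℝ := fun n x => w' n x - v x with hρ'
  have hρH : ∀ n, IsH1 (ρ n) (ρ' n) := fun n => (hw n).sub huv
  have hρL : ∀ n, ∫ x, ρ n x ^ 2 ≤ 2 * K + 2 * ∫ x, u x ^ 2 := by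
    intro n
    have h1 : ∫ x, ρ n x ^ 2 ≤ ∫ x, (2 * w n x ^ 2 + 2 * u x ^ 2) :=
      integral_mono (hρH n).memLp.integrable_sq
        (((hw n).memLp.integrable_sq.const_mul 2).fun_add (huv.memLp.integrable_sq.const_mul 2))
        fun x => by simp only [hρ]; nlinarith [sq_nonneg (w n x + u x)]
    rw [integral_add ((hw n).memLp.integrable_sq.const_mul 2)
      (huv.memLp.integrable_sq.const_mul 2), integral_const_mul, integral_const_mul] at h1
    have h2 := hK n
    rw [normSq] at h2
    have h3 : 0 ≤ ∫ x, w' n x ^ 2 := integral_nonneg fun x => sq_nonneg _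
    linarith
  have hρ0 : ∀ x, Tendsto (fun n => ρ n x) atTop (𝓝 0) := fun x => by
    simpa using (hpt x).sub_const (u x)
  have e : ∀ n, form (W n) u v (ρ n) (ρ' n)
      = ((∫ x, v x * w' n x) - ∫ x, v x * v x) + ∫ x, W n x * (u x * ρ n x) := by
    intro n
    rw [form_eq (hW n) huv (hρH n), ← integral_sub (huv.integrable_der_mul_der (hw n))
      (huv.integrable_der_mul_der huv)]
    congr 2; funext x; simp only [hρ']; ring
  refine Tendsto.congr (fun n => (e n).symm) ?_
  have h1 := (hweak v huv.memLp_der).sub_const (∫ x, v x * v x)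
  rw [sub_self] at h1
  have h2 : Tendsto (fun n => ∫ x, W n x * (u x * ρ n x)) atTop (𝓝 0) := by
    have h3 := (tendsto_integral_abs_mul_zero (fun n => (hρH n).memLp) huv.memLp hρL
      hρ0).const_mul C
    rw [mul_zero] at h3
    exact squeeze_zero_norm
      (fun n => (hW n).abs_integral_mul_le (huv.integrable_mul (hρH n))) h3
  simpa using h1.add h2

/-- The weak limit of a maximizing sequence attains the ratio for the limit problem. -/
lemma limit_ratio {W Γ : ℕ → ℝ → ℝ} {W' Γ' : ℝ → ℝ} {C δ r S : ℝ} (hr : 2 < r)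
    (hW : ∀ n, IsBdd (W n) C) (hΓ : ∀ n, IsBdd (Γ n) C)
    (hWl : ∀ x, Tendsto (fun n => W n x) atTop (𝓝 (W' x)))
    (hΓl : ∀ x, Tendsto (fun n => Γ n x) atTop (𝓝 (Γ' x)))
    (hδ : 0 < δ) (hco : ∀ n, Coercive (W n) δ) (hS0 : 0 ≤ S) (hS : ∀ n, RatioLe (W n) (Γ n) r S)
    {w w' : ℕ → ℝ → ℝ} {u v : ℝ → ℝ} (hw : ∀ n, IsH1 (w n) (w' n)) (huv : IsH1 u v)
    (hone : ∀ n, form (W n) (w n) (w' n) (w n) (w' n) = 1)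
    (hpot : Tendsto (fun n => pot (Γ n) r (w n)) atTop (𝓝 S))
    (hpt : ∀ x, Tendsto (fun n => w n x) atTop (𝓝 (u x)))
    (hweak : ∀ g, MemLp g 2 volume →
      Tendsto (fun n => ∫ x, g x * w' n x) atTop (𝓝 (∫ x, g x * v x))) (hne : ∃ x, u x ≠ 0) :
    RatioAttains W' Γ' r S := by
  set A := form W' u v u v with hA
  have hK : ∀ n, normSq (w n) (w' n) ≤ 1 / δ := fun n => by
    rw [← hone n]; exact normSq_le_of_coercive hδ (hco n) (hw n)
  set ρ : ℕ → ℝ → ℝ := fun n x => w n x - u x with hρ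
  set ρ' : ℕ → ℝ → ℝ := fun n x => w' n x - v x with hρ'
  have hρH : ∀ n, IsH1 (ρ n) (ρ' n) := fun n => (hw n).sub huv
  set θ : ℕ → ℝ := fun n => form (W n) (ρ n) (ρ' n) (ρ n) (ρ' n) with hθ
  have hθ0 : ∀ n, 0 ≤ θ n := fun n => (hco n).form_nonneg hδ (hρH n)
  have hcross := tendsto_form_sub hW hw huv hK hpt hweak
  -- The normalized mass `1` splits into the mass `A` of the limit and that of the remainder `ρ n`,
  -- because the cross term vanishes.
  have hθlim : Tendsto θ atTop (𝓝 (1 - A)) := by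
    have e : ∀ n, θ n = 1 - form (W n) u v u v - 2 * form (W n) u v (ρ n) (ρ' n) := by
      intro n
      have h1 := form_add_mul (hW n) huv (hρH n) 1
      have h2 : (fun x => u x + 1 * ρ n x) = w n := by funext x; simp [hρ]
      have h3 : (fun x => v x + 1 * ρ' n x) = w' n := by funext x; simp [hρ']
      rw [h2, h3, hone n] at h1
      simp only [hθ]; linarith
    rw [funext e]
    have := ((form_tendsto hW hWl huv).const_sub 1).sub (hcross.const_mul 2)
    simpa using this
  have hcW' : Coercive W' δ := Coercive.of_tendsto hW hco hWl
  have hA0 : 0 ≤ A := hcW'.form_nonneg hδ huv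
  have hA1 : 0 ≤ 1 - A := ge_of_tendsto' hθlim hθ0
  have hBL := tendsto_integral_brezis_lieb hr hw huv hK hpt
  have hle : ∀ n, pot (Γ n) r (w n) ≤ S * θ n ^ (r / 2) + pot (Γ n) r u
      + C * ∫ x, |(|w n x| ^ r - |w n x - u x| ^ r - |u x| ^ r)| := by
    intro n
    have i1 := (hw n).integrable_rpow hr
    have i2 := (hρH n).integrable_rpow hr
    have i3 := huv.integrable_rpow hr
    have h1 := hS n _ _ (hρH n)
    have i4 : Integrable (fun x => |w n x| ^ r - |ρ n x| ^ r - |u x| ^ r) := (i1.sub i2).sub i3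
    have i5 : Integrable (fun x => Γ n x * |w n x| ^ r - Γ n x * |ρ n x| ^ r) :=
      ((hΓ n).integrable_mul i1).sub ((hΓ n).integrable_mul i2)
    have h2 := (hΓ n).abs_integral_mul_le i4
    have h3 : ∫ x, Γ n x * (|w n x| ^ r - |ρ n x| ^ r - |u x| ^ r)
        = pot (Γ n) r (w n) - pot (Γ n) r (ρ n) - pot (Γ n) r u := by
      unfold pot
      rw [← integral_sub ((hΓ n).integrable_mul i1) ((hΓ n).integrable_mul i2),
        ← integral_sub i5 ((hΓ n).integrable_mul i3)]
      congr 1; funext x; ring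
    rw [h3] at h2
    have h4 := le_abs_self (pot (Γ n) r (w n) - pot (Γ n) r (ρ n) - pot (Γ n) r u)
    linarith
  have hlimle : S ≤ S * (1 - A) ^ (r / 2) + pot Γ' r u := by
    have h1 := (((hθlim.rpow_const (p := r / 2) (Or.inr (by linarith))).const_mul S).add
      (pot_tendsto hr hΓ hΓl huv)).add (hBL.const_mul C)
    rw [mul_zero, add_zero] at h1
    exact le_of_tendsto_of_tendsto' hpot h1 hle
  -- As `0 ≤ A ≤ 1` and `r / 2 > 1`, the limit inequality gives `S A ≤ B(u)`, hence `S A^(r/2) ≤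
  -- B(u)`. The limit attains the ratio even if it carries only part of the mass.
  have hq1 : (1 - A) ^ (r / 2) ≤ 1 - A :=
    Real.rpow_le_self_of_le_one hA1 (by linarith) (by linarith)
  have hq2 : A ^ (r / 2) ≤ A := Real.rpow_le_self_of_le_one hA0 (by linarith) (by linarith)
  refine ⟨u, v, huv, hne, ?_⟩
  nlinarith [mul_le_mul_of_nonneg_left hq1 hS0, mul_le_mul_of_nonneg_left hq2 hS0]

lemma abs_pot_le {Γ : ℝ → ℝ} {C r : ℝ} {u v : ℝ → ℝ} (hr : 2 < r) (hΓ : IsBdd Γ C)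
    (h : IsH1 u v) {M : ℝ} (hM : ∀ x, |u x| ≤ M) :
    |pot Γ r u| ≤ C * (M ^ (r - 2) * normSq u v) := by
  refine (hΓ.abs_integral_mul_le (h.integrable_rpow hr)).trans
    (mul_le_mul_of_nonneg_left ?_ hΓ.nonneg)
  have h1 : ∫ x, |(|u x| ^ r)| ≤ ∫ x, M ^ (r - 2) * u x ^ 2 := by
    refine integral_mono (h.integrable_rpow hr).abs (h.memLp.integrable_sq.const_mul _) fun x => ?_
    simp only
    rw [abs_of_nonneg (Real.rpow_nonneg (abs_nonneg _) _)]
    exact abs_rpow_le_mul_sq hr (hM x)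
  rw [integral_const_mul] at h1
  refine h1.trans (mul_le_mul_of_nonneg_left ?_
    (Real.rpow_nonneg ((abs_nonneg _).trans (hM 0)) _))
  have h3 : 0 ≤ ∫ x, v x ^ 2 := integral_nonneg fun x => sq_nonneg _
  rw [normSq]; linarith

lemma pot_const_mul (Γ u : ℝ → ℝ) (r : ℝ) {t : ℝ} (ht : 0 ≤ t) :
    pot Γ r (fun x => t * u x) = t ^ r * pot Γ r u := by
  unfold pot
  rw [← integral_const_mul]
  congr 1; funext x
  rw [abs_mul, Real.mul_rpow (abs_nonneg _) (abs_nonneg _), abs_of_nonneg ht]; ring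

lemma pot_eq_zero {u : ℝ → ℝ} (Γ : ℝ → ℝ) {r : ℝ} (hr : 2 < r) (hu : ∀ x, u x = 0) :
    pot Γ r u = 0 := by
  unfold pot
  simp [hu, Real.zero_rpow (by linarith : r ≠ 0)]

/-- The supremum of the ratio is finite and there is a maximizing sequence. -/
lemma exists_ratio_sup {W Γ : ℝ → ℝ} {C δ r : ℝ} (hr : 2 < r) (hΓ : IsBdd Γ C)
    (hδ : 0 < δ) (hco : Coercive W δ) (hpos : ∃ u v, IsH1 u v ∧ 0 < pot Γ r u) :
    ∃ S, 0 < S ∧ RatioLe W Γ r S ∧ ∃ w w' : ℕ → ℝ → ℝ, (∀ n, IsH1 (w n) (w' n)) ∧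
      (∀ n, form W (w n) (w' n) (w n) (w' n) = 1) ∧
      Tendsto (fun n => pot Γ r (w n)) atTop (𝓝 S) := by
  set A : Set ℝ := {b | ∃ u v, IsH1 u v ∧ form W u v u v = 1 ∧ b = pot Γ r u} with hA
  have hbdd : BddAbove A := by
    refine ⟨C * (√(1 / δ) ^ (r - 2) * (1 / δ)), ?_⟩
    rintro b ⟨u, v, huv, h1, rfl⟩
    have h2 := normSq_le_of_coercive hδ hco huv
    rw [h1] at h2
    refine (le_abs_self _).trans ((abs_pot_le hr hΓ huv fun x => (huv.abs_le_sqrt x).trans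
      (Real.sqrt_le_sqrt h2)).trans ?_)
    have := hΓ.nonneg
    gcongr
  have hscale : ∀ u v, IsH1 u v → 0 < form W u v u v →
      pot Γ r u / form W u v u v ^ (r / 2) ∈ A := by
    intro u v huv h0
    set a := form W u v u v with ha
    refine ⟨_, _, huv.const_mul (√a)⁻¹, ?_, ?_⟩
    · rw [form_const_mul, inv_pow, Real.sq_sqrt h0.le]
      exact inv_mul_cancel₀ h0.ne'
    · rw [pot_const_mul _ _ _ (by positivity), Real.inv_rpow (Real.sqrt_nonneg _),
        Real.sqrt_eq_rpow, ← Real.rpow_mul h0.le, div_eq_inv_mul]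
      congr 3; ring
  obtain ⟨u₀, v₀, h₀, hp₀⟩ := hpos
  have hne₀ : ∃ x, u₀ x ≠ 0 := by
    by_contra hcon
    push Not at hcon
    rw [pot_eq_zero Γ hr hcon] at hp₀
    exact lt_irrefl _ hp₀
  obtain ⟨x₀, hx₀⟩ := hne₀
  have ha₀ := hco.form_pos hδ h₀ hx₀
  have hne : A.Nonempty := ⟨_, hscale u₀ v₀ h₀ ha₀⟩
  refine ⟨sSup A, ?_, ?_, ?_⟩
  · exact (div_pos hp₀ (Real.rpow_pos_of_pos ha₀ _)).trans_le
      (le_csSup hbdd (hscale u₀ v₀ h₀ ha₀))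
  · intro u v huv
    by_cases h : ∃ x, u x ≠ 0
    · obtain ⟨x, hx⟩ := h
      have ha := hco.form_pos hδ huv hx
      have := le_csSup hbdd (hscale u v huv ha)
      rwa [div_le_iff₀ (Real.rpow_pos_of_pos ha _)] at this
    · push Not at h
      rw [pot_eq_zero Γ hr h]
      have h1 : 0 ≤ sSup A := (div_pos hp₀ (Real.rpow_pos_of_pos ha₀ _)).le.trans
        (le_csSup hbdd (hscale u₀ v₀ h₀ ha₀))
      exact mul_nonneg h1 (Real.rpow_nonneg (hco.form_nonneg hδ huv) _)
  · obtain ⟨b, -, hb, hbA⟩ := exists_seq_tendsto_sSup hne hbdd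
    choose w w' h1 h2 h3 using hbA
    refine ⟨w, w', h1, h2, ?_⟩
    rw [← funext h3]
    exact hb

lemma isBdd_interface {W₁ W₂ : ℝ → ℝ} {C : ℝ} (h₁ : IsBdd W₁ C) (h₂ : IsBdd W₂ C) :
    IsBdd (interface W₁ W₂) C := by
  refine ⟨?_, fun x => ?_⟩
  · have : interface W₁ W₂ = (Ioi (0 : ℝ)).piecewise W₁ W₂ := by
      funext x; simp [interface, Set.piecewise]
    rw [this]
    exact AEStronglyMeasurable.piecewise measurableSet_Ioi h₁.aesm.restrict h₂.aesm.restrict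
  · unfold interface
    split_ifs
    · exact h₁.abs_le x
    · exact h₂.abs_le x

/-- For fixed `x` the sequence is eventually constant: `x + k n` becomes positive, and the integer
shift is absorbed by periodicity. -/
lemma tendsto_interface_atTop {W₁ W₂ : ℝ → ℝ} (h : Function.Periodic W₁ 1) {k : ℕ → ℤ}
    (hk : Tendsto k atTop atTop) (x : ℝ) :
    Tendsto (fun n => interface W₁ W₂ (x + k n)) atTop (𝓝 (W₁ x)) := by
  refine tendsto_const_nhds.congr' ?_
  have h1 : Tendsto (fun n => x + (k n : ℝ)) atTop atTop :=
    tendsto_atTop_add_const_left _ _ (tendsto_intCast_atTop_atTop.comp hk)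
  filter_upwards [h1.eventually_gt_atTop 0] with n hn
  rw [interface, if_pos hn]
  have := (h.int_mul (k n)) x
  rw [mul_one] at this
  exact this.symm

lemma tendsto_interface_atBot {W₁ W₂ : ℝ → ℝ} (h : Function.Periodic W₂ 1) {k : ℕ → ℤ}
    (hk : Tendsto k atTop atBot) (x : ℝ) :
    Tendsto (fun n => interface W₁ W₂ (x + k n)) atTop (𝓝 (W₂ x)) := by
  refine tendsto_const_nhds.congr' ?_
  have h1 : Tendsto (fun n => x + (k n : ℝ)) atTop atBot :=
    tendsto_atBot_add_const_left _ _ ((tendsto_intCast_atBot_iff (R := ℝ)).2 hk)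
  filter_upwards [h1.eventually_le_atBot 0] with n hn
  rw [interface, if_neg (not_lt.2 hn)]
  have := (h.int_mul (k n)) x
  rw [mul_one] at this
  exact this.symm

/-- Either some value recurs infinitely often, or every bound is exceeded infinitely often, or the
sequence is eventually bounded above; in the last case, with no recurring value, it tends to `-∞`.
-/
lemma exists_subseq_int (k : ℕ → ℤ) : ∃ φ : ℕ → ℕ, StrictMono φ ∧
    ((∃ m, ∀ n, k (φ n) = m) ∨ Tendsto (k ∘ φ) atTop atTop ∨ Tendsto (k ∘ φ) atTop atBot) := by
  by_cases h : ∃ m, ∃ᶠ n in atTop, k n = m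
  · obtain ⟨m, hm⟩ := h
    obtain ⟨φ, h1, h2⟩ := extraction_of_frequently_atTop hm
    exact ⟨φ, h1, Or.inl ⟨m, h2⟩⟩
  · push Not at h
    by_cases hb : ∀ m : ℤ, ∃ᶠ n in atTop, m ≤ k n
    · obtain ⟨φ, h1, h2⟩ := extraction_forall_of_frequently (P := fun (i : ℕ) n => (i : ℤ) ≤ k n)
        fun i => hb i
      refine ⟨φ, h1, Or.inr (Or.inl (tendsto_atTop_mono h2 tendsto_natCast_atTop_atTop))⟩
    · push Not at hb
      obtain ⟨m, hm⟩ := hb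
      refine ⟨id, strictMono_id, Or.inr (Or.inr (tendsto_atBot.2 fun b => ?_))⟩
      have h2 : ∀ᶠ n in atTop, ∀ i ∈ Finset.Icc b m, k n ≠ i :=
        (Finset.eventually_all _).2 fun i _ => h i
      filter_upwards [hm, h2] with n h3 h4
      by_contra hlt
      simp only [Function.comp, id, not_le] at hlt
      exact h4 (k n) (Finset.mem_Icc.2 ⟨hlt.le, h3.le⟩) rfl

/-- Concentration compactness: the supremum `S` of the ratio for the interface problem is reached
by the interface problem itself or by one of the two periodic problems. -/
theorem ratioAttains_or {W₁ W₂ Γ₁ Γ₂ : ℝ → ℝ} {C δ r S : ℝ} (hr : 2 < r)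
    (hW₁ : IsBdd W₁ C) (hW₂ : IsBdd W₂ C) (hΓ₁ : IsBdd Γ₁ C) (hΓ₂ : IsBdd Γ₂ C)
    (pW₁ : Function.Periodic W₁ 1) (pW₂ : Function.Periodic W₂ 1)
    (pΓ₁ : Function.Periodic Γ₁ 1) (pΓ₂ : Function.Periodic Γ₂ 1)
    (hδ : 0 < δ) (hco : Coercive (interface W₁ W₂) δ) (hS0 : 0 < S)
    (hS : RatioLe (interface W₁ W₂) (interface Γ₁ Γ₂) r S)
    {w w' : ℕ → ℝ → ℝ} (hw : ∀ n, IsH1 (w n) (w' n))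
    (hone : ∀ n, form (interface W₁ W₂) (w n) (w' n) (w n) (w' n) = 1)
    (hpot : Tendsto (fun n => pot (interface Γ₁ Γ₂) r (w n)) atTop (𝓝 S)) :
    RatioAttains (interface W₁ W₂) (interface Γ₁ Γ₂) r S ∨ RatioAttains W₁ Γ₁ r S ∨
      RatioAttains W₂ Γ₂ r S := by
  have hW := isBdd_interface hW₁ hW₂
  have hΓ := isBdd_interface hΓ₁ hΓ₂
  have hC := hW.nonneg
  have hK : ∀ n, normSq (w n) (w' n) ≤ 1 / δ := fun n => by
    rw [← hone n]; exact normSq_le_of_coercive hδ hco (hw n)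
  -- Non-vanishing: if `|w n| ≤ d` everywhere then `B(w n) ≤ C d^(r-2) / δ`, which for small `d`
  -- stays below `S / 2`.
  obtain ⟨d, hd0, hd⟩ : ∃ d : ℝ, 0 < d ∧ ∀ᶠ n in atTop, ∃ x, d < |w n x| := by
    have hlim : Tendsto (fun d : ℝ => C * (d ^ (r - 2) * (1 / δ))) (𝓝[>] 0) (𝓝 0) := by
      have h1 : Tendsto (fun d : ℝ => d ^ (r - 2)) (𝓝 0) (𝓝 (0 ^ (r - 2))) :=
        (Real.continuous_rpow_const (by linarith : 0 ≤ r - 2)).tendsto 0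
      rw [Real.zero_rpow (by linarith)] at h1
      have := ((h1.mul_const (1 / δ)).const_mul C).mono_left
        (nhdsWithin_le_nhds (a := (0 : ℝ)) (s := Ioi 0))
      simpa using this
    obtain ⟨d, h1, h2⟩ := ((hlim.eventually_lt_const (half_pos hS0)).and
      self_mem_nhdsWithin).exists
    refine ⟨d, h2, ?_⟩
    filter_upwards [hpot.eventually_const_lt (half_lt_self hS0)] with n hn
    by_contra hcon
    push Not at hcon
    have h3 := (le_abs_self _).trans (abs_pot_le hr hΓ (hw n) hcon)
    have h4 : C * (d ^ (r - 2) * normSq (w n) (w' n)) ≤ C * (d ^ (r - 2) * (1 / δ)) := by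
      have := hK n
      have h5 : 0 ≤ d := le_of_lt h2
      gcongr
    linarith
  obtain ⟨N, hN⟩ := eventually_atTop.1 hd
  choose X hX using fun n => hN (n + N) (Nat.le_add_left N n)
  obtain ⟨φ₁, hφ₁, hcase⟩ := exists_subseq_int fun n => ⌊X n⌋
  set k : ℕ → ℤ := fun n => ⌊X (φ₁ n)⌋ with hk
  set z : ℕ → ℝ → ℝ := fun n x => w (φ₁ n + N) (x + k n) with hz
  set z' : ℕ → ℝ → ℝ := fun n x => w' (φ₁ n + N) (x + k n) with hz'
  have hzH : ∀ n, IsH1 (z n) (z' n) := fun n => (hw _).comp_add _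
  have hzK : ∀ n, normSq (z n) (z' n) ≤ 1 / δ := fun n => by
    have := normSq_comp_add (w (φ₁ n + N)) (w' (φ₁ n + N)) (k n)
    rw [show normSq (z n) (z' n) = _ from this]
    exact hK _
  obtain ⟨φ₂, hφ₂, u, v, huv, hpt, hweak⟩ := exists_subseq_tendsto hzH hzK
  -- After translation by `⌊X⌋` the large value sits at a fractional part in `[0, 1]`. Along a
  -- subsequence these points converge to some `y`, and Hölder equicontinuity keeps `|z|` away from
  -- zero at `y`.
  have hne : ∃ x, u x ≠ 0 := by
    obtain ⟨y, -, φ₃, hφ₃, hy⟩ := (isCompact_Icc (a := (0 : ℝ)) (b := 1)).tendsto_subseq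
      (x := fun n => Int.fract (X (φ₁ (φ₂ n))))
      fun n => ⟨Int.fract_nonneg _, (Int.fract_lt_one _).le⟩
    refine ⟨y, fun h0 => ?_⟩
    have h1 : ∀ n, d ≤ |z (φ₂ (φ₃ n)) y|
        + √(|Int.fract (X (φ₁ (φ₂ (φ₃ n)))) - y| * (1 / δ)) := by
      intro n
      set m := φ₂ (φ₃ n) with hm
      have h2 : d < |z m (Int.fract (X (φ₁ m)))| := by
        have := hX (φ₁ m)
        simp only [hz, hk, Int.fract_add_floor]
        exact this
      have h3 := (hzH m).sub_sq_le y (Int.fract (X (φ₁ m)))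
      have h4 : ∫ x, z' m x ^ 2 ≤ 1 / δ := by
        have := hzK m
        rw [normSq] at this
        have h0 : 0 ≤ ∫ x, z m x ^ 2 := integral_nonneg fun x => sq_nonneg _
        linarith
      have h5 : |z m (Int.fract (X (φ₁ m))) - z m y|
          ≤ √(|Int.fract (X (φ₁ m)) - y| * (1 / δ)) :=
        Real.abs_le_sqrt (h3.trans (mul_le_mul_of_nonneg_left h4 (abs_nonneg _)))
      have h6 := abs_sub_abs_le_abs_sub (z m (Int.fract (X (φ₁ m)))) (z m y)
      linarith
    have h2 : Tendsto (fun n => |z (φ₂ (φ₃ n)) y|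
        + √(|Int.fract (X (φ₁ (φ₂ (φ₃ n)))) - y| * (1 / δ))) atTop (𝓝 0) := by
      have h3 := ((hpt y).comp hφ₃.tendsto_atTop).abs
      rw [h0, abs_zero] at h3
      have h4 := (((hy.sub_const y).abs).mul_const (1 / δ)).sqrt
      simp only [sub_self, abs_zero, zero_mul, Real.sqrt_zero] at h4
      have := h3.add h4
      rw [add_zero] at this
      exact this
    exact absurd (ge_of_tendsto' h2 h1) (not_le.2 hd0)
  have hone' : ∀ n, form (fun x => interface W₁ W₂ (x + k (φ₂ n))) (z (φ₂ n)) (z' (φ₂ n))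
      (z (φ₂ n)) (z' (φ₂ n)) = 1 := fun n => by
    rw [← hone (φ₁ (φ₂ n) + N)]
    exact form_comp_add _ _ _ _ _ _
  have hpot' : Tendsto (fun n => pot (fun x => interface Γ₁ Γ₂ (x + k (φ₂ n))) r (z (φ₂ n)))
      atTop (𝓝 S) := by
    have : Tendsto (fun n => φ₁ (φ₂ n) + N) atTop atTop :=
      tendsto_atTop_mono (fun n => Nat.le_add_right _ N) (hφ₁.comp hφ₂).tendsto_atTop
    refine (hpot.comp this).congr fun n => ?_
    exact (pot_comp_add _ _ _ _).symm
  have main := fun (W' Γ' : ℝ → ℝ) h1 h2 => limit_ratio (W' := W') (Γ' := Γ') hr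
    (fun n => hW.comp_add (k (φ₂ n))) (fun n => hΓ.comp_add (k (φ₂ n))) h1 h2 hδ
    (fun n => hco.comp_add (k (φ₂ n))) hS0.le (fun n => hS.comp_add (k (φ₂ n)))
    (fun n => hzH (φ₂ n)) huv hone' hpot' hpt hweak hne
  rcases hcase with ⟨m, hm⟩ | hT | hB
  · left
    have hkm : ∀ n, k n = m := hm
    refine ratioAttains_comp_add (c := m) (main _ _ (fun x => ?_) fun x => ?_) <;>
    · simp only [hkm]; exact tendsto_const_nhds
  · right; left
    have : Tendsto (fun n => k (φ₂ n)) atTop atTop := hT.comp hφ₂.tendsto_atTop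
    exact main _ _ (tendsto_interface_atTop pW₁ this) (tendsto_interface_atTop pΓ₁ this)
  · right; right
    have : Tendsto (fun n => k (φ₂ n)) atTop atBot := hB.comp hφ₂.tendsto_atTop
    exact main _ _ (tendsto_interface_atBot pW₂ this) (tendsto_interface_atBot pΓ₂ this)

lemma interface_self (f : ℝ → ℝ) : interface f f = f := by
  funext x; simp [interface]

/-- In a periodic problem the supremum of the ratio is attained. -/
theorem exists_periodic_maximizer {W Γ : ℝ → ℝ} {C δ r : ℝ} (hr : 2 < r)
    (hW : IsBdd W C) (hΓ : IsBdd Γ C) (pW : Function.Periodic W 1) (pΓ : Function.Periodic Γ 1)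
    (hδ : 0 < δ) (hco : Coercive W δ) (hpos : ∃ u v, IsH1 u v ∧ 0 < pot Γ r u) :
    ∃ S, 0 < S ∧ RatioLe W Γ r S ∧ RatioAttains W Γ r S := by
  obtain ⟨S, hS0, hS, w, w', hw, hone, hpot⟩ := exists_ratio_sup hr hΓ hδ hco hpos
  refine ⟨S, hS0, hS, ?_⟩
  -- Gluing a coefficient to itself changes nothing, so the three alternatives coincide.
  have := ratioAttains_or (W₁ := W) (W₂ := W) (Γ₁ := Γ) (Γ₂ := Γ) hr hW hW hΓ hΓ pW pW pΓ pΓ hδ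
    (by rwa [interface_self]) hS0 (by rwa [interface_self, interface_self]) hw
    (by simpa only [interface_self] using hone) (by simpa only [interface_self] using hpot)
  rw [interface_self, interface_self] at this
  tauto

/-! ### Maximizers, strong ground states and ground state energies. -/

/-- A maximizer of the ratio, scaled to lie on the Nehari manifold. -/
structure IsExtremal (W Γ : ℝ → ℝ) (r S : ℝ) (u v : ℝ → ℝ) : Prop where
  isH1 : IsH1 u v
  ne_zero : ∃ x, u x ≠ 0
  form_eq_pot : form W u v u v = pot Γ r u
  pot_eq : pot Γ r u = S * form W u v u v ^ (r / 2)

lemma exists_isExtremal {W Γ : ℝ → ℝ} {δ r S : ℝ} (hr : 2 < r) (hδ : 0 < δ) (hco : Coercive W δ)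
    (hS0 : 0 < S) (hS : RatioLe W Γ r S) (h : RatioAttains W Γ r S) :
    ∃ u v, IsExtremal W Γ r S u v := by
  obtain ⟨u, v, huv, ⟨x, hx⟩, hle⟩ := h
  have heq : pot Γ r u = S * form W u v u v ^ (r / 2) := le_antisymm (hS u v huv) hle
  have ha := hco.form_pos hδ huv hx
  have hb : 0 < pot Γ r u := by rw [heq]; exact mul_pos hS0 (Real.rpow_pos_of_pos ha _)
  set a := form W u v u v with hadef
  set b := pot Γ r u with hbdef
  -- This is the root of `t^r b = t² a`: `B` and `a` scale with different powers, while the ratio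
  -- does not change.
  set t := (a / b) ^ (1 / (r - 2)) with ht
  have hab : 0 < a / b := div_pos ha hb
  have ht0 : 0 < t := Real.rpow_pos_of_pos hab _
  have htr : t ^ r * b = t ^ 2 * a := by
    have h1 : t ^ r = t ^ (r - 2) * t ^ 2 := by
      rw [← Real.rpow_natCast, ← Real.rpow_add ht0]; congr 1; push_cast; ring
    have h2 : t ^ (r - 2) = a / b := by
      rw [ht, ← Real.rpow_mul hab.le, one_div_mul_cancel (by linarith), Real.rpow_one]
    rw [h1, h2]; field_simp
  refine ⟨_, _, huv.const_mul t, ⟨x, mul_ne_zero ht0.ne' hx⟩, ?_, ?_⟩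
  · rw [form_const_mul, pot_const_mul _ _ _ ht0.le]; exact htr.symm
  · rw [form_const_mul, pot_const_mul _ _ _ ht0.le, Real.mul_rpow (by positivity) ha.le,
      ← Real.rpow_natCast t 2, ← Real.rpow_mul ht0.le, ← hbdef, heq]
    rw [show ((2 : ℕ) : ℝ) * (r / 2) = r by push_cast; ring]
    ring

lemma IsExtremal.form_pos {W Γ u v : ℝ → ℝ} {δ r S : ℝ} (hδ : 0 < δ) (hco : Coercive W δ)
    (h : IsExtremal W Γ r S u v) : 0 < form W u v u v := by
  obtain ⟨x, hx⟩ := h.ne_zero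
  exact hco.form_pos hδ h.isH1 hx

/-- This relation translates between the supremum of the ratio and the energy level: on the Nehari
manifold a larger `S` means a smaller form. It also normalizes the Lagrange multiplier to one. -/
lemma IsExtremal.mul_rpow_eq_one {W Γ u v : ℝ → ℝ} {δ r S : ℝ} (hδ : 0 < δ) (hco : Coercive W δ)
    (h : IsExtremal W Γ r S u v) : S * form W u v u v ^ (r / 2 - 1) = 1 := by
  have ha := h.form_pos hδ hco
  have h1 := h.form_eq_pot.trans h.pot_eq
  rw [Real.rpow_sub_one ha.ne']
  field_simp
  exact h1.symm

/-- Among the elements of the Nehari manifold, maximizers have the least quadratic form. -/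
lemma IsExtremal.form_le {W Γ u v f g : ℝ → ℝ} {δ r S : ℝ} (hr : 2 < r) (hδ : 0 < δ)
    (hco : Coercive W δ) (hS : RatioLe W Γ r S) (h : IsExtremal W Γ r S u v)
    (hf : IsH1 f g) (hne : ∃ x, f x ≠ 0) (hfp : form W f g f g = pot Γ r f) :
    form W u v u v ≤ form W f g f g := by
  obtain ⟨x, hx⟩ := hne
  have ha := hco.form_pos hδ hf hx
  have h1 := hS f g hf
  rw [← hfp] at h1
  have h2 : 1 ≤ S * form W f g f g ^ (r / 2 - 1) := by
    rw [Real.rpow_sub_one ha.ne', ← mul_div_assoc, le_div_iff₀ ha, one_mul]; exact h1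
  replace h2 : S * form W u v u v ^ (r / 2 - 1) ≤ S * form W f g f g ^ (r / 2 - 1) := by
    rw [h.mul_rpow_eq_one hδ hco]; exact h2
  have hS0 : 0 < S := by
    by_contra hcon
    have h3 := h.mul_rpow_eq_one hδ hco
    have h4 : 0 < form W u v u v ^ (r / 2 - 1) := Real.rpow_pos_of_pos (h.form_pos hδ hco) _
    nlinarith
  have h3 := le_of_mul_le_mul_left h2 hS0
  exact (Real.rpow_le_rpow_iff (h.form_pos hδ hco).le ha.le (by linarith)).1 h3

lemma hasDerivAt_pot {Γ : ℝ → ℝ} {C r : ℝ} {u v f g : ℝ → ℝ} (hr : 2 < r) (hΓ : IsBdd Γ C)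
    (hu : IsH1 u v) (hf : IsH1 f g) :
    HasDerivAt (fun t : ℝ => pot Γ r (fun x => u x + t * f x))
      (r * ∫ x, Γ x * |u x| ^ (r - 2) * u x * f x) 0 := by
  set M := √(normSq u v) + √(normSq f g) with hM
  have hM0 : 0 ≤ M := by positivity
  have hC := hΓ.nonneg
  have hr0 : 0 < r := by linarith
  have hcr : Continuous (fun s : ℝ => |s| ^ (r - 2)) :=
    continuous_abs.rpow_const fun _ => Or.inr (by linarith)
  have key := hasDerivAt_integral_of_dominated_loc_of_deriv_le (μ := volume) (𝕜 := ℝ)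
    (F := fun t x => Γ x * |u x + t * f x| ^ r)
    (F' := fun t x => Γ x * (r * |u x + t * f x| ^ (r - 2) * (u x + t * f x) * f x))
    (x₀ := 0) (s := Metric.ball 0 1)
    (bound := fun x => C * (r * M ^ (r - 2)) * (|u x * f x| + f x ^ 2))
    (Metric.ball_mem_nhds 0 one_pos)
    (Eventually.of_forall fun t => hΓ.aesm.mul
      ((hu.add (hf.const_mul t)).continuous_rpow hr).aestronglyMeasurable)
    (by simpa using hΓ.integrable_mul (hu.integrable_rpow hr))
    (hΓ.aesm.mul (by
      have := hu.continuous; have := hf.continuous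
      have h3 : Continuous fun x => |u x + 0 * f x| ^ (r - 2) := hcr.comp (by fun_prop)
      exact (((continuous_const.mul h3).mul (by fun_prop)).mul
        hf.continuous).aestronglyMeasurable))
    (ae_of_all _ fun x t ht => by
      have ht1 : |t| ≤ 1 := by
        have := Metric.mem_ball.1 ht
        rw [dist_zero_right, Real.norm_eq_abs] at this; exact this.le
      have h1 : |u x + t * f x| ≤ |u x| + |f x| := by
        refine (abs_add_le _ _).trans ?_
        rw [abs_mul]
        nlinarith [abs_nonneg (f x)]
      have h2 : |u x + t * f x| ≤ M :=
        h1.trans (add_le_add (hu.abs_le_sqrt x) (hf.abs_le_sqrt x))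
      have h3 : |u x + t * f x| ^ (r - 2) ≤ M ^ (r - 2) :=
        Real.rpow_le_rpow (abs_nonneg _) h2 (by linarith)
      rw [Real.norm_eq_abs, abs_mul, abs_mul, abs_mul, abs_mul, abs_of_pos hr0,
        abs_of_nonneg (Real.rpow_nonneg (abs_nonneg _) _)]
      have h4 : |u x + t * f x| * |f x| ≤ |u x * f x| + f x ^ 2 := by
        rw [abs_mul, ← sq_abs (f x)]; nlinarith [abs_nonneg (f x)]
      calc |Γ x| * (r * |u x + t * f x| ^ (r - 2) * |u x + t * f x| * |f x|)
          = |Γ x| * (r * |u x + t * f x| ^ (r - 2)) * (|u x + t * f x| * |f x|) := by ring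
        _ ≤ C * (r * M ^ (r - 2)) * (|u x * f x| + f x ^ 2) := by
          have := hΓ.abs_le x
          gcongr)
    (((hu.integrable_mul hf).abs.add hf.memLp.integrable_sq).const_mul _)
    (ae_of_all _ fun x t ht => by
      have h1 : HasDerivAt (fun t : ℝ => u x + t * f x) (f x) t := by
        simpa using ((hasDerivAt_id t).mul_const (f x)).const_add (u x)
      exact ((hasDerivAt_abs_rpow (u x + t * f x) (by linarith : 1 < r)).comp t h1).const_mul _)
  have h2 := key.2
  simp only [zero_mul, add_zero] at h2
  have e : r * ∫ x, Γ x * |u x| ^ (r - 2) * u x * f x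
      = ∫ x, Γ x * (r * |u x| ^ (r - 2) * u x * f x) := by
    rw [← integral_const_mul]
    congr 1; funext x; ring
  rw [e]
  exact h2

/-- The function `t ↦ B(u + t f) - S a(u + t f)^(r/2)` is nowhere positive and vanishes at `t = 0`,
so its derivative there is zero. The factor `S a(u)^(r/2-1)` in that derivative equals one. -/
lemma IsExtremal.euler {W Γ u v f g : ℝ → ℝ} {C δ r S : ℝ} (hr : 2 < r) (hW : IsBdd W C)
    (hΓ : IsBdd Γ C) (hδ : 0 < δ) (hco : Coercive W δ) (hS : RatioLe W Γ r S)
    (h : IsExtremal W Γ r S u v) (hf : IsH1 f g) :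
    form W u v f g = ∫ x, Γ x * |u x| ^ (r - 2) * u x * f x := by
  have ha := h.form_pos hδ hco
  have hd1 := hasDerivAt_pot hr hΓ h.isH1 hf
  have hd2 : HasDerivAt (fun t : ℝ => form W (fun x => u x + t * f x) (fun x => v x + t * g x)
      (fun x => u x + t * f x) (fun x => v x + t * g x)) (2 * form W u v f g) 0 := by
    have e : (fun t : ℝ => form W (fun x => u x + t * f x) (fun x => v x + t * g x)
      (fun x => u x + t * f x) (fun x => v x + t * g x)) = fun t => form W u v u v
        + 2 * t * form W u v f g + t ^ 2 * form W f g f g :=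
      funext fun t => form_add_mul hW h.isH1 hf t
    rw [e]
    have h1 := (((hasDerivAt_id (0 : ℝ)).const_mul 2).mul_const (form W u v f g)).const_add
      (form W u v u v)
    have h2 := ((hasDerivAt_id (0 : ℝ)).pow 2).mul_const (form W f g f g)
    exact (h1.add h2).congr_deriv (by simp)
  have hd3 := (hd2.rpow_const (p := r / 2) (Or.inl (by simpa using ha.ne'))).const_mul S
  have hd := hd1.sub hd3
  have hmax : IsLocalMax (fun t : ℝ => pot Γ r (fun x => u x + t * f x)
      - S * form W (fun x => u x + t * f x) (fun x => v x + t * g x)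
      (fun x => u x + t * f x) (fun x => v x + t * g x) ^ (r / 2)) 0 := by
    refine Eventually.of_forall fun t => ?_
    have h1 := hS _ _ (h.isH1.add (hf.const_mul t))
    have h2 := h.pot_eq
    simp only [zero_mul, add_zero]
    linarith
  have h0 := hmax.hasDerivAt_eq_zero hd
  simp only [zero_mul, add_zero] at h0
  have h1 := h.mul_rpow_eq_one hδ hco
  have h2 : r * ((∫ x, Γ x * |u x| ^ (r - 2) * u x * f x) - form W u v f g) = 0 := by
    calc _ = r * (∫ x, Γ x * |u x| ^ (r - 2) * u x * f x)
        - (S * form W u v u v ^ (r / 2 - 1)) * (r * form W u v f g) := by rw [h1]; ring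
      _ = 0 := by rw [← h0]; ring
  have h3 := (mul_eq_zero.1 h2).resolve_left (by linarith)
  linarith

lemma H1.nontrivial_iff {U : H1} {w : ℝ → ℝ} (hw : w =ᵐ[volume] U.val) (hc : Continuous w) :
    U.Nontrivial ↔ ∃ x, w x ≠ 0 := by
  unfold H1.Nontrivial
  rw [← not_iff_not, not_not]
  push Not
  constructor
  · intro h
    have : w = fun _ => 0 := (hc.ae_eq_iff_eq volume continuous_const).1 (hw.trans h)
    exact fun x => congrFun this x
  · intro h
    filter_upwards [hw] with x hx
    rw [← hx, h x]; rfl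

section energy

variable {W Γ w : ℝ → ℝ} {C p : ℝ} {U : H1}

lemma energy_eq (hp : 1 < p) (hW : IsBdd W C) (hΓ : IsBdd Γ C) (hw : w =ᵐ[volume] U.val)
    (h : IsH1 w U.der) :
    energy W Γ p U = 1 / 2 * form W w U.der w U.der - 1 / (p + 1) * pot Γ (p + 1) w := by
  unfold energy form pot
  rw [← integral_const_mul, ← integral_const_mul,
    ← integral_sub ((integrable_form hW h h).const_mul _)
      ((hΓ.integrable_mul (h.integrable_rpow (by linarith))).const_mul _)]
  refine integral_congr_ae ?_
  filter_upwards [hw] with x hx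
  rw [hx]; ring

lemma mem_nehari_iff (hp : 1 < p) (hW : IsBdd W C) (hΓ : IsBdd Γ C) (hw : w =ᵐ[volume] U.val)
    (h : IsH1 w U.der) :
    U ∈ nehari W Γ p ↔ (∃ x, w x ≠ 0) ∧ form W w U.der w U.der = pot Γ (p + 1) w := by
  unfold nehari
  rw [mem_ofPred_eq, U.nontrivial_iff hw h.continuous, ← sub_eq_zero (b := pot Γ (p + 1) w)]
  unfold form pot
  rw [← integral_sub (integrable_form hW h h)
    (hΓ.integrable_mul (h.integrable_rpow (by linarith)))]
  rw [integral_congr_ae (g := fun x => U.der x * U.der x + W x * (w x * w x)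
    - Γ x * |w x| ^ (p + 1))]
  filter_upwards [hw] with x hx
  rw [hx]; ring

/-- On the Nehari manifold the energy is the form times the positive constant `1/2 - 1/(p+1)`, so
minimality of the form suffices. -/
lemma IsExtremal.isStrongGroundState {u v : ℝ → ℝ} {δ S : ℝ} (hp : 1 < p) (hW : IsBdd W C)
    (hΓ : IsBdd Γ C) (hδ : 0 < δ) (hco : Coercive W δ) (hS : RatioLe W Γ (p + 1) S)
    (h : IsExtremal W Γ (p + 1) S u v) : ∃ w, IsStrongGroundState W Γ p w := by
  have hr : 2 < p + 1 := by linarith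
  refine ⟨h.isH1.toH1, ?_⟩
  have hmem : h.isH1.toH1 ∈ nehari W Γ p :=
    (mem_nehari_iff (U := h.isH1.toH1) hp hW hΓ (ae_eq_refl u) h.isH1).2
      ⟨h.ne_zero, h.form_eq_pot⟩
  refine ⟨hmem, IsLeast.isGLB ⟨mem_image_of_mem _ hmem, ?_⟩⟩
  rintro _ ⟨U, hU, rfl⟩
  obtain ⟨w, hw, hH⟩ := U.exists_rep
  obtain ⟨hne, hfp⟩ := (mem_nehari_iff hp hW hΓ hw hH).1 hU
  rw [energy_eq hp hW hΓ hw hH, energy_eq (U := h.isH1.toH1) hp hW hΓ (ae_eq_refl u) h.isH1,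
    ← hfp]
  change 1 / 2 * form W u v u v - 1 / (p + 1) * pot Γ (p + 1) u ≤ _
  rw [← h.form_eq_pot, ← sub_mul, ← sub_mul]
  refine mul_le_mul_of_nonneg_left (h.form_le hr hδ hco hS hH hne hfp) ?_
  rw [sub_nonneg]
  exact one_div_le_one_div_of_le (by norm_num) (by linarith)

lemma IsExtremal.isBoundState {u v : ℝ → ℝ} {δ S : ℝ} (hp : 1 < p) (hW : IsBdd W C)
    (hΓ : IsBdd Γ C) (hδ : 0 < δ) (hco : Coercive W δ) (hS : RatioLe W Γ (p + 1) S)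
    (h : IsExtremal W Γ (p + 1) S u v) : IsBoundState W Γ p h.isH1.toH1 := by
  intro φ hφ hc
  have := h.euler (by linarith) hW hΓ hδ hco hS (IsH1.of_contDiff hφ hc)
  rw [show p + 1 - 2 = p - 1 by ring] at this
  change _ = ∫ x, Γ x * |u x| ^ (p - 1) * u x * φ x
  rw [← this]
  change ∫ x, (v x * deriv φ x + W x * u x * φ x) = ∫ x, _
  congr 1; funext x; ring

/-- Bound states are strong solutions. -/
lemma IsBoundState.exists_isH1_der (hp : 1 < p) (hW : IsBdd W C) (hΓ : IsBdd Γ C)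
    (hU : IsBoundState W Γ p U) (hw : w =ᵐ[volume] U.val) (h : IsH1 w U.der) :
    ∃ d, d =ᵐ[volume] U.der ∧
      IsH1 d (fun x => W x * w x - Γ x * (|w x| ^ (p - 1) * w x)) := by
  have hNm : MemLp (fun x => Γ x * (|w x| ^ (p - 1) * w x)) 2 volume := by
    refine hΓ.memLp_mul ((h.memLp.const_mul (√(normSq w U.der) ^ (p - 1))).mono ?_
      (ae_of_all _ fun x => ?_))
    · exact ((h.continuous.abs.rpow_const fun _ => Or.inr (by linarith)).mul
        h.continuous).aestronglyMeasurable
    · rw [norm_mul, norm_mul]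
      refine mul_le_mul_of_nonneg_right ?_ (norm_nonneg _)
      rw [Real.norm_eq_abs, Real.norm_eq_abs, abs_of_nonneg (Real.rpow_nonneg (abs_nonneg _) _),
        abs_of_nonneg (Real.rpow_nonneg (Real.sqrt_nonneg _) _)]
      exact Real.rpow_le_rpow (abs_nonneg _) (h.abs_le_sqrt x) (by linarith)
  have hWm := hW.memLp_mul h.memLp
  have hm := hWm.sub hNm
  refine exists_isH1_of_isWeakDeriv h.memLp_der hm fun φ hφ hc => ?_
  have hφH := IsH1.of_contDiff hφ hc
  have h1 := hU φ hφ hc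
  have i1 := integrable_mul_of_memLp h.memLp_der hφH.memLp_der
  have i2 := integrable_mul_of_memLp hφH.memLp hWm
  have i3 := integrable_mul_of_memLp hφH.memLp hNm
  have e1 : ∫ x, (U.der x * deriv φ x + W x * U.val x * φ x)
      = (∫ x, U.der x * deriv φ x) + ∫ x, φ x * (W x * w x) := by
    rw [← integral_add i1 i2]
    refine integral_congr_ae ?_
    filter_upwards [hw] with x hx
    rw [hx]; ring
  have e2 : ∫ x, Γ x * |U.val x| ^ (p - 1) * U.val x * φ x
      = ∫ x, φ x * (Γ x * (|w x| ^ (p - 1) * w x)) := by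
    refine integral_congr_ae ?_
    filter_upwards [hw] with x hx
    rw [hx]; ring
  rw [e1, e2] at h1
  simp only [smul_eq_mul, mul_sub]
  rw [integral_sub i2 i3]
  have e3 : ∫ x, deriv φ x * U.der x = ∫ x, U.der x * deriv φ x := by simp_rw [mul_comm]
  rw [e3]; linarith

/-- The equation tested with the solution itself. As `u'` has a representative in `H¹`, this is one
integration by parts in `H¹` and needs no approximation by test functions. -/
lemma IsBoundState.form_eq_pot (hp : 1 < p) (hW : IsBdd W C) (hΓ : IsBdd Γ C)
    (hU : IsBoundState W Γ p U) (hw : w =ᵐ[volume] U.val) (h : IsH1 w U.der) :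
    form W w U.der w U.der = pot Γ (p + 1) w := by
  obtain ⟨d, hd, hdH⟩ := hU.exists_isH1_der hp hW hΓ hw h
  have h' := h.congr_der hd.symm
  have h1 : form W w U.der w U.der = form W w d w d := by
    refine integral_congr_ae ?_
    filter_upwards [hd] with x hx
    rw [hx]
  rw [h1, form_eq hW h' h', hdH.integral_mul_der h', ← integral_neg,
    ← integral_add (integrable_mul_of_memLp hdH.memLp_der h.memLp).fun_neg
      (hW.integrable_mul (h.integrable_mul h))]
  refine integral_congr_ae (ae_of_all _ fun x => ?_)
  have : |w x| ^ (p + 1) = |w x| ^ (p - 1) * w x * w x := by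
    rcases eq_or_ne (w x) 0 with h0 | h0
    · simp [h0, Real.zero_rpow (by linarith : p + 1 ≠ 0)]
    · rw [mul_assoc, ← abs_mul_abs_self (w x), ← sq, ← Real.rpow_natCast,
        ← Real.rpow_add (abs_pos.2 h0)]
      congr 1; push_cast; ring
  simp only
  rw [this]; ring

/-- Nontrivial bound states lie on the Nehari manifold, and the extremal is itself a bound state, so
the infimum in `groundEnergy` is a minimum attained there. -/
lemma IsExtremal.groundEnergy_eq {u v : ℝ → ℝ} {δ S : ℝ} (hp : 1 < p) (hW : IsBdd W C)
    (hΓ : IsBdd Γ C) (hδ : 0 < δ) (hco : Coercive W δ) (hS : RatioLe W Γ (p + 1) S)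
    (h : IsExtremal W Γ (p + 1) S u v) :
    groundEnergy W Γ p = (1 / 2 - 1 / (p + 1)) * form W u v u v := by
  have hr : 2 < p + 1 := by linarith
  refine IsLeast.csInf_eq ⟨⟨h.isH1.toH1, ⟨h.isBoundState hp hW hΓ hδ hco hS,
    (H1.nontrivial_iff (U := h.isH1.toH1) (ae_eq_refl u) h.isH1.continuous).2 h.ne_zero⟩, ?_⟩, ?_⟩
  · rw [energy_eq (U := h.isH1.toH1) hp hW hΓ (ae_eq_refl u) h.isH1, ← h.form_eq_pot, sub_mul]
    rfl
  · rintro _ ⟨U, ⟨hU, hnt⟩, rfl⟩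
    obtain ⟨w, hw, hH⟩ := U.exists_rep
    have hfp := hU.form_eq_pot hp hW hΓ hw hH
    have hne := (H1.nontrivial_iff hw hH.continuous).1 hnt
    rw [energy_eq hp hW hΓ hw hH, ← hfp, ← sub_mul]
    refine mul_le_mul_of_nonneg_left (h.form_le hr hδ hco hS hH hne hfp) ?_
    rw [sub_nonneg]
    exact one_div_le_one_div_of_le (by norm_num) (by linarith)

end energy

/-- Both `cᵢ = (1/2 - 1/(p+1)) aᵢ` and `Sᵢ aᵢ^((p-1)/2) = 1` hold, so the order of the energies is
reversed for the ratios. -/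
lemma IsExtremal.ratio_le_of_groundEnergy_le {W₁ Γ₁ W₂ Γ₂ u₁ v₁ u₂ v₂ : ℝ → ℝ}
    {C δ p S₁ S₂ : ℝ} (hp : 1 < p) (hW₁ : IsBdd W₁ C) (hΓ₁ : IsBdd Γ₁ C) (hW₂ : IsBdd W₂ C)
    (hΓ₂ : IsBdd Γ₂ C) (hδ : 0 < δ) (hco₁ : Coercive W₁ δ) (hco₂ : Coercive W₂ δ)
    (hS₁ : RatioLe W₁ Γ₁ (p + 1) S₁) (hS₂ : RatioLe W₂ Γ₂ (p + 1) S₂) (hS₁0 : 0 < S₁)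
    (hS₂0 : 0 < S₂)
    (h₁ : IsExtremal W₁ Γ₁ (p + 1) S₁ u₁ v₁) (h₂ : IsExtremal W₂ Γ₂ (p + 1) S₂ u₂ v₂)
    (hle : groundEnergy W₁ Γ₁ p ≤ groundEnergy W₂ Γ₂ p) : S₂ ≤ S₁ := by
  rw [h₁.groundEnergy_eq hp hW₁ hΓ₁ hδ hco₁ hS₁, h₂.groundEnergy_eq hp hW₂ hΓ₂ hδ hco₂ hS₂] at hle
  have hk : 0 < 1 / 2 - 1 / (p + 1) := by
    rw [sub_pos]
    exact one_div_lt_one_div_of_lt (by norm_num) (by linarith)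
  have h3 := le_of_mul_le_mul_left hle hk
  have e1 := h₁.mul_rpow_eq_one hδ hco₁
  have e2 := h₂.mul_rpow_eq_one hδ hco₂
  have ha1 := h₁.form_pos hδ hco₁
  have h4 := Real.rpow_le_rpow ha1.le h3 (by linarith : 0 ≤ (p + 1) / 2 - 1)
  have h5 : 0 < form W₁ u₁ v₁ u₁ v₁ ^ ((p + 1) / 2 - 1) := Real.rpow_pos_of_pos ha1 _
  by_contra hcon
  push Not at hcon
  nlinarith [mul_le_mul_of_nonneg_left h4 hS₂0.le]

/-! ### Unique continuation. -/

/-- Unique continuation for `u'' = z` with `|z| ≤ K |u|`. -/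
lemma eq_zero_of_eq_zero_Iic {u d z : ℝ → ℝ} {K T b : ℝ} (hu : IsPrim u d) (hd : IsPrim d z)
    (hK0 : 0 ≤ K) (hz : ∀ x ≤ T, |z x| ≤ K * |u x|) (h0 : ∀ x ≤ b, u x = 0) :
    ∀ x ≤ T, u x = 0 := by
  -- Starting strictly inside the zero set makes `d` vanish there as well. The step length below
  -- satisfies `K h² < 1`: with zero data at the left end, `max |u| ≤ K h² max |u|` on an interval
  -- of length `h`.
  set c := b - 1 with hc
  set h := 1 / (K + 1) with hh
  have hh0 : 0 < h := by positivity
  have hKh : K * h * h < 1 := by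
    have h1 : (K + 1) * h = 1 := mul_one_div_cancel (by linarith)
    have h2 : K * h < 1 := by linarith
    have h3 : h ≤ 1 := by
      rw [hh, div_le_one (by linarith)]; linarith
    nlinarith [mul_nonneg hK0 hh0.le]
  have key : ∀ n : ℕ, ∀ x ≤ c + n * h, x ≤ T → u x = 0 ∧ d x = 0 := by
    intro n
    induction n with
    | zero =>
      intro x hx hxT
      simp only [Nat.cast_zero, zero_mul, add_zero] at hx
      have hlt : x < b := by linarith
      refine ⟨h0 x hlt.le, ?_⟩
      have h1 := hu.hasDerivAt (hd.continuous.continuousAt (x := x))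
      have h2 : HasDerivAt u 0 x := (hasDerivAt_const x (0 : ℝ)).congr_of_eventuallyEq
        (by filter_upwards [Iio_mem_nhds hlt] with y hy using h0 y (le_of_lt hy))
      exact h1.unique h2
    | succ n ih =>
      intro x hx hxT
      set c' := c + n * h with hc'
      by_cases hxc : x ≤ c'
      · exact ih x hxc hxT
      push Not at hxc
      have hxh : x - c' ≤ h := by push_cast at hx; rw [hc']; linarith
      obtain ⟨h1, h2⟩ := ih c' le_rfl (by linarith)
      obtain ⟨y, hy, hmax⟩ := (isCompact_Icc (a := c') (b := x)).exists_isMaxOn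
        (nonempty_Icc.2 hxc.le) hu.continuous.abs.continuousOn
      have hM : ∀ t ∈ Icc c' x, |u t| ≤ |u y| := fun t ht => hmax ht
      have hdt : ∀ t ∈ Icc c' x, |d t| ≤ K * |u y| * h := by
        intro t ht
        have h3 := hd.sub_eq c' t
        rw [h2, sub_zero] at h3
        rw [h3, ← Real.norm_eq_abs]
        refine (intervalIntegral.norm_integral_le_of_norm_le_const (C := K * |u y|)
          fun s hs => ?_).trans ?_
        · rw [uIoc_of_le ht.1] at hs
          have hs' : s ∈ Icc c' x := ⟨hs.1.le, hs.2.trans ht.2⟩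
          exact (hz s (hs'.2.trans hxT)).trans (mul_le_mul_of_nonneg_left (hM s hs') hK0)
        · rw [abs_of_nonneg (sub_nonneg.2 ht.1)]
          exact mul_le_mul_of_nonneg_left (by linarith [ht.2])
            (mul_nonneg hK0 (abs_nonneg _))
      have hut : |u y| ≤ K * |u y| * h * h := by
        have h3 := hu.sub_eq c' y
        rw [h1, sub_zero] at h3
        nth_rewrite 1 [h3]
        rw [← Real.norm_eq_abs]
        refine (intervalIntegral.norm_integral_le_of_norm_le_const (C := K * |u y| * h)
          fun s hs => ?_).trans ?_
        · rw [uIoc_of_le hy.1] at hs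
          exact hdt s ⟨hs.1.le, hs.2.trans hy.2⟩
        · rw [abs_of_nonneg (sub_nonneg.2 hy.1)]
          exact mul_le_mul_of_nonneg_left (by linarith [hy.2])
            (mul_nonneg (mul_nonneg hK0 (abs_nonneg _)) hh0.le)
      have huy : |u y| = 0 := by
        by_contra hne
        have : 0 < |u y| := lt_of_le_of_ne (abs_nonneg _) (Ne.symm hne)
        nlinarith
      have hx' : x ∈ Icc c' x := ⟨hxc.le, le_rfl⟩
      have h4 := hM x hx'
      have h5 := hdt x hx'
      rw [huy] at h4 h5
      simp only [mul_zero, zero_mul] at h5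
      exact ⟨abs_nonpos_iff.1 h4, abs_nonpos_iff.1 h5⟩
  intro x hx
  obtain ⟨n, hn⟩ := exists_nat_gt ((x - c) / h)
  rw [div_lt_iff₀ hh0] at hn
  exact (key n x (by linarith) hx).1

/-- The boundedness of `u` turns the nonlinear equation into `|u''| ≤ K |u|`, to which unique
continuation applies. -/
lemma IsExtremal.exists_ne_zero_Iic {W Γ u v : ℝ → ℝ} {C δ p S : ℝ} (hp : 1 < p)
    (hW : IsBdd W C) (hΓ : IsBdd Γ C) (hδ : 0 < δ) (hco : Coercive W δ)
    (hS : RatioLe W Γ (p + 1) S) (h : IsExtremal W Γ (p + 1) S u v) (b : ℝ) :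
    ∃ x ≤ b, u x ≠ 0 := by
  by_contra hcon
  push Not at hcon
  obtain ⟨d, hd, hdH⟩ := (h.isBoundState hp hW hΓ hδ hco hS).exists_isH1_der hp hW hΓ
    (ae_eq_refl u) h.isH1
  have hu : IsPrim u d := h.isH1.prim.congr_ae hd.symm
  obtain ⟨x, hx⟩ := h.ne_zero
  have hC := hW.nonneg
  refine hx (eq_zero_of_eq_zero_Iic (K := C + C * √(normSq u v) ^ (p - 1)) hu hdH.prim
    (by positivity) (fun y _ => ?_) hcon x le_rfl)
  have h1 : |u y| ^ (p - 1) ≤ √(normSq u v) ^ (p - 1) :=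
    Real.rpow_le_rpow (abs_nonneg _) (h.isH1.abs_le_sqrt y) (by linarith)
  refine (abs_sub _ _).trans ?_
  rw [abs_mul, abs_mul, abs_mul, abs_of_nonneg (Real.rpow_nonneg (abs_nonneg (u y)) _), add_mul,
    mul_assoc C]
  have := hW.abs_le y
  have := hΓ.abs_le y
  gcongr

/-! ### Bloch modes: decay and uniqueness. -/

lemma SolvesHill.exists_isPrim {W u : ℝ → ℝ} {C : ℝ} (hW : IsBdd W C) (h : SolvesHill W u) :
    ∃ u', IsPrim u u' ∧ IsPrim u' (fun x => W x * u x) := by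
  obtain ⟨u', h1, h2⟩ := h
  have hc : Continuous u := continuous_iff_continuousAt.2 fun x => (h1 x).continuousAt
  have hWl : LocallyIntegrable W volume :=
    (memLp_top_of_bound hW.aesm C (ae_of_all _ hW.abs_le)).locallyIntegrable (by simp)
  have hp : IsPrim u' (fun x => W x * u x) := ⟨hWl.smul_continuous hc, h2⟩
  exact ⟨u', .of_hasDerivAt h1 hp.continuous, hp⟩

/-- A continuous function with `f (x + 1) = e^κ f x` is bounded by a multiple of `e^(κ x)`. -/
lemma exists_abs_le_mul_exp {f : ℝ → ℝ} {κ : ℝ} (hf : Continuous f)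
    (hq : ∀ x, f (x + 1) = Real.exp κ * f x) : ∃ M, 0 ≤ M ∧ ∀ x, |f x| ≤ M * Real.exp (κ * x) := by
  set g : ℝ → ℝ := fun x => f x * Real.exp (-(κ * x)) with hg
  have hgp : Function.Periodic g 1 := by
    intro x
    simp only [hg]
    rw [hq, show -(κ * (x + 1)) = -κ + -(κ * x) by ring, Real.exp_add, Real.exp_neg κ]
    field_simp
  have hgc : Continuous g := by fun_prop
  obtain ⟨M, hM⟩ := (isCompact_Icc (a := (0 : ℝ)) (b := 1)).exists_bound_of_continuousOn
    hgc.continuousOn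
  have hM0 : 0 ≤ M := (norm_nonneg _).trans (hM 0 (by simp))
  refine ⟨M, hM0, fun x => ?_⟩
  obtain ⟨y, hy, he⟩ := hgp.exists_mem_Ico₀ one_pos x
  have h1 := hM y ⟨hy.1, hy.2.le⟩
  rw [← he, Real.norm_eq_abs] at h1
  simp only [hg] at h1
  rw [abs_mul, abs_of_pos (Real.exp_pos _), Real.exp_neg, ← div_eq_mul_inv,
    div_le_iff₀ (Real.exp_pos _)] at h1
  exact h1

lemma tendsto_exp_mul_atBot {κ : ℝ} (hκ : 0 < κ) :
    Tendsto (fun x => Real.exp (κ * x)) atBot (𝓝 0) :=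
  Real.tendsto_exp_atBot.comp (tendsto_id.const_mul_atBot hκ)

lemma tendsto_zero_atBot_of_abs_le {f : ℝ → ℝ} {κ M : ℝ} (hκ : 0 < κ)
    (h : ∀ x, |f x| ≤ M * Real.exp (κ * x)) : Tendsto f atBot (𝓝 0) := by
  have := (tendsto_exp_mul_atBot hκ).const_mul M
  rw [mul_zero] at this
  exact squeeze_zero_norm h this

/-- A Bloch mode `φ = q e^(κ x)` and its derivative `φ'`. -/
structure BlochData (W : ℝ → ℝ) (κ : ℝ) (φ φ' : ℝ → ℝ) : Prop where
  prim : IsPrim φ φ'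
  prim' : IsPrim φ' (fun x => W x * φ x)
  pos : ∀ x, 0 < φ x
  shift : ∀ x, φ (x + 1) = Real.exp κ * φ x
  shift' : ∀ x, φ' (x + 1) = Real.exp κ * φ' x

lemma IsLeftBlochMode.exists_blochData {W q : ℝ → ℝ} {C κ : ℝ} (hW : IsBdd W C)
    (h : IsLeftBlochMode W κ q) :
    ∃ φ', BlochData W κ (fun x => q x * Real.exp (κ * x)) φ' := by
  obtain ⟨φ', h1, h2⟩ := h.solves.exists_isPrim hW
  have hs : ∀ x, q (x + 1) * Real.exp (κ * (x + 1)) = Real.exp κ * (q x * Real.exp (κ * x)) := by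
    intro x
    rw [h.periodic, mul_add, mul_one, Real.exp_add]; ring
  refine ⟨φ', h1, h2, fun x => mul_pos (h.pos x) (Real.exp_pos _), hs, fun x => ?_⟩
  have d1 := h1.hasDerivAt (h2.continuous.continuousAt (x := x))
  have d2 := (h1.comp_add 1).hasDerivAt (x := x)
    ((h2.comp_add 1).continuous.continuousAt)
  rw [funext hs] at d2
  exact d2.unique (d1.const_mul _)

namespace BlochData

variable {W φ φ' ψ ψ' : ℝ → ℝ} {κ κ' : ℝ}

lemma tendsto (hκ : 0 < κ) (h : BlochData W κ φ φ') : Tendsto φ atBot (𝓝 0) := by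
  obtain ⟨M, -, hM⟩ := exists_abs_le_mul_exp h.prim.continuous h.shift
  exact tendsto_zero_atBot_of_abs_le hκ hM

lemma tendsto' (hκ : 0 < κ) (h : BlochData W κ φ φ') : Tendsto φ' atBot (𝓝 0) := by
  obtain ⟨M, -, hM⟩ := exists_abs_le_mul_exp h.prim'.continuous h.shift'
  exact tendsto_zero_atBot_of_abs_le hκ hM

/-- By constancy of the Wronskian, two decaying Bloch modes are proportional. -/
lemma exists_eq_const_mul (hκ : 0 < κ) (hκ' : 0 < κ') (h : BlochData W κ φ φ')
    (h' : BlochData W κ' ψ ψ') : ∃ c, 0 < c ∧ ∀ x, φ x = c * ψ x := by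
  have hw := (h.prim'.mul h'.prim).sub (h.prim.mul h'.prim')
  have hconst : ∀ a b, φ' b * ψ b - φ b * ψ' b = φ' a * ψ a - φ a * ψ' a := by
    intro a b
    have := hw.sub_eq a b
    rw [intervalIntegral.integral_congr (g := fun _ => 0) (fun x _ => by ring)] at this
    simp only [intervalIntegral.integral_zero] at this
    linarith
  have hlim : Tendsto (fun x => φ' x * ψ x - φ x * ψ' x) atBot (𝓝 0) := by
    simpa using ((h.tendsto' hκ).mul (h'.tendsto hκ')).sub ((h.tendsto hκ).mul (h'.tendsto' hκ'))
  have hzero : ∀ x, φ' x * ψ x - φ x * ψ' x = 0 := fun x =>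
    tendsto_nhds_unique (tendsto_const_nhds.congr fun y => hconst y x) hlim
  have hd : ∀ x, HasDerivAt (fun x => φ x / ψ x) 0 x := fun x => by
    have h1 := (h.prim.hasDerivAt (h.prim'.continuous.continuousAt (x := x))).div
      (h'.prim.hasDerivAt (h'.prim'.continuous.continuousAt (x := x))) (h'.pos x).ne'
    rw [hzero x, zero_div] at h1
    exact h1
  have hc := is_const_of_deriv_eq_zero (fun x => (hd x).differentiableAt) fun x => (hd x).deriv
  refine ⟨φ 0 / ψ 0, div_pos (h.pos 0) (h'.pos 0), fun x => ?_⟩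
  rw [← hc x 0]
  field_simp [(h'.pos x).ne']

end BlochData

/-- Decaying modes are proportional; comparing the factors under translation by one identifies the
exponents, and `‖q‖_∞ = 1` fixes the constant of proportionality. -/
lemma IsLeftBlochMode.unique {W q₁ q₂ : ℝ → ℝ} {C κ₁ κ₂ : ℝ} (hW : IsBdd W C)
    (h₁ : IsLeftBlochMode W κ₁ q₁) (h₂ : IsLeftBlochMode W κ₂ q₂) : κ₁ = κ₂ ∧ q₁ = q₂ := by
  obtain ⟨φ', hφ⟩ := h₁.exists_blochData hW
  obtain ⟨ψ', hψ⟩ := h₂.exists_blochData hW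
  obtain ⟨c, hc, heq⟩ := hφ.exists_eq_const_mul h₁.kappa_pos h₂.kappa_pos hψ
  have hκ : κ₁ = κ₂ := by
    have h1 := hφ.shift 0
    have h2 := hψ.shift 0
    rw [heq, heq 0, h2] at h1
    have h3 := hψ.pos 0
    have h4 : Real.exp κ₂ = Real.exp κ₁ := by
      have : c * (q₂ 0 * Real.exp (κ₂ * 0)) ≠ 0 := (mul_pos hc h3).ne'
      apply mul_right_cancel₀ this
      linarith
    exact (Real.exp_injective h4).symm
  subst hκ
  refine ⟨rfl, ?_⟩
  have hq : ∀ x, q₁ x = c * q₂ x := fun x => by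
    have := heq x
    rw [← mul_assoc] at this
    exact mul_right_cancel₀ (Real.exp_pos _).ne' this
  have hle1 : ∀ x, q₁ x ≤ 1 := fun x => h₁.isLUB.1 ⟨x, rfl⟩
  have hle2 : ∀ x, q₂ x ≤ 1 := fun x => h₂.isLUB.1 ⟨x, rfl⟩
  have hc1 : 1 ≤ c := h₁.isLUB.2 (by
    rintro _ ⟨x, rfl⟩
    rw [hq]; nlinarith [hle2 x])
  have hc2 : 1 ≤ 1 / c := h₂.isLUB.2 (by
    rintro _ ⟨x, rfl⟩
    rw [le_div_iff₀ hc, mul_comm, ← hq]; exact hle1 x)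
  rw [le_div_iff₀ hc] at hc2
  have : c = 1 := by linarith
  funext x
  rw [hq, this, one_mul]

/-! ### Existence of the Bloch mode from the Green's function. -/

/-- Evaluation at `0` is represented by the quadratic form. -/
lemma exists_form_eq_eval {W : ℝ → ℝ} {C δ : ℝ} (hW : IsBdd W C) (hδ : 0 < δ)
    (hco : Coercive W δ) : ∃ G G', IsH1 G G' ∧ ∀ f g, IsH1 f g → form W G G' f g = f 0 := by
  -- Direct method: the Euler equation of a minimizer of `a(u) - 2 u(0)` is the required
  -- representation. Evaluation passes to the limit by pointwise convergence.
  set A : Set ℝ := {a | ∃ u v, IsH1 u v ∧ a = form W u v u v - 2 * u 0} with hA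
  have hlow : ∀ u v, IsH1 u v → δ * normSq u v - 2 * √(normSq u v)
      ≤ form W u v u v - 2 * u 0 := fun u v huv => by
    have h1 := hco u v huv
    have h2 := (le_abs_self _).trans (huv.abs_le_sqrt 0)
    linarith
  have hsq : ∀ u v, IsH1 u v → 2 * √(normSq u v) ≤ δ / 2 * normSq u v + 2 / δ := by
    intro u v huv
    have h1 := Real.sq_sqrt (normSq_nonneg u v)
    have h2 : δ / 2 * normSq u v + 2 / δ - 2 * √(normSq u v)
        = δ / 2 * (√(normSq u v) - 2 / δ) ^ 2 := by
      rw [sub_sq, h1]; field_simp; ring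
    have h3 : 0 ≤ δ / 2 * (√(normSq u v) - 2 / δ) ^ 2 := by positivity
    linarith
  have hbdd : BddBelow A := by
    refine ⟨-(2 / δ), ?_⟩
    rintro a ⟨u, v, huv, rfl⟩
    have h1 := hlow u v huv
    have h2 := hsq u v huv
    have h3 : 0 ≤ δ / 2 * normSq u v := mul_nonneg (by positivity) (normSq_nonneg u v)
    linarith
  have hne : A.Nonempty := by
    obtain ⟨u, v, h1, -⟩ := exists_isH1_pos
    exact ⟨_, u, v, h1, rfl⟩
  obtain ⟨b, -, hb, hbA⟩ := exists_seq_tendsto_sInf hne hbdd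
  choose w w' hw hbw using hbA
  obtain ⟨K, hK⟩ := hb.bddAbove_range
  have hKn : ∀ n, normSq (w n) (w' n) ≤ (K + 2 / δ) / (δ / 2) := fun n => by
    rw [le_div_iff₀ (by positivity)]
    have h1 := hlow _ _ (hw n)
    have h2 := hsq _ _ (hw n)
    have h3 : b n ≤ K := hK ⟨n, rfl⟩
    rw [hbw n] at h3
    linarith
  obtain ⟨φ, hφ, G, G', hG, hpt, hweak⟩ := exists_subseq_tendsto hw hKn
  have hcross := tendsto_form_sub (fun _ => hW) (fun n => hw (φ n)) hG (fun n => hKn (φ n))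
    hpt hweak
  have hmin : ∀ u v, IsH1 u v → form W G G' G G' - 2 * G 0 ≤ form W u v u v - 2 * u 0 := by
    have h1 : form W G G' G G' - 2 * G 0 ≤ sInf A := by
      have h2 : ∀ n, form W G G' G G' + 2 * form W G G' (fun x => w (φ n) x - G x)
          (fun x => w' (φ n) x - G' x) - 2 * w (φ n) 0 ≤ b (φ n) := by
        intro n
        have hρ := (hw (φ n)).sub hG
        have h3 := form_add_mul hW hG hρ 1
        have h4 := hco.form_nonneg hδ hρ
        simp only [one_mul, add_sub_cancel] at h3
        rw [hbw]
        linarith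
      have h5 := ((hcross.const_mul 2).const_add (form W G G' G G')).sub ((hpt 0).const_mul 2)
      rw [mul_zero, add_zero] at h5
      exact le_of_tendsto_of_tendsto' h5 (hb.comp hφ.tendsto_atTop) h2
    exact fun u v huv => h1.trans (csInf_le hbdd ⟨u, v, huv, rfl⟩)
  refine ⟨G, G', hG, fun f g hf => ?_⟩
  -- The quadratic has no constant term, so a nonpositive discriminant forces its linear coefficient
  -- to vanish.
  have hquad : ∀ t : ℝ, 0 ≤ form W f g f g * (t * t) + (2 * (form W G G' f g - f 0)) * t + 0 := by
    intro t
    have h1 := hmin _ _ (hG.add (hf.const_mul t))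
    rw [form_add_mul hW hG hf t] at h1
    linarith
  have h2 := discrim_le_zero hquad
  rw [discrim] at h2
  nlinarith [sq_nonneg (form W G G' f g - f 0)]

lemma form_lin_comb {W u v u₂ v₂ f g : ℝ → ℝ} {C : ℝ} (hW : IsBdd W C) (h : IsH1 u v)
    (h₂ : IsH1 u₂ v₂) (hf : IsH1 f g) (a b : ℝ) :
    form W (fun x => a * u x - b * u₂ x) (fun x => a * v x - b * v₂ x) f g
      = a * form W u v f g - b * form W u₂ v₂ f g := by
  unfold form
  rw [← integral_const_mul, ← integral_const_mul, ← integral_sub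
    ((integrable_form hW h hf).const_mul _) ((integrable_form hW h₂ hf).const_mul _)]
  congr 1; funext x; ring

lemma form_indicator (W u v : ℝ → ℝ) (s : Set ℝ) :
    form W (s.indicator u) (s.indicator v) (s.indicator u) (s.indicator v)
      = form W u v (s.indicator u) (s.indicator v) := by
  unfold form
  congr 1; funext x
  by_cases hx : x ∈ s <;> simp [hx]

/-- On the left half line the Green's function is a positive multiple of a solution which is
multiplied by a constant factor under translation by one. -/
lemma exists_decaying_solution {W : ℝ → ℝ} {C δ : ℝ} (hW : IsBdd W C) (pW : Function.Periodic W 1)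
    (hδ : 0 < δ) (hco : Coercive W δ) :
    ∃ H D z : ℝ → ℝ, IsPrim H D ∧ IsPrim D z ∧ (∀ x ≤ 0, z x = W x * H x) ∧ (∀ x ≤ 0, 0 < H x) ∧
      ∃ κ, 0 < κ ∧ ∀ x ≤ 0, H (x - 1) = Real.exp (-κ) * H x := by
  obtain ⟨G, G', hG, hrep⟩ := exists_form_eq_eval hW hδ hco
  -- If `G` were zero, evaluation at `0` would vanish on all of `H¹(ℝ)`, and by translation every
  -- function would be zero.
  have hne : ∃ x, G x ≠ 0 := by
    by_contra hcon
    push Not at hcon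
    obtain ⟨u, v, huv, hu1⟩ := exists_isH1_pos
    have hu0 : ∀ x, u x = 0 := by
      intro x
      have h1 := hrep _ _ (huv.comp_add x)
      have h2 : form W G G' (fun y => u (y + x)) (fun y => v (y + x)) = 0 := by
        have h3 := form_sq_le hW (fun u v h => hco.form_nonneg hδ h) hG (huv.comp_add x)
        rw [hrep G G' hG, hcon 0, zero_mul] at h3
        nlinarith [sq_nonneg (form W G G' (fun y => u (y + x)) (fun y => v (y + x)))]
      rw [h2, zero_add] at h1
      exact h1.symm
    simp [hu0] at hu1
  have hG0 : 0 < G 0 := by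
    obtain ⟨x, hx⟩ := hne
    rw [← hrep G G' hG]
    exact hco.form_pos hδ hG hx
  -- `G'` jumps by `-1` at the pole, exactly as `I` does, so `G' - I` has weak derivative `W G`. Its
  -- representative plus one, called `D` below, agrees with `G'` almost everywhere on the left and
  -- continues smoothly through `0`; the primitive `H` of `D` does the same for `G`.
  set I : ℝ → ℝ := (Iic (0 : ℝ)).indicator fun _ => 1 with hI
  have hIl : LocallyIntegrable I volume :=
    (locallyIntegrable_const (1 : ℝ)).indicator measurableSet_Iic
  have hWG := hW.memLp_mul hG.memLp
  obtain ⟨d, hd, hdp⟩ := exists_isPrim_of_weakDeriv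
    ((hG.memLp_der.locallyIntegrable (by norm_num)).sub hIl)
    (hWG.locallyIntegrable (by norm_num)) (by
      intro φ hφ hc
      have hφH := IsH1.of_contDiff hφ hc
      have hdc : Continuous (deriv φ) := hφ.continuous_deriv (by simp)
      have h1 := hrep _ _ hφH
      rw [form_eq hW hG hφH] at h1
      have i1 := integrable_mul_of_memLp hφH.memLp_der hG.memLp_der
      have i2 : Integrable (fun x => deriv φ x * I x) :=
        hIl.integrable_smul_left_of_hasCompactSupport hdc hc.deriv
      have h2 : ∫ x, deriv φ x * I x = φ 0 := by
        rw [← hφH.prim.integral_Iic 0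
          (hφ.continuous.integrable_of_hasCompactSupport hc).integrableOn
          (hdc.integrable_of_hasCompactSupport hc.deriv).integrableOn,
          ← integral_indicator measurableSet_Iic]
        congr 1; funext x
        by_cases hx : x ∈ Iic (0 : ℝ) <;> simp [hI, hx]
      simp only [Pi.sub_apply, mul_sub]
      rw [integral_sub i1 i2, h2, ← h1]
      have e1 : ∫ x, deriv φ x * G' x = ∫ x, G' x * deriv φ x := by simp_rw [mul_comm]
      have e2 : ∫ x, φ x * (W x * G x) = ∫ x, W x * (G x * φ x) := by
        congr 1; funext x; ring
      rw [e1, e2]; ring)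
  have hDp : IsPrim (fun x => d x + 1) (fun x => W x * G x) := by
    refine ⟨hdp.locInt, fun a b => ?_⟩
    rw [← hdp.sub_eq]; ring
  have hHp := IsPrim.primitive hDp.continuous.locallyIntegrable (G 0)
  set D : ℝ → ℝ := fun x => d x + 1 with hDdef
  set H : ℝ → ℝ := fun x => G 0 + ∫ t in (0 : ℝ)..x, D t with hH
  have hHG : ∀ x ≤ 0, H x = G x := by
    intro x hx
    have h1 := hG.prim.sub_eq 0 x
    have h2 : ∫ t in (0 : ℝ)..x, G' t = ∫ t in (0 : ℝ)..x, D t := by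
      refine intervalIntegral.integral_congr_ae ?_
      filter_upwards [hd] with t ht hmem
      rw [uIoc_of_ge hx] at hmem
      simp only [hDdef, ht, Pi.sub_apply, hI]
      rw [indicator_of_mem (by exact hmem.2)]; ring
    simp only [hH]; linarith
  -- At a zero `x < 0` the truncation of `G` to `(-∞, x]` is admissible; its form is its value at
  -- `0`, which is zero. So `G` vanishes left of `x`, and by unique continuation `G 0 = 0`.
  have hnz : ∀ x ≤ 0, G x ≠ 0 := by
    intro x hx h0
    have hlt : x < 0 := lt_of_le_of_ne hx fun h => by rw [h] at h0; exact hG0.ne' h0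
    have hcut := hG.prim.cut_isH1 h0 hG.memLp.integrable_sq.integrableOn
      hG.memLp_der.integrable_sq.integrableOn
    have h1 := hrep _ _ hcut
    rw [← form_indicator, indicator_of_notMem (by simpa using hlt)] at h1
    have h2 := hco _ _ hcut
    rw [h1] at h2
    have hz : ∀ y ≤ x, G y = 0 := fun y hy => by
      have := hcut.eq_zero_of_normSq (by
        by_contra hcon
        push Not at hcon
        nlinarith) y
      rwa [indicator_of_mem (by exact hy)] at this
    have h3 := eq_zero_of_eq_zero_Iic (K := C) (T := 0) (b := x) hHp hDp hW.nonneg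
      (fun y hy => by
        rw [abs_mul, hHG y hy]
        exact mul_le_mul_of_nonneg_right (hW.abs_le y) (abs_nonneg _))
      (fun y hy => by rw [hHG y (hy.trans hx)]; exact hz y hy) 0 le_rfl
    rw [hHG 0 le_rfl] at h3
    exact hG0.ne' h3
  have hpos : ∀ x ≤ 0, 0 < G x := by
    intro x hx
    by_contra hcon
    push Not at hcon
    obtain ⟨y, hy, hy0⟩ := intermediate_value_Icc hx hG.continuous.continuousOn
      ⟨hcon, hG0.le⟩
    exact hnz y hy.2 hy0
  -- The difference of both sides vanishes at `0`, so it may be truncated there. By periodicity `G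
  -- (· - 1)` represents evaluation at `1`, and the truncation vanishes at both `0` and `1`; hence
  -- its form is zero.
  have hshift : ∀ x ≤ 0, G 0 * G (x - 1) = G (-1) * G x := by
    have hGs := hG.comp_add (-1)
    set z₀ : ℝ → ℝ := fun x => G 0 * G (x + -1) - G (-1) * G x with hz₀
    have hz : IsH1 z₀ (fun x => G 0 * G' (x + -1) - G (-1) * G' x) :=
      (hGs.const_mul _).sub (hG.const_mul _)
    have hz0 : z₀ 0 = 0 := by simp only [hz₀, zero_add]; ring
    have hcut := hz.prim.cut_isH1 hz0 hz.memLp.integrable_sq.integrableOn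
      hz.memLp_der.integrable_sq.integrableOn
    set c : ℝ → ℝ := (Iic (0 : ℝ)).indicator z₀ with hc
    set c' : ℝ → ℝ := (Iic (0 : ℝ)).indicator
      (fun x => G 0 * G' (x + -1) - G (-1) * G' x) with hc'
    have h1 : form W c c' c c' = 0 := by
      rw [hc, hc', form_indicator, ← hc, ← hc', form_lin_comb hW hGs hG hcut, hrep _ _ hcut]
      have h2 : form W (fun x => G (x + -1)) (fun x => G' (x + -1)) c c' = 0 := by
        rw [← form_comp_add _ _ _ _ _ 1]
        have e : (fun x => W (x + 1)) = W := funext pW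
        rw [e]
        simp only [add_neg_cancel_right]
        rw [hrep _ _ (hcut.comp_add 1), hc, zero_add, indicator_of_notMem (by simp)]
      rw [h2, hc, indicator_of_mem (by simp), hz0]; ring
    intro x hx
    have h3 := hcut.eq_zero_of_normSq (by
        have h2 := hco _ _ hcut
        rw [h1] at h2
        by_contra hcon
        push Not at hcon
        nlinarith) x
    rw [hc, indicator_of_mem (by exact hx)] at h3
    simp only [hz₀] at h3
    rw [sub_eq_add_neg]; linarith
  set μ := G (-1) / G 0 with hμ
  have hμ0 : 0 < μ := div_pos (hpos _ (by norm_num)) hG0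
  have hstep : ∀ x ≤ 0, G (x - 1) = μ * G x := by
    intro x hx
    rw [hμ, div_mul_eq_mul_div, eq_div_iff hG0.ne', mul_comm]; exact hshift x hx
  have hpow : ∀ n : ℕ, G (-n) = μ ^ n * G 0 := by
    intro n
    induction n with
    | zero => simp
    | succ n ih =>
      push_cast
      rw [neg_add', hstep _ (by simp), ih]; ring
  -- Otherwise `G(-n) = μ^n G(0)` would not tend to zero, as an element of `H¹` must.
  have hμ1 : μ < 1 := by
    by_contra hcon
    push Not at hcon
    have h1 : Tendsto (fun n : ℕ => G (-n)) atTop (𝓝 0) :=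
      hG.tendsto_atBot.comp (tendsto_neg_atTop_atBot.comp tendsto_natCast_atTop_atTop)
    have h2 : ∀ n : ℕ, G 0 ≤ G (-n) := fun n => by
      rw [hpow]
      have := one_le_pow₀ hcon (n := n)
      nlinarith
    exact absurd (ge_of_tendsto' h1 h2) (not_le.2 hG0)
  refine ⟨H, D, _, hHp, hDp, fun x hx => by simp only [hHG x hx], fun x hx => by
    rw [hHG x hx]; exact hpos x hx, -Real.log μ, by
      have := Real.log_neg hμ0 hμ1; linarith, fun x hx => ?_⟩
  rw [neg_neg, Real.exp_log hμ0, hHG x hx, hHG _ (by linarith), hstep x hx]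

/-- Existence of the Bloch mode. -/
theorem exists_isLeftBlochMode {W : ℝ → ℝ} {C δ : ℝ} (hW : IsBdd W C)
    (pW : Function.Periodic W 1) (hδ : 0 < δ) (hco : Coercive W δ) :
    ∃ κ q, IsLeftBlochMode W κ q := by
  obtain ⟨H, D, z, hH, hD, hz, hpos, κ, hκ, hstep⟩ := exists_decaying_solution hW pW hδ hco
  have hpow : ∀ m : ℕ, ∀ x ≤ 0, H (x - m) = Real.exp (-(κ * m)) * H x := by
    intro m
    induction m with
    | zero => intro x _; simp
    | succ m ih =>
      intro x hx
      push_cast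
      rw [show x - ((m : ℝ) + 1) = (x - m) - 1 by ring,
        hstep _ (by have := Nat.cast_nonneg (α := ℝ) m; linarith), ih x hx, ← mul_assoc,
        ← Real.exp_add]
      congr 2; ring
  -- Extension by quasi-periodicity: `⌈x⌉₊` translations bring `x` into the left half line, and any
  -- larger number gives the same value. A fixed number therefore serves in a whole neighbourhood of
  -- `x`.
  set Φ : ℝ → ℝ := fun x => Real.exp (κ * ⌈x⌉₊) * H (x - ⌈x⌉₊) with hΦ
  have hΦn : ∀ n : ℕ, ∀ x ≤ (n : ℝ), Φ x = Real.exp (κ * n) * H (x - n) := by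
    intro n x hx
    obtain ⟨m, hm⟩ := Nat.exists_eq_add_of_le (Nat.ceil_le.2 hx)
    rw [hm]
    push_cast
    rw [← sub_sub, hpow m _ (by linarith [Nat.le_ceil x]), ← mul_assoc, ← Real.exp_add]
    simp only [hΦ]
    congr 2; ring
  have hder : ∀ n : ℕ, ∀ x < (n : ℝ), HasDerivAt Φ (Real.exp (κ * n) * D (x - n)) x := by
    intro n x hx
    have h1 := (hH.hasDerivAt (hD.continuous.continuousAt (x := x - n)))
    have h2 := (h1.comp_sub_const x (n : ℝ)).const_mul (Real.exp (κ * n))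
    refine h2.congr_of_eventuallyEq ?_
    filter_upwards [Iio_mem_nhds hx] with y hy using hΦn n y (le_of_lt hy)
  have hsolve : SolvesHill W Φ := by
    refine ⟨deriv Φ, fun x => ?_, fun a b => ?_⟩
    · obtain ⟨n, hn⟩ := exists_nat_gt x
      exact (hder n x hn).differentiableAt.hasDerivAt
    · obtain ⟨n, hn⟩ := exists_nat_gt (max a b)
      have ha := (le_max_left a b).trans_lt hn
      have hb := (le_max_right a b).trans_lt hn
      rw [(hder n a ha).deriv, (hder n b hb).deriv, ← mul_sub, hD.sub_eq,
        ← intervalIntegral.integral_comp_sub_right, ← intervalIntegral.integral_const_mul]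
      refine intervalIntegral.integral_congr fun x hx => ?_
      have hxn : x ≤ n := (hx.2.trans_lt hn).le
      rw [hz _ (by linarith), hΦn n x hxn]
      have := (pW.nat_mul n).sub_eq x
      rw [mul_one] at this
      rw [this]; ring
  have hΦc : Continuous Φ := by
    obtain ⟨u', h1, -⟩ := hsolve
    exact continuous_iff_continuousAt.2 fun x => (h1 x).continuousAt
  have hΦpos : ∀ x, 0 < Φ x := fun x =>
    mul_pos (Real.exp_pos _) (hpos _ (by linarith [Nat.le_ceil x]))
  have hΦs : ∀ x, Φ (x + 1) = Real.exp κ * Φ x := by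
    intro x
    obtain ⟨n, hn⟩ := exists_nat_gt x
    rw [hΦn n x hn.le, hΦn (n + 1) (x + 1) (by push_cast; linarith)]
    push_cast
    rw [mul_add, mul_one, Real.exp_add, add_sub_add_right_eq_sub]; ring
  set q : ℝ → ℝ := fun x => Φ x * Real.exp (-(κ * x)) with hq
  have hqp : Function.Periodic q 1 := by
    intro x
    simp only [hq]
    rw [hΦs, show -(κ * (x + 1)) = -κ + -(κ * x) by ring, Real.exp_add, Real.exp_neg κ]
    field_simp
  have hqpos : ∀ x, 0 < q x := fun x => mul_pos (hΦpos x) (Real.exp_pos _)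
  have hqc : Continuous q := by fun_prop
  obtain ⟨y, hy, hmax⟩ := (isCompact_Icc (a := (0 : ℝ)) (b := 1)).exists_isMaxOn
    (nonempty_Icc.2 zero_le_one) hqc.continuousOn
  have hM : ∀ x, q x ≤ q y := fun x => by
    obtain ⟨t, ht, he⟩ := hqp.exists_mem_Ico₀ one_pos x
    rw [he]; exact hmax ⟨ht.1, ht.2.le⟩
  refine ⟨κ, fun x => q x / q y, hκ, fun x => by simp only [hqp x],
    fun x => div_pos (hqpos x) (hqpos y), IsGreatest.isLUB ⟨⟨y, div_self (hqpos y).ne'⟩, ?_⟩, ?_⟩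
  · rintro _ ⟨x, rfl⟩
    exact (div_le_one (hqpos y)).2 (hM x)
  · have e : (fun x => q x / q y * Real.exp (κ * x)) = fun x => (q y)⁻¹ * Φ x := by
      funext x
      simp only [hq]
      rw [Real.exp_neg]
      field_simp
    rw [e]
    obtain ⟨u', h1, h2⟩ := hsolve
    refine ⟨fun x => (q y)⁻¹ * u' x, fun x => (h1 x).const_mul _, fun a b => ?_⟩
    rw [← mul_sub, h2, ← intervalIntegral.integral_const_mul]
    congr 1; funext x; ring

/-! ### The comparison function with a Bloch tail. -/

lemma memLp_restrict_Iic_of_abs_le {f : ℝ → ℝ} {κ M : ℝ} (hκ : 0 < κ) (hf : Continuous f)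
    (h : ∀ x, |f x| ≤ M * Real.exp (κ * x)) : MemLp f 2 (volume.restrict (Iic 0)) := by
  rw [memLp_two_iff_integrable_sq hf.aestronglyMeasurable]
  have hi : IntegrableOn (fun x => M ^ 2 * Real.exp (2 * κ * x)) (Iic 0) :=
    (integrableOn_exp_mul_Iic (by linarith) 0).const_mul _
  refine hi.mono' (hf.pow 2).aestronglyMeasurable (ae_of_all _ fun x => ?_)
  rw [Real.norm_eq_abs, abs_of_nonneg (sq_nonneg _), ← sq_abs]
  calc |f x| ^ 2 ≤ (M * Real.exp (κ * x)) ^ 2 := pow_le_pow_left₀ (abs_nonneg _) (h x) 2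
    _ = M ^ 2 * Real.exp (2 * κ * x) := by
      rw [mul_pow, ← Real.exp_nat_mul]; congr 2; push_cast; ring

/-- A geometric series: the integral over the half line has the sign of the integral over one
period. -/
lemma setIntegral_Iic_neg {f : ℝ → ℝ} {c : ℝ} (hc1 : c < 1)
    (hf : IntegrableOn f (Iic 0)) (hs : ∀ x, f (x - 1) = c * f x)
    (hneg : ∫ x in (-1 : ℝ)..0, f x < 0) : ∫ x in Iic 0, f x < 0 := by
  have h1 := intervalIntegral.integral_Iic_sub_Iic (a := (-1 : ℝ)) (b := 0)
    (hf.mono_set (Iic_subset_Iic.2 (by norm_num))) hf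
  have h2 : ∫ x in Iic (-1 : ℝ), f x = c * ∫ x in Iic 0, f x := by
    rw [← integral_const_mul, ← integral_indicator measurableSet_Iic,
      ← integral_indicator measurableSet_Iic,
      ← integral_sub_right_eq_self ((Iic (-1 : ℝ)).indicator f) 1]
    congr 1; funext x
    by_cases hx : x ≤ 0
    · rw [indicator_of_mem (by simp only [mem_Iic]; linarith), indicator_of_mem (by exact hx), hs]
    · rw [indicator_of_notMem (by simp only [mem_Iic]; linarith),
        indicator_of_notMem (by exact hx)]
  rw [h2] at h1
  nlinarith

set_option maxHeartbeats 1000000 in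
/-- Replacing the left tail of a shifted ground state of the right periodic problem by the Bloch
mode increases the ratio. -/
theorem IsExtremal.not_ratioLe {W₁ W₂ Γ₁ Γ₂ u v φ φ' : ℝ → ℝ} {C δ κ r S S₁ : ℝ} (hr : 2 < r)
    (hW₁ : IsBdd W₁ C) (hW₂ : IsBdd W₂ C) (hΓ₁ : IsBdd Γ₁ C) (hΓ₂ : IsBdd Γ₂ C)
    (pW₁ : Function.Periodic W₁ 1) (pW₂ : Function.Periodic W₂ 1) (pΓ₁ : Function.Periodic Γ₁ 1)
    (hδ : 0 < δ) (hco : Coercive (interface W₁ W₂) δ) (hco₁ : Coercive W₁ δ)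
    (hu : IsExtremal W₁ Γ₁ r S₁ u v) (hS₁ : 0 ≤ S₁) (hne : ∀ b, ∃ x ≤ b, u x ≠ 0) (hκ : 0 < κ)
    (hφ : BlochData W₁ κ φ φ') (hI : ∫ x in (-1 : ℝ)..0, (W₂ x - W₁ x) * φ x ^ 2 < 0)
    (hle : S ≤ S₁) : ¬ RatioLe (interface W₁ W₂) (interface Γ₁ Γ₂) r S := by
  intro hS
  have hC := hW₁.nonneg
  obtain ⟨M, hM0, hM⟩ := exists_abs_le_mul_exp hφ.prim.continuous hφ.shift
  obtain ⟨M', -, hM'⟩ := exists_abs_le_mul_exp hφ.prim'.continuous hφ.shift'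
  have hφL := memLp_restrict_Iic_of_abs_le hκ hφ.prim.continuous hM
  have hφ'L := memLp_restrict_Iic_of_abs_le hκ hφ.prim'.continuous hM'
  have hφsq : IntegrableOn (fun x => φ x ^ 2) (Iic 0) := hφL.integrable_sq
  set P := ∫ x in Iic 0, φ x ^ 2 with hP
  have hP0 : 0 < P := by
    rw [hP, setIntegral_pos_iff_support_of_nonneg_ae (ae_of_all _ fun x => sq_nonneg _) hφsq]
    have : Function.support (fun x => φ x ^ 2) = univ := by
      ext x; simp [(hφ.pos x).ne']
    simp [this]
  have hWφ : IntegrableOn (fun x => (W₂ x - W₁ x) * φ x ^ 2) (Iic 0) :=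
    Integrable.bdd_mul hφsq (hW₂.aesm.sub hW₁.aesm).restrict (c := C + C)
      (ae_of_all _ fun x => (abs_sub _ _).trans (add_le_add (hW₂.abs_le x) (hW₁.abs_le x)))
  set J := ∫ x in Iic 0, (W₂ x - W₁ x) * φ x ^ 2 with hJ
  have hJ0 : J < 0 := by
    refine setIntegral_Iic_neg (c := Real.exp (-κ) ^ 2) ?_ hWφ (fun x => ?_) hI
    · have : Real.exp (-κ) < 1 := Real.exp_lt_one_iff.2 (by linarith)
      exact pow_lt_one₀ (Real.exp_pos _).le this (by norm_num)
    · have h1 := hφ.shift (x - 1)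
      rw [sub_add_cancel] at h1
      rw [pW₁.sub_eq, pW₂.sub_eq, h1, Real.exp_neg]
      field_simp
  -- A single rate for both gains in the form: coercivity gives at least `η ∫ h²`, and the negative
  -- `J` gives at least `η β² P`.
  set η := min δ (-J / P) with hη
  have hη0 : 0 < η := lt_min hδ (div_pos (by linarith) hP0)
  have hηδ : η ≤ δ := min_le_left _ _
  have hηJ : η * P ≤ -J := by
    rw [← le_div_iff₀ hP0]; exact min_le_right _ _
  -- choice of the translation
  set L := 1 + M / φ 0 with hL
  have hL1 : 1 ≤ L := by
    have : 0 ≤ M / φ 0 := div_nonneg hM0 (hφ.pos 0).le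
    linarith
  -- Once `|w| ≤ m` on the left half line, `m L` bounds both `|w|` and `|β φ|` there; the inequality
  -- makes the nonlinear loss smaller than the gain in the form.
  obtain ⟨m, hm0, hmη⟩ : ∃ m : ℝ, 0 < m ∧ 3 * C * (m * L) ^ (r - 2) < η := by
    have hlim : Tendsto (fun m : ℝ => 3 * C * (m * L) ^ (r - 2)) (𝓝[>] 0) (𝓝 0) := by
      have h1 : Tendsto (fun d : ℝ => d ^ (r - 2)) (𝓝 0) (𝓝 (0 ^ (r - 2))) :=
        (Real.continuous_rpow_const (by linarith : 0 ≤ r - 2)).tendsto 0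
      rw [Real.zero_rpow (by linarith)] at h1
      have h2 : Tendsto (fun m : ℝ => m * L) (𝓝 0) (𝓝 0) := by
        simpa using (tendsto_id (x := 𝓝 (0 : ℝ))).mul_const L
      have := ((h1.comp h2).const_mul (3 * C)).mono_left
        (nhdsWithin_le_nhds (a := (0 : ℝ)) (s := Ioi 0))
      simpa using this
    obtain ⟨m, h1, h2⟩ := ((hlim.eventually_lt_const hη0).and self_mem_nhdsWithin).exists
    exact ⟨m, h2, h1⟩
  obtain ⟨b, hb⟩ : ∃ b : ℝ, ∀ x ≤ b, |u x| ≤ m := by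
    have h1 := hu.isH1.tendsto_atBot.abs
    rw [abs_zero] at h1
    obtain ⟨b, hb⟩ := eventually_atBot.1 (h1.eventually_le_const hm0)
    exact ⟨b, hb⟩
  -- An integer shift leaves the periodic coefficients, and hence form and potential energy of the
  -- ground state, unchanged.
  obtain ⟨n, hn⟩ := exists_nat_gt (-b)
  set w : ℝ → ℝ := fun x => u (x + -n) with hw
  set w' : ℝ → ℝ := fun x => v (x + -n) with hw'
  have hwH : IsH1 w w' := hu.isH1.comp_add _
  have hwm : ∀ x ≤ 0, |w x| ≤ m := fun x hx => hb _ (by linarith)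
  have hWn : (fun x => W₁ (x + -n)) = W₁ := by
    funext x
    have := (pW₁.nat_mul n).sub_eq x
    rwa [mul_one] at this
  have hΓn : (fun x => Γ₁ (x + -n)) = Γ₁ := by
    funext x
    have := (pΓ₁.nat_mul n).sub_eq x
    rwa [mul_one] at this
  set A := form W₁ u v u v with hA
  have hwA : form W₁ w w' w w' = A := by
    have := form_comp_add W₁ u v u v (-n)
    rwa [hWn] at this
  have hwP : pot Γ₁ r w = A := by
    have := pot_comp_add Γ₁ u r (-n)
    rw [hΓn, ← hu.form_eq_pot] at this
    exact this
  -- the modified function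
  set β := w 0 / φ 0 with hβ
  have hh0 : IsPrim (fun x => w x - β * φ x) (fun x => w' x - β * φ' x) :=
    hwH.prim.sub (hφ.prim.const_mul β)
  have hcut := hh0.cut_isH1 (b := 0) (by rw [hβ]; field_simp [(hφ.pos 0).ne']; ring)
    ((hwH.memLp.restrict _).sub (hφL.const_mul β)).integrable_sq
    ((hwH.memLp_der.restrict _).sub (hφ'L.const_mul β)).integrable_sq
  set h : ℝ → ℝ := (Iic (0 : ℝ)).indicator (fun x => w x - β * φ x) with hh
  set h' : ℝ → ℝ := (Iic (0 : ℝ)).indicator (fun x => w' x - β * φ' x) with hh'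
  have hU := hwH.sub hcut
  set U : ℝ → ℝ := fun x => w x - h x with hUdef
  set U' : ℝ → ℝ := fun x => w' x - h' x with hUdef'
  have hU_le : ∀ x ≤ 0, U x = β * φ x := fun x hx => by
    simp only [hUdef, hh]; rw [indicator_of_mem (by exact hx)]; ring
  have hU'_le : ∀ x ≤ 0, U' x = β * φ' x := fun x hx => by
    simp only [hUdef', hh']; rw [indicator_of_mem (by exact hx)]; ring
  have hh_gt : ∀ x, 0 < x → h x = 0 := fun x hx => indicator_of_notMem (by simpa using hx) _
  have hh'_gt : ∀ x, 0 < x → h' x = 0 := fun x hx => indicator_of_notMem (by simpa using hx) _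
  have hU_gt : ∀ x, 0 < x → U x = w x := fun x hx => by simp only [hUdef, hh_gt x hx, sub_zero]
  -- On the left `U = β φ`, and the integrand is `β (φ' h)'` by the equation for `φ`; the boundary
  -- term vanishes because `h 0 = 0`. On the right `h` is zero.
  have horth : form W₁ U U' h h' = 0 := by
    have hp := hφ.prim'.mul hcut.prim
    have i1 : IntegrableOn (fun x => φ' x * h x) (Iic 0) :=
      hφ'L.integrable_mul (hcut.memLp.restrict _)
    have i2 : IntegrableOn (fun x => φ x * h x) (Iic 0) :=
      hφL.integrable_mul (hcut.memLp.restrict _)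
    have i3 : IntegrableOn (fun x => W₁ x * φ x * h x) (Iic 0) := by
      have := Integrable.bdd_mul i2 hW₁.aesm.restrict (ae_of_all _ hW₁.abs_le)
      refine Integrable.congr this (ae_of_all _ fun x => ?_)
      simp only; ring
    have i4 : IntegrableOn (fun x => φ' x * h' x) (Iic 0) :=
      hφ'L.integrable_mul (hcut.memLp_der.restrict _)
    have h1 := hp.integral_Iic 0 i1 (i3.add i4)
    have h2 : h 0 = 0 := by
      simp only [hh]; rw [indicator_of_mem (by simp), hβ]; field_simp [(hφ.pos 0).ne']; ring
    rw [h2, mul_zero] at h1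
    have h3 : form W₁ U U' h h' = β * ∫ x in Iic 0, (W₁ x * φ x * h x + φ' x * h' x) := by
      rw [← integral_const_mul, ← integral_indicator measurableSet_Iic]
      unfold form
      congr 1; funext x
      by_cases hx : x ≤ 0
      · rw [indicator_of_mem (by exact hx), hU_le x hx, hU'_le x hx]; ring
      · rw [indicator_of_notMem (by exact hx), hh_gt x (not_le.1 hx), hh'_gt x (not_le.1 hx)]; ring
    rw [h3, h1, mul_zero]
  have hsplit : form W₁ U U' U U' = A - form W₁ h h' h h' := by
    have h1 := form_add_mul hW₁ hU hcut 1
    have e1 : (fun x => U x + 1 * h x) = w := by funext x; simp [hUdef]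
    have e2 : (fun x => U' x + 1 * h' x) = w' := by funext x; simp [hUdef']
    rw [e1, e2, hwA, horth] at h1
    linarith
  have hWb := isBdd_interface hW₁ hW₂
  have hΓb := isBdd_interface hΓ₁ hΓ₂
  have hformU : form (interface W₁ W₂) U U' U U' = form W₁ U U' U U' + β ^ 2 * J := by
    have h1 : form (interface W₁ W₂) U U' U U' - form W₁ U U' U U'
        = ∫ x in Iic 0, β ^ 2 * ((W₂ x - W₁ x) * φ x ^ 2) := by
      unfold form
      rw [← integral_sub (integrable_form hWb hU hU) (integrable_form hW₁ hU hU),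
        ← integral_indicator measurableSet_Iic]
      congr 1; funext x
      by_cases hx : x ≤ 0
      · rw [indicator_of_mem (by exact hx), hU_le x hx, hU'_le x hx, interface,
          if_neg (not_lt.2 hx)]; ring
      · rw [indicator_of_notMem (by exact hx), interface, if_pos (not_le.1 hx)]; ring
    rw [integral_const_mul] at h1
    linarith
  set Q := ∫ x, h x ^ 2 with hQ
  have hQ0 : 0 ≤ Q := integral_nonneg fun x => sq_nonneg _
  set X := Q + β ^ 2 * P with hX
  have hX0 : 0 ≤ X := by positivity
  set a := form (interface W₁ W₂) U U' U U' with ha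
  have ha0 : 0 ≤ a := hco.form_nonneg hδ hU
  have haX : a ≤ A - η * X := by
    have h1 := hco₁ h h' hcut
    have h2 : Q ≤ normSq h h' := by
      have : 0 ≤ ∫ x, h' x ^ 2 := integral_nonneg fun x => sq_nonneg _
      rw [normSq]; linarith
    have h3 : η * Q ≤ form W₁ h h' h h' :=
      (mul_le_mul hηδ h2 hQ0 hδ.le).trans h1
    have h4 : β ^ 2 * (η * P) ≤ β ^ 2 * (-J) := mul_le_mul_of_nonneg_left hηJ (sq_nonneg _)
    rw [hformU, hsplit, hX]
    linarith
  -- the potential energy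
  set T := C * (m * L) ^ (r - 2) with hT
  have hmL : 0 ≤ m * L := by positivity
  have hT0 : 0 ≤ T := by positivity
  -- The constant `3` collects the loss of `w`, with `w² ≤ 2 h² + 2 (β φ)²`, and that of `β φ`
  -- itself. No sign of `Γ₁` or `Γ₂` is used.
  have hpotU : A - 3 * T * X ≤ pot (interface Γ₁ Γ₂) r U := by
    have iU := hΓb.integrable_mul (hU.integrable_rpow hr)
    have iw := hΓ₁.integrable_mul (hwH.integrable_rpow hr)
    have i1 : Integrable ((Iic (0 : ℝ)).indicator fun x => 3 * T * β ^ 2 * φ x ^ 2) :=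
      (integrable_indicator_iff measurableSet_Iic).2 (hφsq.const_mul _)
    have i2 : Integrable (fun x => 2 * T * h x ^ 2) := hcut.memLp.integrable_sq.const_mul _
    have h1 : ∫ x, (Γ₁ x * |w x| ^ r - interface Γ₁ Γ₂ x * |U x| ^ r)
        ≤ ∫ x, ((Iic (0 : ℝ)).indicator (fun x => 3 * T * β ^ 2 * φ x ^ 2) x
          + 2 * T * h x ^ 2) := by
      refine integral_mono (iw.sub iU) (i1.add i2) fun x => ?_
      simp only
      by_cases hx : x ≤ 0
      · rw [indicator_of_mem (by exact hx), interface, if_neg (not_lt.2 hx), hU_le x hx]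
        have hwle : |w x| ≤ m * L := (hwm x hx).trans (le_mul_of_one_le_right hm0.le hL1)
        have hφle : |β * φ x| ≤ m * L := by
          have h2 : φ x ≤ M := by
            have h3 := (le_abs_self _).trans (hM x)
            have h4 : Real.exp (κ * x) ≤ 1 :=
              Real.exp_le_one_iff.2 (mul_nonpos_of_nonneg_of_nonpos hκ.le hx)
            nlinarith
          have hφ0 := hφ.pos 0
          rw [abs_mul, abs_of_pos (hφ.pos x), hβ, abs_div, abs_of_pos hφ0]
          calc |w 0| / φ 0 * φ x ≤ m / φ 0 * M := by
                have := hwm 0 le_rfl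
                have := (hφ.pos x).le
                gcongr
            _ = m * (M / φ 0) := by ring
            _ ≤ m * L := mul_le_mul_of_nonneg_left (by linarith) hm0.le
        have e1 := abs_rpow_le_mul_sq hr hwle
        have e2 := abs_rpow_le_mul_sq hr hφle
        have e3 : Γ₁ x * |w x| ^ r ≤ C * ((m * L) ^ (r - 2) * w x ^ 2) :=
          mul_le_mul ((le_abs_self _).trans (hΓ₁.abs_le x)) e1
            (Real.rpow_nonneg (abs_nonneg _) _) hC
        have e4 : -(Γ₂ x * |β * φ x| ^ r) ≤ C * ((m * L) ^ (r - 2) * (β * φ x) ^ 2) := by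
          rw [← neg_mul]
          exact mul_le_mul ((neg_le_abs _).trans (hΓ₂.abs_le x)) e2
            (Real.rpow_nonneg (abs_nonneg _) _) hC
        have e5 : w x ^ 2 ≤ 2 * h x ^ 2 + 2 * (β * φ x) ^ 2 := by
          have : w x = h x + β * φ x := by
            simp only [hh]; rw [indicator_of_mem (by exact hx)]; ring
          rw [this]; nlinarith [sq_nonneg (h x - β * φ x)]
        have e6 := mul_le_mul_of_nonneg_left e5 hT0
        rw [← mul_assoc, ← hT] at e3 e4
        have e7 : 3 * T * β ^ 2 * φ x ^ 2 + 2 * T * h x ^ 2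
            = T * (2 * h x ^ 2 + 2 * (β * φ x) ^ 2) + T * (β * φ x) ^ 2 := by ring
        rw [e7]
        linarith
      · rw [indicator_of_notMem (by exact hx), interface, if_pos (not_le.1 hx),
          hU_gt x (not_le.1 hx), sub_self, zero_add]
        positivity
    rw [integral_sub iw iU, integral_add i1 i2, integral_indicator measurableSet_Iic,
      integral_const_mul, integral_const_mul] at h1
    change pot Γ₁ r w - pot (interface Γ₁ Γ₂) r U ≤ _ at h1
    rw [hwP] at h1
    have h2 : 0 ≤ T * Q := mul_nonneg hT0 hQ0
    have h3 : 3 * T * X = 3 * T * Q + 3 * T * β ^ 2 * P := by rw [hX]; ring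
    rw [h3]
    change A - pot (interface Γ₁ Γ₂) r U ≤ 3 * T * β ^ 2 * P + 2 * T * Q at h1
    linarith
  have hratio : pot (interface Γ₁ Γ₂) r U ≤ a := by
    have h1 := hS U U' hU
    rcases ha0.eq_or_lt with h0 | h0
    · rw [← ha, ← h0, Real.zero_rpow (by linarith), mul_zero] at h1
      rwa [← h0]
    · have h2 : a ^ (r / 2) = a ^ (r / 2 - 1) * a := by
        rw [Real.rpow_sub_one h0.ne']; field_simp
      have h3 : a ^ (r / 2 - 1) ≤ A ^ (r / 2 - 1) :=
        Real.rpow_le_rpow ha0 (haX.trans (by nlinarith)) (by linarith)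
      have h4 := hu.mul_rpow_eq_one hδ hco₁
      have h5 : 0 ≤ a ^ (r / 2) := Real.rpow_nonneg ha0 _
      calc pot (interface Γ₁ Γ₂) r U ≤ S * a ^ (r / 2) := h1
        _ ≤ S₁ * a ^ (r / 2) := mul_le_mul_of_nonneg_right hle h5
        _ = (S₁ * a ^ (r / 2 - 1)) * a := by rw [h2]; ring
        _ ≤ (S₁ * A ^ (r / 2 - 1)) * a := by gcongr
        _ = a := by rw [h4, one_mul]
  -- `A - 3 T X ≤ B(U) ≤ a ≤ A - η X` with `3 T < η` leaves no other possibility.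
  have hXz : X = 0 := by
    have h1 : (η - 3 * T) * X ≤ 0 := by linarith
    have h2 : 0 < η - 3 * T := by rw [hT]; linarith
    by_contra hcon
    have : 0 < X := lt_of_le_of_ne hX0 (Ne.symm hcon)
    nlinarith
  have hβP : 0 ≤ β ^ 2 * P := by positivity
  have hβ0 : β = 0 := by
    have h1 : β ^ 2 * P = 0 := by linarith
    have h2 := (mul_eq_zero.1 h1).resolve_right hP0.ne'
    exact pow_eq_zero_iff (two_ne_zero) |>.1 h2
  have hhz : ∀ x, h x = 0 := by
    have h1 : Q = 0 := by linarith
    have h2 := (integral_eq_zero_iff_of_nonneg (fun x => sq_nonneg (h x))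
      hcut.memLp.integrable_sq).1 h1
    have h3 := (hcut.continuous.pow 2).ae_eq_iff_eq volume continuous_const |>.1 h2
    intro x
    have h4 : h x ^ 2 = 0 := congrFun h3 x
    exact pow_eq_zero_iff (two_ne_zero) |>.1 h4
  obtain ⟨x, hx, hxne⟩ := hne (-n)
  apply hxne
  have h1 := hhz (x + n)
  simp only [hh] at h1
  rw [indicator_of_mem (by simp only [mem_Iic]; linarith), hβ0] at h1
  simpa [hw] using h1

/-- `φ'' = W φ ≥ 0` makes `φ'` increasing, and `φ'` tends to zero at `-∞`, so `φ' ≥ 0`. Integrating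
`φ'' ≥ k φ(y)` twice from `y` gives quadratic growth. -/
lemma BlochData.growth {W φ φ' : ℝ → ℝ} {κ k : ℝ} (hκ : 0 < κ) (h : BlochData W κ φ φ')
    (hk : 0 ≤ k) (hW : ∀ x, k ≤ W x) :
    Monotone φ ∧ ∀ x y, y ≤ x → φ y * (1 + k * (x - y) ^ 2 / 2) ≤ φ x := by
  have hmono' : Monotone φ' := by
    intro a b hab
    have h1 := h.prim'.sub_eq a b
    have h2 : 0 ≤ ∫ x in a..b, W x * φ x :=
      intervalIntegral.integral_nonneg hab fun x _ => mul_nonneg (hk.trans (hW x)) (h.pos x).le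
    linarith
  have hpos' : ∀ x, 0 ≤ φ' x := fun x =>
    le_of_tendsto (h.tendsto' hκ) (by
      filter_upwards [eventually_le_atBot x] with y hy using hmono' hy)
  have hmono : Monotone φ := by
    intro a b hab
    have h1 := h.prim.sub_eq a b
    have h2 : 0 ≤ ∫ x in a..b, φ' x := intervalIntegral.integral_nonneg hab fun x _ => hpos' x
    linarith
  refine ⟨hmono, fun x y hyx => ?_⟩
  have hlow : ∀ t ∈ Icc y x, k * φ y * (t - y) ≤ φ' t := by
    intro t ht
    have h1 := h.prim'.sub_eq y t
    have h2 : ∫ s in y..t, k * φ y ≤ ∫ s in y..t, W s * φ s := by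
      refine intervalIntegral.integral_mono_on ht.1 (by simp) (h.prim'.intervalIntegrable y t)
        fun s hs => mul_le_mul (hW s) (hmono hs.1) (h.pos y).le (hk.trans (hW s))
    rw [intervalIntegral.integral_const, smul_eq_mul] at h2
    linarith [hpos' y]
  have h1 := h.prim.sub_eq y x
  have h2 : ∫ t in y..x, k * φ y * (t - y) ≤ ∫ t in y..x, φ' t :=
    intervalIntegral.integral_mono_on hyx
      (Continuous.intervalIntegrable (by fun_prop) _ _) (h.prim.intervalIntegrable y x) hlow
  rw [intervalIntegral.integral_const_mul, intervalIntegral.integral_comp_sub_right (fun t => t) y,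
    integral_id, sub_self] at h2
  nlinarith

/-! ### Part (a): verification of the variational hypotheses and conclusion. -/

lemma IsBdd.mono {W : ℝ → ℝ} {C C' : ℝ} (h : IsBdd W C) (hC : C ≤ C') : IsBdd W C' :=
  ⟨h.aesm, fun x => (h.abs_le x).trans hC⟩

lemma IsCoefficient.exists_isBdd {f : ℝ → ℝ} (h : IsCoefficient f) : ∃ C, IsBdd f C := by
  obtain ⟨C, hC⟩ := h.bounded
  exact ⟨C, h.measurable.aestronglyMeasurable, hC⟩

/-- At a Lebesgue point `x₀` with `Γ x₀ > 0`, choose `ρ` with `∫ |Γ - Γ x₀| < ρ Γ x₀` over the ball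
of radius `ρ`. A bump equal to one on the ball of radius `ρ / 2`, which has length `ρ`, gains at
least `ρ Γ x₀`. -/
lemma exists_pot_pos {Γ : ℝ → ℝ} {C r : ℝ} (hr : 2 < r) (hΓ : IsBdd Γ C)
    (hpos : 0 < essSup Γ volume) : ∃ u v, IsH1 u v ∧ 0 < pot Γ r u := by
  have hl : LocallyIntegrable Γ volume :=
    (memLp_top_of_bound hΓ.aesm C (ae_of_all _ hΓ.abs_le)).locallyIntegrable (by simp)
  have hfreq : ∃ᶠ x in ae volume, 0 < Γ x := by
    intro hcon
    refine absurd hpos (not_lt.2 (limsup_le_of_le ?_ (hcon.mono fun x hx => not_lt.1 hx)))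
    exact IsBoundedUnder.isCoboundedUnder_le
      ⟨-C, eventually_map.2 (ae_of_all _ fun x => (abs_le.1 (hΓ.abs_le x)).1)⟩
  obtain ⟨x₀, hx0, hx⟩ := (hfreq.and_eventually
    (IsUnifLocDoublingMeasure.ae_tendsto_average_norm_sub volume hl 1)).exists
  have hlim := hx (l := 𝓝[>] (0 : ℝ)) (fun _ => x₀) (fun ρ => ρ) tendsto_id
    (by filter_upwards [self_mem_nhdsWithin] with ρ hρ
        exact Metric.mem_closedBall_self (by rw [one_mul]; exact le_of_lt hρ))
  obtain ⟨ρ, hρ1, hρ⟩ := ((hlim.eventually_lt_const (half_pos hx0)).and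
    self_mem_nhdsWithin).exists
  replace hρ : 0 < ρ := hρ
  rw [setAverage_eq, Measure.real, Real.volume_closedBall,
    ENNReal.toReal_ofReal (by positivity), smul_eq_mul, inv_mul_lt_iff₀ (by positivity)] at hρ1
  let f : ContDiffBump x₀ := ⟨ρ / 2, ρ, by positivity, by linarith⟩
  have hf := IsH1.of_contDiff (φ := f) f.contDiff f.hasCompactSupport
  refine ⟨_, _, hf, ?_⟩
  have i1 : Integrable ((Metric.closedBall x₀ (ρ / 2)).indicator fun _ => Γ x₀) :=
    (integrable_indicator_iff Metric.isClosed_closedBall.measurableSet).2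
      (integrableOn_const (isCompact_closedBall _ _).measure_ne_top (by simp))
  have i2 : Integrable ((Metric.closedBall x₀ ρ).indicator fun x => ‖Γ x - Γ x₀‖) :=
    (integrable_indicator_iff Metric.isClosed_closedBall.measurableSet).2
      ((hl.integrableOn_isCompact (isCompact_closedBall x₀ ρ)).sub
        (integrableOn_const (isCompact_closedBall _ _).measure_ne_top (by simp))).norm
  have hle : ∫ x, ((Metric.closedBall x₀ (ρ / 2)).indicator (fun _ => Γ x₀) x
      - (Metric.closedBall x₀ ρ).indicator (fun x => ‖Γ x - Γ x₀‖) x) ≤ pot Γ r f := by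
    refine integral_mono (i1.sub i2) (hΓ.integrable_mul (hf.integrable_rpow hr)) fun x => ?_
    simp only
    have hf0 : 0 ≤ f x := f.nonneg
    have hf1 : f x ≤ 1 := f.le_one
    have hr0 : 0 ≤ f x ^ r := Real.rpow_nonneg hf0 _
    have hr1 : f x ^ r ≤ 1 := Real.rpow_le_one hf0 hf1 (by linarith)
    rw [abs_of_nonneg hf0]
    have e : Γ x * f x ^ r = Γ x₀ * f x ^ r + (Γ x - Γ x₀) * f x ^ r := by ring
    have e1 : (Metric.closedBall x₀ (ρ / 2)).indicator (fun _ => Γ x₀) x ≤ Γ x₀ * f x ^ r := by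
      by_cases hx : x ∈ Metric.closedBall x₀ (ρ / 2)
      · rw [indicator_of_mem hx, f.one_of_mem_closedBall hx, Real.one_rpow, mul_one]
      · rw [indicator_of_notMem hx]; positivity
    have e2 : -(Metric.closedBall x₀ ρ).indicator (fun x => ‖Γ x - Γ x₀‖) x
        ≤ (Γ x - Γ x₀) * f x ^ r := by
      by_cases hx : x ∈ Metric.closedBall x₀ ρ
      · rw [indicator_of_mem hx, Real.norm_eq_abs]
        have h1 := neg_abs_le (Γ x - Γ x₀)
        have h2 := abs_nonneg (Γ x - Γ x₀)
        nlinarith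
      · have h3 : f x = 0 := f.zero_of_le_dist (by
          rw [Metric.mem_closedBall, not_le] at hx; exact hx.le)
        rw [indicator_of_notMem hx, h3, Real.zero_rpow (by linarith)]; simp
    rw [e]; linarith
  rw [integral_sub i1 i2, integral_indicator Metric.isClosed_closedBall.measurableSet,
    integral_indicator Metric.isClosed_closedBall.measurableSet, setIntegral_const, Measure.real,
    Real.volume_closedBall, ENNReal.toReal_ofReal (by positivity), smul_eq_mul] at hle
  nlinarith

/-- A function good for the right periodic problem is moved far to the right, where the interface
problem looks periodic. -/
lemma exists_pot_interface_pos {Γ₁ Γ₂ : ℝ → ℝ} {C r : ℝ} (hr : 2 < r) (hΓ₁ : IsBdd Γ₁ C)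
    (hΓ₂ : IsBdd Γ₂ C) (pΓ₁ : Function.Periodic Γ₁ 1) (hpos : ∃ u v, IsH1 u v ∧ 0 < pot Γ₁ r u) :
    ∃ u v, IsH1 u v ∧ 0 < pot (interface Γ₁ Γ₂) r u := by
  obtain ⟨u, v, huv, h0⟩ := hpos
  have h1 := pot_tendsto hr
    (fun n : ℕ => (isBdd_interface hΓ₁ hΓ₂).comp_add ((n : ℤ) : ℝ))
    (tendsto_interface_atTop (W₂ := Γ₂) pΓ₁ tendsto_natCast_atTop_atTop) huv
  obtain ⟨n, hn⟩ := (h1.eventually_const_lt h0).exists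
  refine ⟨_, _, huv.comp_add (-((n : ℤ) : ℝ)), ?_⟩
  rw [← pot_comp_add _ _ _ ((n : ℤ) : ℝ)]
  simpa using hn

/-- Translates of the interface potential converge pointwise to the periodic ones, and the form of a
fixed function converges with them, so the same constant survives. -/
lemma Coercive.of_interface {W₁ W₂ : ℝ → ℝ} {C δ : ℝ} (hW₁ : IsBdd W₁ C) (hW₂ : IsBdd W₂ C)
    (pW₁ : Function.Periodic W₁ 1) (pW₂ : Function.Periodic W₂ 1)
    (hco : Coercive (interface W₁ W₂) δ) : Coercive W₁ δ ∧ Coercive W₂ δ := by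
  have hb := isBdd_interface hW₁ hW₂
  constructor
  · exact Coercive.of_tendsto (fun n : ℕ => hb.comp_add ((n : ℤ) : ℝ)) (fun n => hco.comp_add _)
      (tendsto_interface_atTop pW₁ tendsto_natCast_atTop_atTop)
  · exact Coercive.of_tendsto (fun n : ℕ => hb.comp_add ((-(n : ℤ) : ℤ) : ℝ))
      (fun n => hco.comp_add _) (tendsto_interface_atBot pW₂
        (tendsto_neg_atTop_atBot.comp tendsto_natCast_atTop_atTop))

lemma hasUniqueBlochMode_of_coercive {V : ℝ → ℝ} {C δ lam : ℝ} (hW : IsBdd (fun x => V x - lam) C)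
    (pV : Function.Periodic V 1) (hδ : 0 < δ) (hco : Coercive (fun x => V x - lam) δ) :
    HasUniqueBlochMode V lam := by
  obtain ⟨κ, q, h⟩ := exists_isLeftBlochMode hW (fun x => by simp only [pV x]) hδ hco
  refine ⟨(κ, q), h, fun m hm => ?_⟩
  obtain ⟨h1, h2⟩ := IsLeftBlochMode.unique hW hm h
  exact Prod.ext h1 h2

lemma RatioAttains.le {W Γ : ℝ → ℝ} {δ r S S' : ℝ} (hδ : 0 < δ) (hco : Coercive W δ)
    (h : RatioAttains W Γ r S) (h' : RatioLe W Γ r S') : S ≤ S' := by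
  obtain ⟨u, v, huv, ⟨x, hx⟩, h1⟩ := h
  exact le_of_mul_le_mul_right (h1.trans (h' u v huv))
    (Real.rpow_pos_of_pos (hco.form_pos hδ huv hx) _)

/-- Existence of strong ground states at an interface under the Bloch mode condition. -/
theorem exists_strongGroundState {V₁ V₂ Γ₁ Γ₂ : ℝ → ℝ} {p lam : ℝ}
    (hV₁ : IsCoefficient V₁) (hV₂ : IsCoefficient V₂)
    (hΓ₁ : IsCoefficient Γ₁) (hΓ₂ : IsCoefficient Γ₂)
    (hΓ₁_pos : 0 < essSup Γ₁ volume) (hΓ₂_pos : 0 < essSup Γ₂ volume) (hp : 1 < p)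
    (hspec : PositiveSpectrum (fun x => interface V₁ V₂ x - lam))
    (hground : groundEnergy (fun x => V₁ x - lam) Γ₁ p
      ≤ groundEnergy (fun x => V₂ x - lam) Γ₂ p) :
    HasUniqueBlochMode V₁ lam ∧ (BlochCondition V₁ V₂ lam →
      ∃ w : H1, IsStrongGroundState (fun x => interface V₁ V₂ x - lam) (interface Γ₁ Γ₂) p w) := by
  have hr : 2 < p + 1 := by linarith
  obtain ⟨C₁, hC₁⟩ := hV₁.exists_isBdd
  obtain ⟨C₂, hC₂⟩ := hV₂.exists_isBdd
  obtain ⟨C₃, hC₃⟩ := hΓ₁.exists_isBdd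
  obtain ⟨C₄, hC₄⟩ := hΓ₂.exists_isBdd
  set C := (C₁ + |lam|) + (C₂ + |lam|) + C₃ + C₄ with hC
  have n1 := (hC₁.sub_const lam).nonneg
  have n2 := (hC₂.sub_const lam).nonneg
  have n3 := hC₃.nonneg
  have n4 := hC₄.nonneg
  set W₁ : ℝ → ℝ := fun x => V₁ x - lam with hW₁
  set W₂ : ℝ → ℝ := fun x => V₂ x - lam with hW₂
  have b1 : IsBdd W₁ C := (hC₁.sub_const lam).mono (by linarith)
  have b2 : IsBdd W₂ C := (hC₂.sub_const lam).mono (by linarith)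
  have b3 : IsBdd Γ₁ C := hC₃.mono (by linarith)
  have b4 : IsBdd Γ₂ C := hC₄.mono (by linarith)
  have p1 : Function.Periodic W₁ 1 := fun x => by simp only [hW₁, hV₁.periodic x]
  have p2 : Function.Periodic W₂ 1 := fun x => by simp only [hW₂, hV₂.periodic x]
  have hWe : (fun x => interface V₁ V₂ x - lam) = interface W₁ W₂ := by
    funext x
    simp only [interface]
    split_ifs <;> rfl
  rw [hWe] at hspec ⊢
  have hW := isBdd_interface b1 b2
  have hΓ := isBdd_interface b3 b4
  obtain ⟨δ, hδ, hco⟩ := exists_coercive_of_positiveSpectrum hW hspec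
  obtain ⟨hco₁, hco₂⟩ := hco.of_interface b1 b2 p1 p2
  refine ⟨hasUniqueBlochMode_of_coercive b1 hV₁.periodic hδ hco₁, ?_⟩
  rintro ⟨κ, q, hq, hneg⟩
  have hpos₁ := exists_pot_pos hr b3 hΓ₁_pos
  have hpos₂ := exists_pot_pos hr b4 hΓ₂_pos
  obtain ⟨S, hS0, hS, w, w', hw, hone, hpot⟩ := exists_ratio_sup hr hΓ hδ hco
    (exists_pot_interface_pos hr b3 b4 hΓ₁.periodic hpos₁)
  obtain ⟨S₁, hS₁0, hS₁, hat₁⟩ := exists_periodic_maximizer hr b1 b3 p1 hΓ₁.periodic hδ hco₁ hpos₁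
  obtain ⟨S₂, hS₂0, hS₂, hat₂⟩ := exists_periodic_maximizer hr b2 b4 p2 hΓ₂.periodic hδ hco₂ hpos₂
  obtain ⟨u₁, v₁, h₁⟩ := exists_isExtremal hr hδ hco₁ hS₁0 hS₁ hat₁
  obtain ⟨u₂, v₂, h₂⟩ := exists_isExtremal hr hδ hco₂ hS₂0 hS₂ hat₂
  have hS21 := h₁.ratio_le_of_groundEnergy_le hp b1 b3 b2 b4 hδ hco₁ hco₂ hS₁ hS₂ hS₁0 hS₂0 h₂ hground
  -- The Bloch condition enters only here; it shows `S > S₁`, which rules out escape to either side.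
  have hfalse : S ≤ S₁ → False := fun hle => by
    obtain ⟨φ', hφ⟩ := hq.exists_blochData b1
    refine h₁.not_ratioLe hr b1 b2 b3 b4 p1 p2 hΓ₁.periodic hδ hco hco₁ hS₁0.le
      (fun b => h₁.exists_ne_zero_Iic hp b1 b3 hδ hco₁ hS₁ b) hq.kappa_pos hφ ?_ hle hS
    refine lt_of_eq_of_lt ?_ hneg
    congr 1; funext x
    simp only [hW₁, hW₂]
    rw [mul_pow, ← Real.exp_nat_mul]
    push_cast
    ring_nf
  rcases ratioAttains_or hr b1 b2 b3 b4 p1 p2 hΓ₁.periodic hΓ₂.periodic hδ hco hS0 hS hw hone hpot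
    with h | h | h
  · obtain ⟨u, v, hu⟩ := exists_isExtremal hr hδ hco hS0 hS h
    exact hu.isStrongGroundState hp hW hΓ hδ hco hS
  · exact (hfalse (h.le hδ hco₁ hS₁)).elim
  · exact (hfalse ((h.le hδ hco₂ hS₂).trans hS21)).elim

/-! ### Part (b): the Bloch condition for very negative `lam`. -/

/-- For very negative `lam` the Bloch mode concentrates at the right end of the period. -/
theorem exists_forall_lt_blochCondition {V₁ V₂ : ℝ → ℝ} (hV₁ : IsCoefficient V₁)
    (hV₂ : IsCoefficient V₂) {ε : ℝ} (hε : 0 < ε) (hc₁ : ContinuousOn V₁ (Ico (-ε) 0))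
    (hc₂ : ContinuousOn V₂ (Ico (-ε) 0)) (hlt : ∀ x ∈ Ico (-ε) 0, V₂ x < V₁ x) :
    ∃ Λ : ℝ, ∀ lam < Λ, HasUniqueBlochMode V₁ lam ∧ BlochCondition V₁ V₂ lam := by
  wlog hε1 : ε ≤ 1 generalizing ε
  · have hsub : Ico (-1 : ℝ) 0 ⊆ Ico (-ε) 0 := Ico_subset_Ico_left (by linarith)
    exact this one_pos (hc₁.mono hsub) (hc₂.mono hsub) (fun x hx => hlt x (hsub hx)) le_rfl
  obtain ⟨C₁, hC₁⟩ := hV₁.exists_isBdd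
  obtain ⟨C₂, hC₂⟩ := hV₂.exists_isBdd
  have n1 := hC₁.nonneg
  have n2 := hC₂.nonneg
  set C := C₁ + C₂ with hC
  -- a uniform gap on a compact subinterval
  obtain ⟨m, hm0, hm⟩ : ∃ m : ℝ, 0 < m ∧ ∀ x ∈ Icc (-(2 * ε / 3)) (-(ε / 3)), V₂ x - V₁ x ≤ -m := by
    have hsub : Icc (-(2 * ε / 3)) (-(ε / 3)) ⊆ Ico (-ε) 0 := fun x hx =>
      ⟨by linarith [hx.1], by linarith [hx.2]⟩
    obtain ⟨y, hy, hmax⟩ := isCompact_Icc.exists_isMaxOn (nonempty_Icc.2 (by linarith))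
      ((hc₂.mono hsub).sub (hc₁.mono hsub))
    refine ⟨V₁ y - V₂ y, sub_pos.2 (hlt y (hsub hy)), fun x hx => ?_⟩
    have := hmax hx
    simp only [mem_ofPred_eq, Pi.sub_apply] at this
    linarith
  -- `τ` is chosen so that `m (ε/3) τ > C`: growth of `φ` by this factor from `-ε` to `-2ε/3` lets
  -- the middle third of `[-ε, 0]` outweigh `[-1, -ε]`.
  set τ := 1 + 3 * C / (m * ε) with hτ
  have hCτ : 0 ≤ 3 * C / (m * ε) := by positivity
  -- Over the distance `ε / 3` the growth factor is at least `1 + k ε² / 18 ≥ τ`. The summand `1`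
  -- ensures `k ≥ 1`, so the form dominates the `H¹` norm.
  set k := 18 / ε ^ 2 * τ + 1 with hk
  have hk1 : 1 ≤ k := by
    have : 0 ≤ 18 / ε ^ 2 * τ := by positivity
    linarith
  refine ⟨-(C₁ + k), fun lam hlam => ?_⟩
  have hWk : ∀ x, k ≤ V₁ x - lam := fun x => by
    linarith [(abs_le.1 (hC₁.abs_le x)).1]
  have hW := hC₁.sub_const lam
  have hco : Coercive (fun x => V₁ x - lam) 1 := by
    intro u v huv
    rw [one_mul, normSq_eq_form huv]
    refine integral_mono (integrable_form (C := 1) ⟨aestronglyMeasurable_const, fun _ => by simp⟩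
      huv huv) (integrable_form hW huv huv) fun x => ?_
    have := mul_le_mul_of_nonneg_right (hk1.trans (hWk x)) (mul_self_nonneg (u x))
    simp only; linarith
  have huniq := hasUniqueBlochMode_of_coercive hW hV₁.periodic one_pos hco
  refine ⟨huniq, ?_⟩
  obtain ⟨⟨κ, q⟩, hq, -⟩ := huniq
  refine ⟨κ, q, hq, ?_⟩
  obtain ⟨φ', hφ⟩ := hq.exists_blochData hW
  set φ : ℝ → ℝ := fun x => q x * Real.exp (κ * x) with hφdef
  obtain ⟨hmono, hgrow⟩ := hφ.growth hq.kappa_pos (by linarith) hWk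
  have he : ∀ x, (V₂ x - V₁ x) * (q x) ^ 2 * Real.exp (2 * κ * x) = (V₂ x - V₁ x) * φ x ^ 2 := by
    intro x
    simp only [hφdef]
    rw [mul_pow, ← Real.exp_nat_mul]
    push_cast
    ring_nf
  simp only at hq ⊢
  simp_rw [he]
  have hφc : Continuous φ := hφ.prim.continuous
  have hVl : LocallyIntegrable (fun x => V₂ x - V₁ x) volume :=
    (memLp_top_of_bound (hC₂.aesm.sub hC₁.aesm) (C₂ + C₁) (ae_of_all _ fun x =>
      (abs_sub _ _).trans (add_le_add (hC₂.abs_le x) (hC₁.abs_le x)))).locallyIntegrable (by simp)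
  have hFi : ∀ a b, IntervalIntegrable (fun x => (V₂ x - V₁ x) * φ x ^ 2) volume a b :=
    locallyIntegrable_intervalIntegrable (hVl.smul_continuous (hφc.pow 2))
  have hφ0 := fun x => (hφ.pos x).le
  -- On the outer thirds of `[-ε, 0]` only the sign of `V₂ - V₁` is used, since the gap may close at
  -- `0`.
  rw [← intervalIntegral.integral_add_adjacent_intervals (hFi (-1) (-ε)) (hFi (-ε) 0),
    ← intervalIntegral.integral_add_adjacent_intervals (hFi (-ε) (-(2 * ε / 3)))
      (hFi (-(2 * ε / 3)) 0),
    ← intervalIntegral.integral_add_adjacent_intervals (hFi (-(2 * ε / 3)) (-(ε / 3)))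
      (hFi (-(ε / 3)) 0)]
  have hnonpos : ∀ a b : ℝ, -ε ≤ a → a ≤ b → b ≤ 0 →
      ∫ x in a..b, (V₂ x - V₁ x) * φ x ^ 2 ≤ 0 := by
    intro a b ha hab hb
    have h1 : ∫ x in a..b, (V₂ x - V₁ x) * φ x ^ 2 ≤ ∫ x in a..b, (0 : ℝ) := by
      refine intervalIntegral.integral_mono_on_of_le_Ioo hab (hFi a b) (by simp) fun x hx => ?_
      exact mul_nonpos_of_nonpos_of_nonneg
        (by linarith [hlt x ⟨ha.trans hx.1.le, hx.2.trans_le hb⟩]) (sq_nonneg _)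
    simpa using h1
  have hA : ∫ x in (-1 : ℝ)..(-ε), (V₂ x - V₁ x) * φ x ^ 2 ≤ C * φ (-ε) ^ 2 := by
    have h1 : ∫ x in (-1 : ℝ)..(-ε), (V₂ x - V₁ x) * φ x ^ 2
        ≤ ∫ x in (-1 : ℝ)..(-ε), C * φ (-ε) ^ 2 := by
      refine intervalIntegral.integral_mono_on (by linarith) (hFi _ _) (by simp) fun x hx => ?_
      have h2 : V₂ x - V₁ x ≤ C := by
        have := (abs_le.1 (hC₁.abs_le x)).1
        have := (abs_le.1 (hC₂.abs_le x)).2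
        linarith
      have h3 : φ x ^ 2 ≤ φ (-ε) ^ 2 := pow_le_pow_left₀ (hφ0 x) (hmono hx.2) 2
      exact mul_le_mul h2 h3 (sq_nonneg _) (by linarith)
    rw [intervalIntegral.integral_const, smul_eq_mul] at h1
    have h2 : 0 ≤ C * φ (-ε) ^ 2 := mul_nonneg (by linarith) (sq_nonneg _)
    nlinarith
  have hB : ∫ x in (-(2 * ε / 3))..(-(ε / 3)), (V₂ x - V₁ x) * φ x ^ 2
      ≤ -(m * (ε / 3) * φ (-(2 * ε / 3)) ^ 2) := by
    have h1 : ∫ x in (-(2 * ε / 3))..(-(ε / 3)), (V₂ x - V₁ x) * φ x ^ 2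
        ≤ ∫ x in (-(2 * ε / 3))..(-(ε / 3)), -(m * φ (-(2 * ε / 3)) ^ 2) := by
      refine intervalIntegral.integral_mono_on (by linarith) (hFi _ _) (by simp) fun x hx => ?_
      have h2 := hm x hx
      have h3 : φ (-(2 * ε / 3)) ^ 2 ≤ φ x ^ 2 := pow_le_pow_left₀ (hφ0 _) (hmono hx.1) 2
      have h4 := mul_le_mul_of_nonneg_left h3 hm0.le
      have h5 := mul_le_mul_of_nonneg_right h2 (sq_nonneg (φ x))
      linarith
    rw [intervalIntegral.integral_const, smul_eq_mul] at h1
    refine h1.trans (le_of_eq ?_)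
    ring
  have hgr : τ * φ (-ε) ≤ φ (-(2 * ε / 3)) := by
    have h1 := hgrow (-(2 * ε / 3)) (-ε) (by linarith)
    have h2 : τ ≤ 1 + k * (-(2 * ε / 3) - -ε) ^ 2 / 2 := by
      have h3 : k * (-(2 * ε / 3) - -ε) ^ 2 / 2 = τ + ε ^ 2 / 18 := by
        rw [hk]; field_simp; ring
      rw [h3]; have := sq_nonneg ε; linarith
    have h4 := mul_le_mul_of_nonneg_right h2 (hφ0 (-ε))
    linarith
  have hφε := hφ.pos (-ε)
  have h1 : C * φ (-ε) ^ 2 < m * (ε / 3) * φ (-(2 * ε / 3)) ^ 2 := by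
    have h2 : (τ * φ (-ε)) ^ 2 ≤ φ (-(2 * ε / 3)) ^ 2 :=
      pow_le_pow_left₀ (by positivity) hgr 2
    have h3 : C < m * (ε / 3) * τ := by
      have h4 : m * (ε / 3) * τ = m * (ε / 3) + C := by rw [hτ]; field_simp
      rw [h4]
      have : 0 < m * (ε / 3) := by positivity
      linarith
    have h5 : τ ≤ τ ^ 2 := by nlinarith
    have h6 : C < m * (ε / 3) * τ ^ 2 :=
      h3.trans_le (mul_le_mul_of_nonneg_left h5 (by positivity))
    calc C * φ (-ε) ^ 2 < m * (ε / 3) * τ ^ 2 * φ (-ε) ^ 2 :=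
          mul_lt_mul_of_pos_right h6 (by positivity)
      _ = m * (ε / 3) * (τ * φ (-ε)) ^ 2 := by ring
      _ ≤ m * (ε / 3) * φ (-(2 * ε / 3)) ^ 2 := mul_le_mul_of_nonneg_left h2 (by positivity)
  have h2 := hnonpos (-ε) (-(2 * ε / 3)) le_rfl (by linarith) (by linarith)
  have h3 := hnonpos (-(ε / 3)) 0 (by linarith) (by linarith) le_rfl
  linarith

/-- In the degenerate case `V₂ - V₁` vanishes at `0` with positive derivative, so it is negative
just to the left of `0`. -/
lemma exists_gap_of_contDiffAt {V₁ V₂ : ℝ → ℝ} (h₁ : ContDiffAt ℝ 1 V₁ 0)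
    (h₂ : ContDiffAt ℝ 1 V₂ 0)
    (h : V₂ 0 < V₁ 0 ∨ (V₂ 0 = V₁ 0 ∧ deriv V₁ 0 < deriv V₂ 0)) :
    ∃ ε : ℝ, 0 < ε ∧ ContinuousOn V₁ (Ico (-ε) 0) ∧ ContinuousOn V₂ (Ico (-ε) 0) ∧
      ∀ x ∈ Ico (-ε) 0, V₂ x < V₁ x := by
  have hc₁ : ∀ᶠ x in 𝓝[<] (0 : ℝ), ContinuousAt V₁ x :=
    ((h₁.eventually (by simp)).mono fun x hx => hx.continuousAt).filter_mono nhdsWithin_le_nhds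
  have hc₂ : ∀ᶠ x in 𝓝[<] (0 : ℝ), ContinuousAt V₂ x :=
    ((h₂.eventually (by simp)).mono fun x hx => hx.continuousAt).filter_mono nhdsWithin_le_nhds
  have hlt : ∀ᶠ x in 𝓝[<] (0 : ℝ), V₂ x < V₁ x := by
    rcases h with h | ⟨h0, hd⟩
    · exact (h₂.continuousAt.eventually_lt h₁.continuousAt h).filter_mono nhdsWithin_le_nhds
    · have hd₁ := (h₁.differentiableAt (by simp)).hasDerivAt
      have hd₂ := (h₂.differentiableAt (by simp)).hasDerivAt
      have h3 := (hasDerivAt_iff_tendsto_slope.1 (hd₂.sub hd₁)).eventually_const_lt (sub_pos.2 hd)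
      have h4 : ∀ᶠ x in 𝓝[<] (0 : ℝ), 0 < slope (V₂ - V₁) 0 x :=
        h3.filter_mono (nhdsWithin_mono 0 fun x hx => ne_of_lt hx)
      filter_upwards [h4, self_mem_nhdsWithin] with x hx hx0
      replace hx0 : x < 0 := hx0
      rw [slope_def_field, Pi.sub_apply, Pi.sub_apply, h0, sub_self, sub_zero, sub_zero] at hx
      by_contra hcon
      push Not at hcon
      exact absurd hx (not_lt.2 (div_nonpos_of_nonneg_of_nonpos (by linarith) hx0.le))
  obtain ⟨l, hl, hI⟩ := mem_nhdsLT_iff_exists_Ico_subset.1 (hc₁.and (hc₂.and hlt))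
  refine ⟨-l, by simpa using hl, ?_⟩
  rw [neg_neg]
  exact ⟨fun x hx => (hI hx).1.continuousWithinAt, fun x hx => (hI hx).2.1.continuousWithinAt,
    fun x hx => (hI hx).2.2⟩

end InterfaceNLS

open InterfaceNLS in
theorem theorem2p8 (V₁ V₂ Γ₁ Γ₂ : ℝ → ℝ) (p : ℝ)
    (hV₁ : IsCoefficient V₁) (hV₂ : IsCoefficient V₂)
    (hΓ₁ : IsCoefficient Γ₁) (hΓ₂ : IsCoefficient Γ₂)
    (hΓ₁_pos : 0 < essSup Γ₁ MeasureTheory.volume)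
    (hΓ₂_pos : 0 < essSup Γ₂ MeasureTheory.volume)
    (hp : 1 < p) :
    -- part (a)
    (∀ lam : ℝ, PositiveSpectrum (fun x => interface V₁ V₂ x - lam) →
      groundEnergy (fun x => V₁ x - lam) Γ₁ p ≤ groundEnergy (fun x => V₂ x - lam) Γ₂ p →
        HasUniqueBlochMode V₁ lam ∧
        (BlochCondition V₁ V₂ lam →
          ∃ w : H1, IsStrongGroundState (fun x => interface V₁ V₂ x - lam)
            (interface Γ₁ Γ₂) p w)) ∧
    -- part (b)
    ((∃ ε : ℝ, 0 < ε ∧ ContinuousOn V₁ (Set.Ico (-ε) 0) ∧ ContinuousOn V₂ (Set.Ico (-ε) 0) ∧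
        ∀ x ∈ Set.Ico (-ε) 0, V₂ x < V₁ x) →
      ∃ Λ : ℝ, ∀ lam < Λ, HasUniqueBlochMode V₁ lam ∧ BlochCondition V₁ V₂ lam) ∧
    -- the particular case in part (b)
    (ContDiffAt ℝ 1 V₁ 0 → ContDiffAt ℝ 1 V₂ 0 →
      (V₂ 0 < V₁ 0 ∨ (V₂ 0 = V₁ 0 ∧ deriv V₁ 0 < deriv V₂ 0)) →
      ∃ Λ : ℝ, ∀ lam < Λ, HasUniqueBlochMode V₁ lam ∧ BlochCondition V₁ V₂ lam) := by
  refine ⟨fun lam h1 h2 => exists_strongGroundState hV₁ hV₂ hΓ₁ hΓ₂ hΓ₁_pos hΓ₂_pos hp h1 h2, ?_, ?_⟩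
  · rintro ⟨ε, hε, hc₁, hc₂, hlt⟩
    exact exists_forall_lt_blochCondition hV₁ hV₂ hε hc₁ hc₂ hlt
  · intro h₁ h₂ h
    obtain ⟨ε, hε, hc₁, hc₂, hlt⟩ := exists_gap_of_contDiffAt h₁ h₂ h
    exact exists_forall_lt_blochCondition hV₁ hV₂ hε hc₁ hc₂ hlt
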